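/- **Theorem 1.1.** Let $n \ge 2$ and let $X=(X_1,\dots,X_n)$ be a random vector in $\mathbb R^n$ which is isotropic, that is, $\mathbb E X_iX_j=\delta_{ij}$ for all $i,j\le n$, has mean zero, and satisfies $|X|^2=n$ almost surely. For $\theta$ in the unit sphere $\mathbb S^{n-1}$ put $F_\theta(x)=\mathbb P\{\theta_1X_1+\dots+\theta_nX_n\le x\}$, and let $\Phi$ be the standard normal distribution function. For distribution functions $F,G$ on the line let $$\rho(F,G)=\sup_{x\in\mathbb R}|F(x)-G(x)|,\qquad \omega(F,G)=\Big(\int_{-\infty}^\infty (F(x)-G(x))^2\,dx\Big)^{1/2}.$$ Let $\mathbb E_\theta$ denote the integral over $\mathbb S^{n-1}$ with respect to the normalized Lebesgue measure, and let $$m_p=\frac1{\sqrt n}\,\big(\mathbb E\langle X,Y\rangle^p\big)^{1/p},$$ where $Y$ is an independent copy of $X$. Then $\mathbb E_\theta\,\omega^2(F_\theta,\Phi)$ and $\mathbb E_\theta\,\rho^2(F_\theta,\Phi)$ are well defined and finite, and, with absolute constants $C,c_1,c_2>0$ (independent of $n$ and of the distribution of $X$), $$\Big|\,\mathbb E_\theta\,\omega^2(F_\theta,\Phi)-\frac{1}{16\sqrt\pi}\,\frac{m_3^3}{n^{3/2}}\Big|\le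 C\,\frac{m_4^4}{n^2}$$ and $$\mathbb E_\theta\,\rho^2(F_\theta,\Phi)\le \frac{c_1\log n}{n^{3/2}}\,m_3^3+\frac{c_2(\log n)^2}{n^2}\,m_4^4.$$ -/

import Mathlib

open MeasureTheory ProbabilityTheory

namespace RandomizedCLT

noncomputable section

/-- The normalized (rotation invariant, total mass one) Lebesgue measure on the unit sphere
of `ℝⁿ`. -/
def sphereMeasure (n : ℕ) : Measure (Metric.sphere (0 : EuclideanSpace ℝ (Fin n)) 1) :=
  ((volume : Measure (EuclideanSpace ℝ (Fin n))).toSphere Set.univ)⁻¹ •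
    (volume : Measure (EuclideanSpace ℝ (Fin n))).toSphere

/-- `X` is isotropic: `E X_i X_j = δ_{ij}`. For measurable `X`, the diagonal equations force every
`X_i ^ 2`, hence every product `X_i X_j`, to be integrable. -/
def IsIsotropic {n : ℕ} {Ω : Type*} [MeasurableSpace Ω] (P : Measure Ω)
    (X : Ω → EuclideanSpace ℝ (Fin n)) : Prop :=
  ∀ i j : Fin n, ∫ ω, X ω i * X ω j ∂P = if i = j then 1 else 0

/-- `F_θ`, the distribution function of the weighted sum
`S_θ = θ₁ X₁ + ⋯ + θₙ Xₙ = ⟨θ, X⟩`. -/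
def weightedCDF {n : ℕ} {Ω : Type*} [MeasurableSpace Ω] (P : Measure Ω)
    (X : Ω → EuclideanSpace ℝ (Fin n)) (θ : EuclideanSpace ℝ (Fin n)) (x : ℝ) : ℝ :=
  P.real {ω | inner ℝ θ (X ω) ≤ x}

/-- The standard normal distribution function `Φ`. -/
def normalCDF (x : ℝ) : ℝ := cdf (gaussianReal 0 1) x

/-- The Kolmogorov distance `ρ(F, G) = sup_x |F(x) - G(x)|` between distribution functions. -/
def kolmogorovDist (F G : ℝ → ℝ) : ℝ := ⨆ x : ℝ, |F x - G x|

/-- The `L²`-distance `ω(F, G) = (∫ (F(x) - G(x))² dx)^{1/2}` between distribution functions. -/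
def l2Dist (F G : ℝ → ℝ) : ℝ := Real.sqrt (∫ x : ℝ, (F x - G x) ^ 2)

/-- The moment functional `m_p(X) = n^{-1/2} (E ⟨X, Y⟩^p)^{1/p}`, with `Y` an independent copy
of `X`. The pair `(X, Y)` is realized on the product space as `(ω, ω') ↦ (X ω, X ω')`. -/
def momentFunctional {n : ℕ} {Ω : Type*} [MeasurableSpace Ω] (P : Measure Ω)
    (X : Ω → EuclideanSpace ℝ (Fin n)) (p : ℕ) : ℝ :=
  (1 / Real.sqrt n) *
    (∫ z : Ω × Ω, (inner ℝ (X z.1) (X z.2)) ^ p ∂(P.prod P)) ^ (1 / (p : ℝ))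

end

end RandomizedCLT

/-! Let `G` be a standard Gaussian vector in `ℝⁿ` independent of `X`. For a unit vector `θ`, `Φ` is
the law of `⟨θ, G⟩`, so `F_θ` and `Φ` are projections of two measures on `ℝⁿ`, and averaging a
quadratic distance over `θ` leaves an expression in the lengths of `X - Y`, `X - G` and `G` alone.
Put `‖X - Y‖² = 2n(1 - ξ)`, `‖X - G‖² = 2n(1 - η)`, `‖G‖² = n(1 - ζ)`; these are `overlap`,
`gaussianOverlap`, `radialDefect`. Both estimates reduce to the second difference `E w(ξ) - 2 E w(η)
+ E w(ζ)` for a function `w` on `(-∞, 1]`. Isotropy, the zero mean and `‖X‖² = n` make the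
contributions of the moments of order 0, 1, 2 cancel, while order 3 leaves exactly `E ξ³` and order
4 is at most a multiple of `E ξ⁴`, since `E ξ⁴ ≥ (E ξ²)² = 1/n²`. This is
`integrable_and_abs_second_difference_le`. Moreover `m_p^p = n^{p/2} E ξ^p`.

For `ω`, the squared `L²` distance is an energy distance (`integral_cdf_sub_cdf_sq`), and `E_θ |⟨θ,
a⟩|` is proportional to `‖a‖`. This gives `w(x) = √(1 - x)`, whose cubic Taylor coefficient `-1/16`
produces the constant of the expansion.

For `ρ`, Gaussian smoothing at scale `1/n` bounds the distance by `∫ |f_θ - φ| dt/t`, where `f_θ`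
and `φ` are the characteristic functions of the two laws. Cauchy-Schwarz on `[1/n, n²]` costs a
factor `3 log n` and leaves `∫ |f_θ - φ|² dt/t` (`sq_kolmogorovDist_le`). As `dt/t` is scale
invariant, its spherical average is controlled by Gaussian averages over all scales `σ`
(`lintegral_sphere_radial_le`). There the second difference returns with `w(x) = exp(-s(1 - x))`, `s
= σ²n`. Its cubic coefficient `e^{-s}s³/6` is integrable in `dσ/σ`; the quartic remainder, of order
`min(1, s)`, costs the second logarithm. -/

namespace RandomizedCLT

/-! ### Polar decomposition of the standard Gaussian measure. -/

section

section Polar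

variable {E : Type*} [NormedAddCommGroup E] [InnerProductSpace ℝ E] [FiniteDimensional ℝ E]
  [MeasurableSpace E] [BorelSpace E]

/-- The density of the standard Gaussian measure, as a function of the norm. -/
noncomputable def gaussianRadialDensity (d : ℕ) (r : ℝ) : ℝ :=
  (2 * Real.pi) ^ (-(d : ℝ) / 2) * Real.exp (-(1 / 2) * r ^ 2)

lemma gaussianRadialDensity_nonneg (d : ℕ) (r : ℝ) : 0 ≤ gaussianRadialDensity d r := by
  unfold gaussianRadialDensity; positivity

lemma continuous_gaussianRadialDensity (d : ℕ) : Continuous (gaussianRadialDensity d) := by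
  unfold gaussianRadialDensity; fun_prop

variable (E) in
lemma lintegral_gaussianRadialDensity :
    ∫⁻ v : E, ENNReal.ofReal (gaussianRadialDensity (Module.finrank ℝ E) ‖v‖) = 1 := by
  have h := GaussianFourier.integral_rexp_neg_mul_sq_norm (V := E) (b := 1 / 2) (by norm_num)
  have hi : Integrable (fun v : E => Real.exp (-(1 / 2) * ‖v‖ ^ 2)) := by
    -- A non-integrable function has integral `0`, while the value in `h` is positive.
    by_contra hn
    rw [integral_undef hn] at h
    have : 0 < (Real.pi / (1 / 2)) ^ ((Module.finrank ℝ E : ℝ) / 2) := by positivity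
    linarith
  rw [← ofReal_integral_eq_lintegral_ofReal]
  · unfold gaussianRadialDensity
    rw [integral_const_mul, h, show Real.pi / (1 / 2) = 2 * Real.pi by ring,
      ← Real.rpow_add (by positivity)]
    simp [neg_div]
  · exact hi.const_mul _
  · exact .of_forall fun v => gaussianRadialDensity_nonneg _ _

-- Finite measures are determined by their characteristic functions; that of the density is a
-- Gaussian integral with an imaginary linear term.
variable (E) in
lemma stdGaussian_eq_withDensity :
    stdGaussian E = (volume : Measure E).withDensity
      (fun v => ENNReal.ofReal (gaussianRadialDensity (Module.finrank ℝ E) ‖v‖)) := by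
  have hm : Measurable fun v : E =>
      ENNReal.ofReal (gaussianRadialDensity (Module.finrank ℝ E) ‖v‖) :=
    ((continuous_gaussianRadialDensity _).comp continuous_norm).measurable.ennreal_ofReal
  have : IsFiniteMeasure ((volume : Measure E).withDensity
      (fun v => ENNReal.ofReal (gaussianRadialDensity (Module.finrank ℝ E) ‖v‖))) := by
    refine isFiniteMeasure_withDensity ?_
    rw [lintegral_gaussianRadialDensity]; simp
  apply Measure.ext_of_charFun
  ext t
  rw [charFun_stdGaussian, charFun_apply, integral_withDensity_eq_integral_toReal_smul hm (by simp)]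
  have h := GaussianFourier.integral_cexp_neg_mul_sq_norm_add (V := E) (b := 1 / 2) (by norm_num)
    Complex.I t
  have h2 : ∀ v : E, (ENNReal.ofReal (gaussianRadialDensity (Module.finrank ℝ E) ‖v‖)).toReal •
      Complex.exp (inner ℝ v t * Complex.I) =
      ((2 * Real.pi : ℝ) ^ (-(Module.finrank ℝ E : ℝ) / 2) : ℝ) *
       Complex.exp (-(1 / 2) * ‖v‖ ^ 2 + Complex.I * (inner ℝ t v)) := by
    intro v
    rw [ENNReal.toReal_ofReal (gaussianRadialDensity_nonneg _ _), gaussianRadialDensity,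
      Complex.exp_add, real_inner_comm, Complex.real_smul]
    push_cast
    rw [mul_comm Complex.I]
    ring
  simp_rw [h2]
  rw [integral_const_mul, h]
  have h3 : ((Real.pi : ℂ) / (1 / 2)) ^ ((Module.finrank ℝ E : ℂ) / 2) =
      (((2 * Real.pi : ℝ) ^ ((Module.finrank ℝ E : ℝ) / 2) : ℝ) : ℂ) := by
    rw [Complex.ofReal_cpow (by positivity)]
    push_cast
    congr 1
    ring
  rw [h3, ← mul_assoc, ← Complex.ofReal_mul, ← Real.rpow_add (by positivity)]
  simp [neg_div]
  ring_nf

/-- The origin is a null set, and on its complement the homeomorphism with sphere times half-line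
carries volume to a product measure. -/
lemma lintegral_polar [Nontrivial E] {F : E → ENNReal} (hF : Measurable F) :
    ∫⁻ v, F v = ∫⁻ r, ∫⁻ θ, F ((r : ℝ) • (θ : E)) ∂(volume : Measure E).toSphere
      ∂Measure.volumeIoiPow (Module.finrank ℝ E - 1) := by
  have h1 : ∫⁻ v, F v = ∫⁻ v : ({(0)}ᶜ : Set E), F v ∂((volume : Measure E).comap (↑)) := by
    rw [lintegral_subtype_comap (measurableSet_singleton _).compl F, restrict_compl_singleton]
  rw [h1, ← lintegral_prod_symm' (f := fun p : Metric.sphere (0 : E) 1 × Set.Ioi (0 : ℝ) =>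
    F ((p.2 : ℝ) • (p.1 : E)))]
  · rw [← (volume : Measure E).measurePreserving_homeomorphUnitSphereProd.lintegral_comp_emb
      (Homeomorph.measurableEmbedding _)]
    refine lintegral_congr fun v => ?_
    congr 1
    rw [← homeomorphUnitSphereProd_symm_apply_coe, Homeomorph.symm_apply_apply]
  · exact hF.comp (by fun_prop)

end Polar

/-- The Euclidean space `ℝⁿ`. -/
abbrev Euc (n : ℕ) : Type := EuclideanSpace ℝ (Fin n)

variable {n : ℕ}

lemma nontrivial_euc (hn : 0 < n) : Nontrivial (Euc n) := by
  have : Nonempty (Fin n) := ⟨⟨0, hn⟩⟩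
  infer_instance

lemma isProbabilityMeasure_sphereMeasure (hn : 0 < n) :
    IsProbabilityMeasure (sphereMeasure n) := by
  have := nontrivial_euc hn
  constructor
  simp only [sphereMeasure, Measure.smul_apply, smul_eq_mul]
  exact ENNReal.inv_mul_cancel (by
    simpa only [ne_eq, Measure.measure_univ_eq_zero] using
      (volume : Measure (Euc n)).toSphere_ne_zero) (measure_ne_top _ _)

/-- The density depends on the norm only, so replacing the direction of `v` by an independent
uniform one does not change its law. In polar coordinates the surplus integral over directions is
the total mass that normalizes `sphereMeasure`. -/
lemma lintegral_stdGaussian_polar (hn : 0 < n) {F : Euc n → ENNReal} (hF : Measurable F) :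
    ∫⁻ v, F v ∂stdGaussian (Euc n) =
      ∫⁻ v, ∫⁻ θ, F (‖v‖ • (θ : Euc n)) ∂sphereMeasure n ∂stdGaussian (Euc n) := by
  have := nontrivial_euc hn
  have := isProbabilityMeasure_sphereMeasure hn
  have hT0 : (volume : Measure (Euc n)).toSphere Set.univ ≠ 0 := by
    simpa only [ne_eq, Measure.measure_univ_eq_zero] using
      (volume : Measure (Euc n)).toSphere_ne_zero
  have hm : Measurable fun v : Euc n =>
      ENNReal.ofReal (gaussianRadialDensity (Module.finrank ℝ (Euc n)) ‖v‖) :=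
    ((continuous_gaussianRadialDensity _).comp continuous_norm).measurable.ennreal_ofReal
  have hG : Measurable fun r : ℝ => ∫⁻ θ, F (r • (θ : Euc n)) ∂sphereMeasure n := by
    apply Measurable.lintegral_prod_right' (f := fun p : ℝ × Metric.sphere (0 : Euc n) 1 =>
      F (p.1 • (p.2 : Euc n)))
    exact hF.comp (by fun_prop)
  have hGv : Measurable fun v : Euc n => ∫⁻ θ, F (‖v‖ • (θ : Euc n)) ∂sphereMeasure n :=
    hG.comp (measurable_norm (α := Euc n))
  rw [stdGaussian_eq_withDensity, lintegral_withDensity_eq_lintegral_mul _ hm hF,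
    lintegral_withDensity_eq_lintegral_mul _ hm hGv, lintegral_polar (hm.mul hF),
    lintegral_polar (hm.mul hGv)]
  refine lintegral_congr fun r => ?_
  have hr : 0 < (r : ℝ) := r.2
  have hnorm : ∀ θ : Metric.sphere (0 : Euc n) 1, ‖(r : ℝ) • (θ : Euc n)‖ = r := by
    intro θ
    rw [norm_smul, norm_eq_of_mem_sphere, Real.norm_of_nonneg hr.le, mul_one]
  have hFr : Measurable fun θ : Metric.sphere (0 : Euc n) 1 => F ((r : ℝ) • (θ : Euc n)) :=
    hF.comp (by fun_prop)
  simp only [Pi.mul_apply, hnorm]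
  rw [lintegral_const, lintegral_const_mul _ hFr, sphereMeasure, lintegral_smul_measure,
    smul_eq_mul, mul_assoc, mul_comm _ ((volume : Measure (Euc n)).toSphere Set.univ),
    ← mul_assoc ((volume : Measure (Euc n)).toSphere Set.univ), ENNReal.mul_inv_cancel hT0
    (measure_ne_top _ _), one_mul]

end

/-! ### Moments of norms and of projections of Gaussian vectors. -/

section

lemma integral_pow_mul_exp_neg_half_sq (q : ℕ) :
    ∫ x in Set.Ioi (0 : ℝ), x ^ q * Real.exp (-(1 / 2) * x ^ 2) =
      (1 / 2 : ℝ) ^ (-((q : ℝ) + 1) / 2) * (1 / 2) * Real.Gamma (((q : ℝ) + 1) / 2) := by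
  rw [← integral_rpow_mul_exp_neg_mul_rpow (p := 2) (q := q) (b := 1 / 2) (by norm_num)
    (by linarith [(Nat.cast_nonneg q : (0 : ℝ) ≤ q)]) (by norm_num)]
  refine setIntegral_congr_fun measurableSet_Ioi fun x _ => ?_
  simp only [Real.rpow_natCast, Real.rpow_two]

lemma integral_pow_add_two_mul_exp_neg_half_sq (q : ℕ) :
    ∫ x in Set.Ioi (0 : ℝ), x ^ (q + 2) * Real.exp (-(1 / 2) * x ^ 2) =
      (q + 1) * ∫ x in Set.Ioi (0 : ℝ), x ^ q * Real.exp (-(1 / 2) * x ^ 2) := by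
  rw [integral_pow_mul_exp_neg_half_sq, integral_pow_mul_exp_neg_half_sq]
  have hq : (0 : ℝ) ≤ q := Nat.cast_nonneg q
  have h1 : (((q + 2 : ℕ) : ℝ) + 1) / 2 = ((q : ℝ) + 1) / 2 + 1 := by push_cast; ring
  have h2 : -(((q + 2 : ℕ) : ℝ) + 1) / 2 = -((q : ℝ) + 1) / 2 + (-1) := by push_cast; ring
  rw [h1, h2, Real.Gamma_add_one (by positivity), Real.rpow_add (by norm_num), Real.rpow_neg_one]
  ring

section

variable {E : Type*} [NormedAddCommGroup E] [InnerProductSpace ℝ E] [FiniteDimensional ℝ E]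
  [MeasurableSpace E] [BorelSpace E]

lemma integrable_norm_pow_stdGaussian (k : ℕ) :
    Integrable (fun v : E => ‖v‖ ^ k) (stdGaussian E) :=
  (IsGaussian.memLp_id (stdGaussian E) k (by simp)).integrable_norm_pow'

lemma integral_stdGaussian_eq (f : E → ℝ) :
    ∫ v, f v ∂stdGaussian E =
      ∫ v, gaussianRadialDensity (Module.finrank ℝ E) ‖v‖ * f v := by
  have hm : Measurable fun v : E =>
      ENNReal.ofReal (gaussianRadialDensity (Module.finrank ℝ E) ‖v‖) :=
    ((continuous_gaussianRadialDensity _).comp continuous_norm).measurable.ennreal_ofReal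
  rw [stdGaussian_eq_withDensity, integral_withDensity_eq_integral_toReal_smul hm (by simp)]
  simp_rw [ENNReal.toReal_ofReal (gaussianRadialDensity_nonneg _ _), smul_eq_mul]

-- The constants of radial integration do not depend on `k`, so only the ratio of two
-- one-dimensional integrals remains, given by the functional equation of `Γ`.
variable (E) in
lemma integral_norm_pow_stdGaussian_add_two [Nontrivial E] (k : ℕ) :
    ∫ v, ‖v‖ ^ (k + 2) ∂stdGaussian E =
      (Module.finrank ℝ E + k) * ∫ v, ‖v‖ ^ k ∂stdGaussian E := by
  obtain ⟨d, hd⟩ : ∃ d, Module.finrank ℝ E = d + 1 :=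
    Nat.exists_eq_succ_of_ne_zero Module.finrank_pos.ne'
  have key : ∀ k : ℕ, ∫ v, ‖v‖ ^ k ∂stdGaussian E =
      (d + 1) * ((volume : Measure E).real (Metric.ball 0 1) *
        ((2 * Real.pi) ^ (-((d + 1 : ℕ) : ℝ) / 2) *
          ∫ x in Set.Ioi (0 : ℝ), x ^ (d + k) * Real.exp (-(1 / 2) * x ^ 2))) := by
    intro k
    have h : ∀ x : ℝ, x ^ (d + 1 - 1) • (gaussianRadialDensity (d + 1) x * x ^ k) =
        (2 * Real.pi) ^ (-((d + 1 : ℕ) : ℝ) / 2) *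
          (x ^ (d + k) * Real.exp (-(1 / 2) * x ^ 2)) := by
      intro x
      simp only [gaussianRadialDensity, smul_eq_mul, add_tsub_cancel_right, pow_add]
      ring
    rw [integral_stdGaussian_eq, hd, integral_fun_norm_addHaar volume
      (fun r => gaussianRadialDensity (d + 1) r * r ^ k), hd, nsmul_eq_mul, smul_eq_mul]
    simp_rw [h]
    rw [integral_const_mul]
    push_cast
    rfl
  rw [key, key, ← add_assoc, integral_pow_add_two_mul_exp_neg_half_sq, hd]
  push_cast
  ring

lemma map_inner_stdGaussian (a : E) :
    (stdGaussian E).map (fun v => inner ℝ a v) = (gaussianReal 0 1).map (fun x => ‖a‖ * x) := by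
  have h1 : Measurable fun v : E => inner ℝ a v := by fun_prop
  have : IsProbabilityMeasure ((stdGaussian E).map (fun v => inner ℝ a v)) :=
    Measure.isProbabilityMeasure_map h1.aemeasurable
  have : IsProbabilityMeasure ((gaussianReal 0 1).map (fun x => ‖a‖ * x)) :=
    Measure.isProbabilityMeasure_map (by fun_prop)
  apply Measure.ext_of_charFun
  ext t
  rw [charFun_map_mul, charFun_gaussianReal, charFun_apply_real,
    integral_map h1.aemeasurable (by fun_prop)]
  have h2 := charFun_stdGaussian (t • a)
  rw [charFun_apply] at h2
  simp only [inner_smul_right, Complex.ofReal_mul] at h2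
  have h3 : ∀ v : E, Complex.exp (t * (inner ℝ a v : ℝ) * Complex.I) =
      Complex.exp (t * (inner ℝ v a : ℝ) * Complex.I) := fun v => by rw [real_inner_comm]
  simp_rw [h3]
  rw [h2, norm_smul]
  congr 1
  simp [mul_pow]
  norm_cast
  rw [sq_abs]
  ring

lemma integral_comp_inner_stdGaussian (a : E) {f : ℝ → ℝ} (hf : Measurable f) :
    ∫ v, f (inner ℝ a v) ∂stdGaussian E = ∫ x, f (‖a‖ * x) ∂gaussianReal 0 1 := by
  rw [← integral_map (φ := fun v : E => inner ℝ a v) (by fun_prop) hf.aestronglyMeasurable,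
    map_inner_stdGaussian, integral_map (by fun_prop) hf.aestronglyMeasurable]

end

lemma stdGaussian_real : stdGaussian ℝ = gaussianReal 0 1 := by
  have h := map_inner_stdGaussian (1 : ℝ)
  simpa using h

lemma integral_pow_four_gaussianReal : ∫ x, x ^ 4 ∂gaussianReal 0 1 = 3 := by
  rw [← stdGaussian_real]
  -- The norm recursion in dimension one: `(1 + 2)(1 + 0) = 3`.
  have h4 := integral_norm_pow_stdGaussian_add_two ℝ 2
  have h2 := integral_norm_pow_stdGaussian_add_two ℝ 0
  simp only [pow_zero, integral_const, probReal_univ, Module.finrank_self, smul_eq_mul] at h2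
  rw [h2] at h4
  simp only [Real.norm_eq_abs, Module.finrank_self] at h4
  norm_num at h4
  simpa [show ∀ x : ℝ, |x| ^ 4 = x ^ 4 from fun x => Even.pow_abs (by decide) x] using h4

lemma integral_abs_gaussianReal : ∫ x, |x| ∂gaussianReal 0 1 = √(2 / Real.pi) := by
  rw [integral_gaussianReal_eq_integral_smul (by simp)]
  simp only [gaussianPDFReal, NNReal.coe_one, mul_one, sub_zero, smul_eq_mul, mul_assoc]
  rw [integral_const_mul]
  have h := integral_comp_abs (f := fun x : ℝ => Real.exp (-x ^ 2 / 2) * x)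
  simp only [sq_abs] at h
  rw [h]
  have h1 := integral_pow_mul_exp_neg_half_sq 1
  have h2 : ∫ x in Set.Ioi (0 : ℝ), Real.exp (-x ^ 2 / 2) * x = 1 := by
    rw [← show (1 / 2 : ℝ) ^ (-(((1 : ℕ) : ℝ) + 1) / 2) * (1 / 2) *
      Real.Gamma ((((1 : ℕ) : ℝ) + 1) / 2) = 1 by norm_num [Real.rpow_neg_one], ← h1]
    refine setIntegral_congr_fun measurableSet_Ioi fun x _ => ?_
    simp only [pow_one, mul_comm x]
    congr 2
    ring
  rw [h2, Real.sqrt_div (by norm_num), Real.sqrt_mul (by norm_num), mul_inv]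
  have := Real.mul_self_sqrt (show (0 : ℝ) ≤ 2 by norm_num)
  field_simp
  nlinarith

end

/-! ### Third order Taylor estimates valid on all of `(-∞, 1]`. -/

section

/-- The third order Taylor estimate for `√(1 - x)`, uniformly in `x ≤ 1`. -/
lemma abs_sqrt_one_sub_sub_taylor_le {x : ℝ} (hx : x ≤ 1) :
    |√(1 - x) - (1 + (-(1 / 2)) * x + (-(1 / 8)) * x ^ 2 + (-(1 / 16)) * x ^ 3)| ≤ 1 * x ^ 4 := by
  have h0 : 0 ≤ √(1 - x) := Real.sqrt_nonneg _
  have h1 : √(1 - x) ^ 2 = 1 - x := Real.sq_sqrt (by linarith)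
  -- In `u = √(1 - x)` the remainder is a polynomial with factor `(1 - u) ^ 4`, a factor that `x ^
  -- 4` has too; no cases in the size of `x` are needed.
  generalize √(1 - x) = u at h0 h1 ⊢
  obtain rfl : x = 1 - u ^ 2 := by linarith
  have h2 : u - (1 + (-(1 / 2)) * (1 - u ^ 2) + (-(1 / 8)) * (1 - u ^ 2) ^ 2 +
      (-(1 / 16)) * (1 - u ^ 2) ^ 3) = -((1 - u) ^ 4 * ((u ^ 2 + 4 * u + 5) / 16)) := by ring
  rw [h2, abs_neg, abs_of_nonneg (by positivity), one_mul,
    show (1 - u ^ 2) ^ 4 = (1 - u) ^ 4 * (1 + u) ^ 4 by ring]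
  gcongr
  nlinarith [pow_nonneg h0 2, pow_nonneg h0 3, pow_nonneg h0 4]

lemma abs_exp_sub_taylor_le (y : ℝ) :
    |Real.exp y - (1 + y + y ^ 2 / 2 + y ^ 3 / 6)| ≤ |y| ^ 4 * Real.exp |y| := by
  have h := Complex.norm_exp_sub_sum_le_norm_mul_exp (y : ℂ) 4
  simp only [Finset.sum_range_succ, Finset.sum_range_zero] at h
  norm_num [Nat.factorial] at h
  rw [← Real.norm_eq_abs, ← Complex.norm_real]
  push_cast
  convert h using 2

/-- On `[-1, 0]` the usual remainder suffices since `e < 4`; below `-1` the exponential lies in `(0,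
1]` and the polynomial is dominated by `y ^ 4`. -/
lemma abs_exp_sub_taylor_le_of_nonpos {y : ℝ} (hy : y ≤ 0) :
    |Real.exp y - (1 + y + y ^ 2 / 2 + y ^ 3 / 6)| ≤ 4 * y ^ 4 := by
  rcases le_or_gt (-1) y with h | h
  · have h1 := abs_exp_sub_taylor_le y
    have h2 : Real.exp |y| ≤ 4 := by
      have h3 : Real.exp |y| ≤ Real.exp 1 := Real.exp_le_exp.2 (by rw [abs_of_nonpos hy]; linarith)
      linarith [Real.exp_one_lt_d9]
    have h4 : |y| ^ 4 = y ^ 4 := Even.pow_abs (by decide) y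
    rw [h4] at h1
    nlinarith [show 0 ≤ y ^ 4 by positivity]
  · have h1 : Real.exp y ≤ 1 := Real.exp_le_one_iff.2 hy
    have h0 := Real.exp_pos y
    obtain ⟨z, rfl⟩ : ∃ z, y = -1 - z := ⟨-1 - y, by ring⟩
    have hz : 0 < z := by linarith
    rw [abs_le]
    constructor <;> nlinarith [pow_pos hz 2, pow_pos hz 3, pow_pos hz 4]

lemma pow_four_mul_exp_neg_le {s : ℝ} (hs : 0 ≤ s) : s ^ 4 * Real.exp (-s) ≤ 24 := by
  have h := Real.sum_le_exp_of_nonneg hs 5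
  simp only [Finset.sum_range_succ, Finset.sum_range_zero] at h
  norm_num [Nat.factorial] at h
  rw [Real.exp_neg, ← div_eq_mul_inv, div_le_iff₀ (Real.exp_pos s)]
  nlinarith [pow_nonneg hs 2, pow_nonneg hs 3]

/-- The third order Taylor estimate for `exp (-s (1 - x))` in `x ≤ 1`, with a remainder uniform
in `s` and small for small `s`. -/
lemma abs_exp_neg_mul_one_sub_sub_taylor_le {s x : ℝ} (hs : 0 ≤ s) (hx : x ≤ 1) :
    |Real.exp (-s * (1 - x)) - (Real.exp (-s) + (Real.exp (-s) * s) * x +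
      (Real.exp (-s) * s ^ 2 / 2) * x ^ 2 + (Real.exp (-s) * s ^ 3 / 6) * x ^ 3)| ≤
      384 * min 1 s * x ^ 4 := by
  have hx4 : 0 ≤ x ^ 4 := by positivity
  have hE : Real.exp (-s * (1 - x)) = Real.exp (-s) * Real.exp (s * x) := by
    rw [← Real.exp_add]; congr 1; ring
  have h1 : Real.exp (-s * (1 - x)) - (Real.exp (-s) + (Real.exp (-s) * s) * x +
      (Real.exp (-s) * s ^ 2 / 2) * x ^ 2 + (Real.exp (-s) * s ^ 3 / 6) * x ^ 3) =
      Real.exp (-s) * (Real.exp (s * x) - (1 + s * x + (s * x) ^ 2 / 2 + (s * x) ^ 3 / 6)) := by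
    rw [hE]; ring
  have hs4 : s ≤ 1 → s ^ 4 ≤ s := fun h => by
    nlinarith [pow_le_one₀ hs h (n := 3)]
  rw [h1, abs_mul, abs_of_pos (Real.exp_pos _)]
  -- For `x ≤ 0` the remainder of `exp (s x)` has no exponential growth, so the whole factor
  -- `e^{-s}` is free to absorb `s ^ 4`; for `x ≥ 0` only `e^{-s(1 - x)}` is left.
  rcases le_total x 0 with hx0 | hx0
  · have h2 := abs_exp_sub_taylor_le_of_nonpos (mul_nonpos_of_nonneg_of_nonpos hs hx0)
    have h3 := pow_four_mul_exp_neg_le hs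
    have h4 : s ^ 4 * Real.exp (-s) ≤ 24 * min 1 s := by
      rcases le_total s 1 with h | h
      · rw [min_eq_right h]
        have : Real.exp (-s) ≤ 1 := Real.exp_le_one_iff.2 (by linarith)
        nlinarith [hs4 h, pow_nonneg hs 4]
      · rw [min_eq_left h]; linarith
    have h5 : 0 ≤ min 1 s := le_min zero_le_one hs
    calc _ ≤ Real.exp (-s) * (4 * (s * x) ^ 4) := by gcongr
      _ = 4 * (s ^ 4 * Real.exp (-s)) * x ^ 4 := by ring
      _ ≤ 4 * (24 * min 1 s) * x ^ 4 := by gcongr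
      _ ≤ _ := by nlinarith [mul_nonneg h5 hx4]
  · have hsx : 0 ≤ s * x := mul_nonneg hs hx0
    have h2 := abs_exp_sub_taylor_le (s * x)
    rw [abs_of_nonneg hsx] at h2
    have h3 : Real.exp (-s) * |Real.exp (s * x) - (1 + s * x + (s * x) ^ 2 / 2 + (s * x) ^ 3 / 6)|
        ≤ s ^ 4 * Real.exp (-s * (1 - x)) * x ^ 4 := by
      calc _ ≤ Real.exp (-s) * ((s * x) ^ 4 * Real.exp (s * x)) := by gcongr
        _ = _ := by rw [hE]; ring
    rcases le_total s 1 with h | h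
    · rw [min_eq_right h]
      have : Real.exp (-s * (1 - x)) ≤ 1 := Real.exp_le_one_iff.2 (by nlinarith)
      calc _ ≤ _ := h3
        _ ≤ s * 1 * x ^ 4 := by gcongr; exact hs4 h
        _ ≤ _ := by nlinarith [mul_nonneg hs hx4]
    · rw [min_eq_left h]
      -- Below `1/2` the decay `e^{-s/2}` remains, and `384 = 2 ^ 4 * 24` comes from it. Near `1`
      -- there is no decay, but the difference is at most `1 ≤ 16 x ^ 4`.
      rcases le_total x (1 / 2) with hx2 | hx2
      · have h4 := pow_four_mul_exp_neg_le (s := s / 2) (by linarith)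
        have h5 : Real.exp (-s * (1 - x)) ≤ Real.exp (-(s / 2)) := Real.exp_le_exp.2 (by nlinarith)
        calc _ ≤ _ := h3
          _ ≤ s ^ 4 * Real.exp (-(s / 2)) * x ^ 4 := by gcongr
          _ = 16 * ((s / 2) ^ 4 * Real.exp (-(s / 2))) * x ^ 4 := by ring
          _ ≤ 16 * 24 * x ^ 4 := by gcongr
          _ = _ := by ring
      · have h4 := Real.sum_le_exp_of_nonneg hsx 4
        simp only [Finset.sum_range_succ, Finset.sum_range_zero] at h4
        norm_num [Nat.factorial] at h4
        rw [abs_of_nonneg (by linarith)]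
        have h5 : Real.exp (-s * (1 - x)) ≤ 1 := Real.exp_le_one_iff.2 (by nlinarith)
        have h6 : (1 / 16 : ℝ) ≤ x ^ 4 := by
          calc (1 / 16 : ℝ) = (1 / 2) ^ 4 := by norm_num
            _ ≤ x ^ 4 := by gcongr
        have h7 : 0 ≤ 1 + s * x + (s * x) ^ 2 / 2 + (s * x) ^ 3 / 6 := by positivity
        have h8 := Real.exp_pos (-s)
        rw [mul_sub, ← hE]
        nlinarith [mul_nonneg h8.le h7]

end

/-! ### The normalized variables `ξ`, `η`, `ζ` and the moments of `ζ`. -/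

section

/-- A distribution on `ℝⁿ` which is isotropic, centered and concentrated on the sphere of
radius `√n`. -/
structure IsotropicSphereLaw {n : ℕ} (μ : Measure (Euc n)) : Prop where
  norm_sq : ∀ᵐ x ∂μ, ‖x‖ ^ 2 = (n : ℝ)
  cov : ∀ i j : Fin n, ∫ x, x i * x j ∂μ = if i = j then 1 else 0
  mean : ∀ i : Fin n, ∫ x, x i ∂μ = 0

/-- The normalized inner product `⟨x, y⟩ / n`. -/
noncomputable def overlap {n : ℕ} (x y : Euc n) : ℝ := inner ℝ x y / n

/-- The quantity `ζ` in `‖g‖² = n (1 - ζ)`. -/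
noncomputable def radialDefect {n : ℕ} (g : Euc n) : ℝ := 1 - ‖g‖ ^ 2 / n

/-- The quantity `η` in `‖x - g‖² = 2n (1 - η)` for `‖x‖² = n`. -/
noncomputable def gaussianOverlap {n : ℕ} (x g : Euc n) : ℝ :=
  overlap x g + radialDefect g / 2

variable {n : ℕ}

lemma continuous_overlap : Continuous fun p : Euc n × Euc n => overlap p.1 p.2 := by
  unfold overlap; fun_prop

lemma continuous_radialDefect : Continuous (radialDefect : Euc n → ℝ) := by
  unfold radialDefect; fun_prop

lemma continuous_gaussianOverlap :
    Continuous fun p : Euc n × Euc n => gaussianOverlap p.1 p.2 := by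
  unfold gaussianOverlap
  exact continuous_overlap.add ((continuous_radialDefect.comp continuous_snd).div_const _)

lemma norm_sub_sq_eq_overlap (hn : 0 < n) {x y : Euc n} (hx : ‖x‖ ^ 2 = n) (hy : ‖y‖ ^ 2 = n) :
    ‖x - y‖ ^ 2 = 2 * n * (1 - overlap x y) := by
  have hn' : (n : ℝ) ≠ 0 := by positivity
  rw [norm_sub_sq_real, hx, hy, overlap]
  field_simp
  ring

lemma norm_sub_sq_eq_gaussianOverlap (hn : 0 < n) {x g : Euc n} (hx : ‖x‖ ^ 2 = n) :
    ‖x - g‖ ^ 2 = 2 * n * (1 - gaussianOverlap x g) := by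
  have hn' : (n : ℝ) ≠ 0 := by positivity
  rw [norm_sub_sq_real, hx, gaussianOverlap, overlap, radialDefect]
  field_simp
  ring

lemma norm_sq_eq_radialDefect (hn : 0 < n) (g : Euc n) : ‖g‖ ^ 2 = n * (1 - radialDefect g) := by
  have hn' : (n : ℝ) ≠ 0 := by positivity
  rw [radialDefect]
  field_simp
  ring

lemma radialDefect_le_one (g : Euc n) : radialDefect g ≤ 1 := by
  unfold radialDefect
  have : 0 ≤ ‖g‖ ^ 2 / n := by positivity
  linarith

lemma overlap_le_one (hn : 0 < n) {x y : Euc n} (hx : ‖x‖ ^ 2 = n) (hy : ‖y‖ ^ 2 = n) :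
    overlap x y ≤ 1 := by
  have h := norm_sub_sq_eq_overlap hn hx hy
  have h1 := sq_nonneg ‖x - y‖
  have hn' : (0 : ℝ) < n := by positivity
  by_contra hc
  nlinarith

lemma gaussianOverlap_le_one (hn : 0 < n) {x g : Euc n} (hx : ‖x‖ ^ 2 = n) :
    gaussianOverlap x g ≤ 1 := by
  have h := norm_sub_sq_eq_gaussianOverlap hn (g := g) hx
  have h1 := sq_nonneg ‖x - g‖
  have hn' : (0 : ℝ) < n := by positivity
  by_contra hc
  nlinarith

lemma norm_eq_sqrt {x : Euc n} (hx : ‖x‖ ^ 2 = n) : ‖x‖ = √n := by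
  rw [← hx, Real.sqrt_sq (norm_nonneg _)]

lemma abs_overlap_le_one (hn : 0 < n) {x y : Euc n} (hx : ‖x‖ ^ 2 = n) (hy : ‖y‖ ^ 2 = n) :
    |overlap x y| ≤ 1 := by
  have hn' : (0 : ℝ) < n := by positivity
  rw [overlap, abs_div, abs_of_pos hn', div_le_one hn']
  calc _ ≤ ‖x‖ * ‖y‖ := abs_real_inner_le_norm x y
    _ = n := by rw [norm_eq_sqrt hx, norm_eq_sqrt hy, Real.mul_self_sqrt hn'.le]

/-- Crude on purpose: this bound and the next one serve only to dominate by powers of `1 + ‖g‖` and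
so give integrability. -/
lemma abs_overlap_le_norm (hn : 0 < n) {x : Euc n} (hx : ‖x‖ ^ 2 = n) (g : Euc n) :
    |overlap x g| ≤ ‖g‖ := by
  have hn' : (0 : ℝ) < n := by positivity
  rw [overlap, abs_div, abs_of_pos hn', div_le_iff₀ hn']
  have h1 : √(n : ℝ) ≤ n := by
    rw [Real.sqrt_le_iff]
    have : (1 : ℝ) ≤ n := by exact_mod_cast hn
    exact ⟨hn'.le, by nlinarith⟩
  calc _ ≤ ‖x‖ * ‖g‖ := abs_real_inner_le_norm x g
    _ ≤ n * ‖g‖ := by rw [norm_eq_sqrt hx]; gcongr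
    _ = _ := mul_comm _ _

lemma abs_radialDefect_le (hn : 0 < n) (g : Euc n) : |radialDefect g| ≤ (1 + ‖g‖) ^ 2 := by
  have hn' : (1 : ℝ) ≤ n := by exact_mod_cast hn
  have h1 : ‖g‖ ^ 2 / n ≤ ‖g‖ ^ 2 := div_le_self (by positivity) hn'
  have h2 : 0 ≤ ‖g‖ ^ 2 / n := by positivity
  have h3 := norm_nonneg g
  rw [radialDefect, abs_le]
  constructor <;> nlinarith

lemma integrable_one_add_norm_pow_stdGaussian (k : ℕ) :
    Integrable (fun g : Euc n => (1 + ‖g‖) ^ k) (stdGaussian (Euc n)) := by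
  have h2 : MemLp (fun g : Euc n => ‖g‖) k (stdGaussian (Euc n)) :=
    (IsGaussian.memLp_id (stdGaussian (Euc n)) k (by simp)).norm
  have h1 : MemLp (fun g : Euc n => 1 + ‖g‖) k (stdGaussian (Euc n)) :=
    (memLp_const (1 : ℝ)).add h2
  refine h1.integrable_norm_pow'.congr (.of_forall fun g => ?_)
  have := norm_nonneg g
  simp only [Real.norm_eq_abs]
  rw [abs_of_nonneg (by positivity)]

lemma integrable_radialDefect_pow (hn : 0 < n) (k : ℕ) :
    Integrable (fun g : Euc n => radialDefect g ^ k) (stdGaussian (Euc n)) := by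
  refine (integrable_one_add_norm_pow_stdGaussian (n := n) (2 * k)).mono'
    (continuous_radialDefect.pow k).aestronglyMeasurable (.of_forall fun g => ?_)
  rw [norm_pow, Real.norm_eq_abs, pow_mul]
  exact pow_le_pow_left₀ (abs_nonneg _) (abs_radialDefect_le hn g) k

lemma integral_norm_sq_polynomial (hn : 0 < n) (a₀ a₁ a₂ a₃ a₄ : ℝ) :
    ∫ g : Euc n, (a₀ + a₁ * ‖g‖ ^ 2 + a₂ * ‖g‖ ^ 4 + a₃ * ‖g‖ ^ 6 + a₄ * ‖g‖ ^ 8)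
      ∂stdGaussian (Euc n) = a₀ + a₁ * n + a₂ * (n * (n + 2)) + a₃ * (n * (n + 2) * (n + 4)) +
        a₄ * (n * (n + 2) * (n + 4) * (n + 6)) := by
  have := nontrivial_euc hn
  have hk := fun k => integral_norm_pow_stdGaussian_add_two (Euc n) k
  have m2 := hk 0
  have m4 := hk 2
  have m6 := hk 4
  have m8 := hk 6
  norm_num at m2 m4 m6 m8
  rw [m2] at m4; rw [m4] at m6; rw [m6] at m8
  have hi := fun (a : ℝ) k => (integrable_norm_pow_stdGaussian (E := Euc n) k).const_mul a
  have i1 : Integrable (fun g : Euc n => a₀ + a₁ * ‖g‖ ^ 2) (stdGaussian (Euc n)) :=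
    (integrable_const _).add (hi _ _)
  have i2 : Integrable (fun g : Euc n => a₀ + a₁ * ‖g‖ ^ 2 + a₂ * ‖g‖ ^ 4)
    (stdGaussian (Euc n)) := i1.add (hi _ _)
  have i3 : Integrable (fun g : Euc n => a₀ + a₁ * ‖g‖ ^ 2 + a₂ * ‖g‖ ^ 4 + a₃ * ‖g‖ ^ 6)
    (stdGaussian (Euc n)) := i2.add (hi _ _)
  rw [integral_add i3 (hi _ _), integral_add i2 (hi _ _), integral_add i1 (hi _ _),
    integral_add (integrable_const _) (hi _ _), integral_const_mul, integral_const_mul,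
    integral_const_mul, integral_const_mul, m2, m4, m6, m8]
  simp only [integral_const, probReal_univ, smul_eq_mul]
  ring

/-- The even moments `n`, `n(n + 2)`, ... of the Gaussian norm turn these into identities in `n`.
The first three values must be exact, as they have to cancel against the moments of `ξ` and `η`. -/
lemma integral_radialDefect_pow (hn : 0 < n) :
    ∫ g : Euc n, radialDefect g ∂stdGaussian (Euc n) = 0 ∧
    ∫ g : Euc n, radialDefect g ^ 2 ∂stdGaussian (Euc n) = 2 / n ∧
    ∫ g : Euc n, radialDefect g ^ 3 ∂stdGaussian (Euc n) = -8 / n ^ 2 ∧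
    ∫ g : Euc n, radialDefect g ^ 4 ∂stdGaussian (Euc n) ≤ 60 / n ^ 2 := by
  have hn1 : (1 : ℝ) ≤ n := by exact_mod_cast hn
  have hn' : (n : ℝ) ≠ 0 := by positivity
  have hp := integral_norm_sq_polynomial hn
  refine ⟨?_, ?_, ?_, ?_⟩
  · have h : ∀ g : Euc n, radialDefect g =
        1 + (-1 / n) * ‖g‖ ^ 2 + 0 * ‖g‖ ^ 4 + 0 * ‖g‖ ^ 6 + 0 * ‖g‖ ^ 8 := by
      intro g; unfold radialDefect; field_simp; ring
    simp_rw [h]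
    rw [hp]
    field_simp
    ring
  · have h : ∀ g : Euc n, radialDefect g ^ 2 =
        1 + (-2 / n) * ‖g‖ ^ 2 + 1 / n ^ 2 * ‖g‖ ^ 4 + 0 * ‖g‖ ^ 6 + 0 * ‖g‖ ^ 8 := by
      intro g; unfold radialDefect; field_simp; ring
    simp_rw [h]
    rw [hp]
    field_simp
    ring
  · have h : ∀ g : Euc n, radialDefect g ^ 3 =
        1 + (-3 / n) * ‖g‖ ^ 2 + 3 / n ^ 2 * ‖g‖ ^ 4 + (-1 / n ^ 3) * ‖g‖ ^ 6 + 0 * ‖g‖ ^ 8 := by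
      intro g; unfold radialDefect; field_simp; ring
    simp_rw [h]
    rw [hp]
    field_simp
    ring
  · have h : ∀ g : Euc n, radialDefect g ^ 4 = 1 + (-4 / n) * ‖g‖ ^ 2 + 6 / n ^ 2 * ‖g‖ ^ 4 +
        (-4 / n ^ 3) * ‖g‖ ^ 6 + 1 / n ^ 4 * ‖g‖ ^ 8 := by
      intro g; unfold radialDefect; field_simp; ring
    -- The bound `60 / n ^ 2` is this value with `48` replaced by `48 n`.
    have e : ∫ g : Euc n, radialDefect g ^ 4 ∂stdGaussian (Euc n) = (12 * n + 48) / n ^ 3 := by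
      simp_rw [h]
      rw [hp]
      field_simp
      ring
    rw [e, div_le_div_iff₀ (by positivity) (by positivity)]
    have : (0 : ℝ) ≤ (n : ℝ) ^ 2 := by positivity
    nlinarith [mul_le_mul_of_nonneg_left hn1 this]

end

/-! ### Moments of the overlap `ξ`. -/

section

variable {n : ℕ} {μ : Measure (Euc n)} [IsProbabilityMeasure μ]

namespace IsotropicSphereLaw


lemma integrable_of_bound (hμ : IsotropicSphereLaw μ) {f : Euc n → ℝ} (hf : Continuous f) (C : ℝ)
    (hC : ∀ x, ‖x‖ ^ 2 = n → |f x| ≤ C) : Integrable f μ := by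
  refine Integrable.of_bound hf.aestronglyMeasurable C ?_
  filter_upwards [hμ.norm_sq] with x hx using hC x hx

lemma integrable_inner_pow (hμ : IsotropicSphereLaw μ) (a : Euc n) (k : ℕ) :
    Integrable (fun x => inner ℝ x a ^ k) μ := by
  refine hμ.integrable_of_bound (by fun_prop) ((√n * ‖a‖) ^ k) fun x hx => ?_
  rw [abs_pow, ← norm_eq_sqrt hx]
  exact pow_le_pow_left₀ (abs_nonneg _) (abs_real_inner_le_norm x a) k

lemma integrable_coord (hμ : IsotropicSphereLaw μ) (i : Fin n) : Integrable (fun x => x i) μ := by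
  refine hμ.integrable_of_bound (by fun_prop) (√n) fun x hx => ?_
  rw [← norm_eq_sqrt hx]
  exact PiLp.norm_apply_le x i

lemma integrable_coord_mul (hμ : IsotropicSphereLaw μ) (i j : Fin n) :
    Integrable (fun x => x i * x j) μ := by
  refine hμ.integrable_of_bound (by fun_prop) (√n * √n) fun x hx => ?_
  rw [← norm_eq_sqrt hx, abs_mul]
  exact mul_le_mul (PiLp.norm_apply_le x i) (PiLp.norm_apply_le x j) (abs_nonneg _) (norm_nonneg _)

lemma integrable_coord_mul_mul (hμ : IsotropicSphereLaw μ) (i j k : Fin n) :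
    Integrable (fun x => x i * x j * x k) μ := by
  refine hμ.integrable_of_bound (by fun_prop) (√n * √n * √n) fun x hx => ?_
  rw [← norm_eq_sqrt hx, abs_mul, abs_mul]
  exact mul_le_mul (mul_le_mul (PiLp.norm_apply_le x i) (PiLp.norm_apply_le x j) (abs_nonneg _)
    (norm_nonneg _)) (PiLp.norm_apply_le x k) (abs_nonneg _) (by positivity)

lemma integral_inner (hμ : IsotropicSphereLaw μ) (a : Euc n) : ∫ x, inner ℝ x a ∂μ = 0 := by
  simp only [PiLp.inner_apply, RCLike.inner_apply, conj_trivial]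
  rw [integral_finsetSum _ fun i _ => (hμ.integrable_coord i).const_mul (a i)]
  simp [integral_const_mul, hμ.mean]

lemma integral_inner_sq (hμ : IsotropicSphereLaw μ) (a : Euc n) :
    ∫ x, inner ℝ x a ^ 2 ∂μ = ‖a‖ ^ 2 := by
  have h : ∀ x : Euc n, inner ℝ x a ^ 2 = ∑ i, ∑ j, a i * a j * (x i * x j) := by
    intro x
    simp only [PiLp.inner_apply, RCLike.inner_apply, conj_trivial]
    rw [sq, Finset.sum_mul_sum]
    refine Finset.sum_congr rfl fun i _ => Finset.sum_congr rfl fun j _ => by ring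
  simp_rw [h]
  rw [integral_finsetSum _ fun i _ => integrable_finsetSum _ fun j _ =>
    (hμ.integrable_coord_mul i j).const_mul _]
  have h2 : ∀ i, ∫ x, ∑ j, a i * a j * (x i * x j) ∂μ = a i ^ 2 := by
    intro i
    rw [integral_finsetSum _ fun j _ => (hμ.integrable_coord_mul i j).const_mul _]
    simp_rw [integral_const_mul, hμ.cov]
    simp [sq]
  simp_rw [h2]
  rw [EuclideanSpace.real_norm_sq_eq]

lemma ae_prod {μ : Measure (Euc n)} (hμ : IsotropicSphereLaw μ) :
    ∀ᵐ p ∂(μ.prod μ), ‖p.1‖ ^ 2 = (n : ℝ) ∧ ‖p.2‖ ^ 2 = (n : ℝ) := by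
  have h1 := Measure.quasiMeasurePreserving_fst (μ := μ) (ν := μ) |>.ae hμ.norm_sq
  have h2 := Measure.quasiMeasurePreserving_snd (μ := μ) (ν := μ) |>.ae hμ.norm_sq
  filter_upwards [h1, h2] with p hp1 hp2 using ⟨hp1, hp2⟩

lemma ae_prod_gaussian {μ : Measure (Euc n)} (hμ : IsotropicSphereLaw μ) :
    ∀ᵐ p ∂(μ.prod (stdGaussian (Euc n))), ‖p.1‖ ^ 2 = (n : ℝ) :=
  Measure.quasiMeasurePreserving_fst (μ := μ) (ν := stdGaussian (Euc n)) |>.ae hμ.norm_sq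

lemma integrable_overlap_pow (hμ : IsotropicSphereLaw μ) (hn : 0 < n) (k : ℕ) :
    Integrable (fun p : Euc n × Euc n => overlap p.1 p.2 ^ k) (μ.prod μ) := by
  refine Integrable.of_bound (continuous_overlap.pow k).aestronglyMeasurable 1 ?_
  filter_upwards [hμ.ae_prod] with p hp
  rw [norm_pow]
  exact pow_le_one₀ (norm_nonneg _) (abs_overlap_le_one hn hp.1 hp.2)

lemma integral_overlap (hμ : IsotropicSphereLaw μ) (hn : 0 < n) :
    ∫ p : Euc n × Euc n, overlap p.1 p.2 ∂(μ.prod μ) = 0 := by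
  rw [integral_prod_symm _ (by simpa using hμ.integrable_overlap_pow hn 1)]
  simp only [overlap, integral_div, hμ.integral_inner]
  simp

lemma integral_overlap_sq (hμ : IsotropicSphereLaw μ) (hn : 0 < n) :
    ∫ p : Euc n × Euc n, overlap p.1 p.2 ^ 2 ∂(μ.prod μ) = 1 / n := by
  have hn' : (n : ℝ) ≠ 0 := by positivity
  rw [integral_prod_symm _ (hμ.integrable_overlap_pow hn 2)]
  simp only [overlap, div_pow, integral_div, hμ.integral_inner_sq]
  rw [integral_congr_ae hμ.norm_sq]
  simp only [integral_const, probReal_univ, smul_eq_mul]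
  field_simp

/-- By independence `E ⟨X, Y⟩³` is the sum of the squares `(E X_i X_j X_k)²`. -/
lemma integral_overlap_pow_three_nonneg (hμ : IsotropicSphereLaw μ) :
    0 ≤ ∫ p : Euc n × Euc n, overlap p.1 p.2 ^ 3 ∂(μ.prod μ) := by
  simp only [overlap, div_pow, integral_div]
  refine div_nonneg ?_ (by positivity)
  have h : ∀ p : Euc n × Euc n, inner ℝ p.1 p.2 ^ 3 =
      ∑ i, ∑ j, ∑ k, (p.1 i * p.1 j * p.1 k) * (p.2 i * p.2 j * p.2 k) := by
    intro p
    simp only [PiLp.inner_apply, RCLike.inner_apply, conj_trivial]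
    rw [pow_three, Finset.sum_mul_sum, Finset.sum_mul_sum]
    refine Finset.sum_congr rfl fun i _ => ?_
    refine Finset.sum_congr rfl fun j _ => ?_
    rw [Finset.mul_sum]
    refine Finset.sum_congr rfl fun k _ => by ring
  simp_rw [h]
  have hint := fun i j k => (hμ.integrable_coord_mul_mul i j k).mul_prod
    (hμ.integrable_coord_mul_mul i j k)
  rw [integral_finsetSum _ fun i _ => integrable_finsetSum _ fun j _ =>
    integrable_finsetSum _ fun k _ => hint i j k]
  refine Finset.sum_nonneg fun i _ => ?_
  rw [integral_finsetSum _ fun j _ => integrable_finsetSum _ fun k _ => hint i j k]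
  refine Finset.sum_nonneg fun j _ => ?_
  rw [integral_finsetSum _ fun k _ => hint i j k]
  refine Finset.sum_nonneg fun k _ => ?_
  rw [integral_prod_mul (fun x : Euc n => x i * x j * x k) (fun x : Euc n => x i * x j * x k)]
  exact mul_self_nonneg _

/-- Jensen's inequality with `E ξ² = 1/n`, obtained from `(ξ² - 1/n)² ≥ 0`. It allows every error of
order `1/n²` to be absorbed in the fourth moment. -/
lemma one_div_sq_le_integral_overlap_pow_four (hμ : IsotropicSphereLaw μ) (hn : 0 < n) :
    1 / (n : ℝ) ^ 2 ≤ ∫ p : Euc n × Euc n, overlap p.1 p.2 ^ 4 ∂(μ.prod μ) := by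
  have hn' : (n : ℝ) ≠ 0 := by positivity
  have h : ∫ p : Euc n × Euc n, (2 / n * overlap p.1 p.2 ^ 2 - 1 / (n : ℝ) ^ 2) ∂(μ.prod μ) ≤
      ∫ p : Euc n × Euc n, overlap p.1 p.2 ^ 4 ∂(μ.prod μ) := by
    refine integral_mono (((hμ.integrable_overlap_pow hn 2).const_mul _).sub (integrable_const _))
      (hμ.integrable_overlap_pow hn 4) fun p => ?_
    have := sq_nonneg (overlap p.1 p.2 ^ 2 - 1 / n)
    have h2 : (overlap p.1 p.2 ^ 2 - 1 / n) ^ 2 =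
      overlap p.1 p.2 ^ 4 - (2 / n * overlap p.1 p.2 ^ 2 - 1 / (n : ℝ) ^ 2) := by ring
    linarith
  rw [integral_sub ((hμ.integrable_overlap_pow hn 2).const_mul _) (integrable_const _),
    integral_const_mul, hμ.integral_overlap_sq hn] at h
  simp only [integral_const, probReal_univ, smul_eq_mul] at h
  convert h using 1
  field_simp
  ring

/-- From `|ξ|³/n ≤ ξ⁴/2 + ξ²/(2n²)`, where the last term has mean `1/(2n³) ≤ E ξ⁴/2`. It pays for
relative errors of order `1/n` in the coefficient of `E ξ³`. -/
lemma abs_integral_overlap_pow_three_div_le (hμ : IsotropicSphereLaw μ) (hn : 0 < n) :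
    |∫ p : Euc n × Euc n, overlap p.1 p.2 ^ 3 ∂(μ.prod μ)| / n ≤
      ∫ p : Euc n × Euc n, overlap p.1 p.2 ^ 4 ∂(μ.prod μ) := by
  have hn' : (n : ℝ) ≠ 0 := by positivity
  have hn1 : (1 : ℝ) ≤ n := by exact_mod_cast hn
  have h4 := hμ.one_div_sq_le_integral_overlap_pow_four hn
  have h : ∫ p : Euc n × Euc n, |overlap p.1 p.2 ^ 3| / n ∂(μ.prod μ) ≤
      ∫ p : Euc n × Euc n, (overlap p.1 p.2 ^ 4 / 2 + overlap p.1 p.2 ^ 2 / (2 * n ^ 2))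
        ∂(μ.prod μ) := by
    refine integral_mono ((hμ.integrable_overlap_pow hn 3).abs.div_const _)
      (((hμ.integrable_overlap_pow hn 4).div_const _).add
        ((hμ.integrable_overlap_pow hn 2).div_const _)) fun p => ?_
    have h1 : 0 ≤ overlap p.1 p.2 ^ 2 / 2 * (|overlap p.1 p.2| - 1 / n) ^ 2 := by positivity
    have h2 : overlap p.1 p.2 ^ 2 / 2 * (|overlap p.1 p.2| - 1 / n) ^ 2 =
        overlap p.1 p.2 ^ 4 / 2 + overlap p.1 p.2 ^ 2 / (2 * n ^ 2) -
          |overlap p.1 p.2 ^ 3| / n := by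
      rw [abs_pow, ← sq_abs, show overlap p.1 p.2 ^ 4 = |overlap p.1 p.2| ^ 4 from
        (Even.pow_abs (by decide) _).symm]
      field_simp
      ring
    simp only
    linarith
  rw [integral_add ((hμ.integrable_overlap_pow hn 4).div_const _)
        ((hμ.integrable_overlap_pow hn 2).div_const _), integral_div, integral_div, integral_div,
        hμ.integral_overlap_sq hn] at h
  have h5 : 1 / (n : ℝ) / (2 * n ^ 2) ≤ 1 / (n : ℝ) ^ 2 / 2 := by
    rw [div_div, div_div]
    apply one_div_le_one_div_of_le (by positivity)
    have : (0 : ℝ) ≤ (n : ℝ) ^ 2 := by positivity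
    nlinarith
  calc _ ≤ (∫ p : Euc n × Euc n, |overlap p.1 p.2 ^ 3| ∂(μ.prod μ)) / n := by
        gcongr
        exact abs_integral_le_integral_abs
    _ ≤ _ := by linarith

end IsotropicSphereLaw

end

/-! ### Moments of `η` and the second difference. -/

section

variable {n : ℕ} {μ : Measure (Euc n)} [IsProbabilityMeasure μ]

lemma integral_pow_three_gaussianReal : ∫ x, x ^ 3 ∂gaussianReal 0 1 = 0 := by
  have h : (gaussianReal 0 1).map (fun x => -x) = gaussianReal 0 1 := by
    rw [gaussianReal_map_neg, neg_zero]
  have h1 : ∫ x, x ^ 3 ∂gaussianReal 0 1 = ∫ x, (-x) ^ 3 ∂gaussianReal 0 1 := by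
    conv_lhs => rw [← h]
    rw [integral_map (by fun_prop) (by fun_prop)]
  have h2 : ∀ x : ℝ, (-x) ^ 3 = -x ^ 3 := fun x => by ring
  simp_rw [h2, integral_neg] at h1
  linarith

namespace IsotropicSphereLaw

lemma integrable_overlap_mul_radialDefect (hμ : IsotropicSphereLaw μ) (hn : 0 < n) (k l : ℕ) :
    Integrable (fun p : Euc n × Euc n => overlap p.1 p.2 ^ k * radialDefect p.2 ^ l)
      (μ.prod (stdGaussian (Euc n))) := by
  have h1 : Integrable (fun p : Euc n × Euc n => (1 + ‖p.2‖) ^ (k + 2 * l))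
      (μ.prod (stdGaussian (Euc n))) :=
    (integrable_one_add_norm_pow_stdGaussian (k + 2 * l)).comp_snd μ
  refine h1.mono' ((continuous_overlap.pow k).mul
    ((continuous_radialDefect.comp continuous_snd).pow l)).aestronglyMeasurable ?_
  filter_upwards [hμ.ae_prod_gaussian] with p hp
  rw [norm_mul, norm_pow, norm_pow, Real.norm_eq_abs, Real.norm_eq_abs, pow_add, pow_mul]
  have h2 : |overlap p.1 p.2| ≤ 1 + ‖p.2‖ := by
    linarith [abs_overlap_le_norm hn hp p.2]
  have h3 := abs_radialDefect_le hn p.2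
  gcongr

lemma integral_prod_gaussian_snd (f : Euc n → ℝ) :
    ∫ p : Euc n × Euc n, f p.2 ∂(μ.prod (stdGaussian (Euc n))) =
      ∫ g, f g ∂stdGaussian (Euc n) := by
  rw [integral_fun_snd]; simp

/-- Integrate in `x` first: the defect depends on `g` alone, and `⟨x, g⟩` is centered. -/
lemma integral_overlap_mul_radialDefect (hμ : IsotropicSphereLaw μ) (hn : 0 < n) (l : ℕ) :
    ∫ p : Euc n × Euc n, overlap p.1 p.2 * radialDefect p.2 ^ l
      ∂(μ.prod (stdGaussian (Euc n))) = 0 := by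
  have h := hμ.integrable_overlap_mul_radialDefect hn 1 l
  simp only [pow_one] at h
  rw [integral_prod_symm _ h]
  simp only [integral_mul_const, overlap, integral_div, hμ.integral_inner]
  simp

/-- By isotropy, for fixed `g` the mean of `⟨x, g⟩²/n²` is `‖g‖²/n² = (1 - ζ)/n`. -/
lemma integral_overlap_sq_mul_radialDefect (hμ : IsotropicSphereLaw μ) (hn : 0 < n) (l : ℕ) :
    ∫ p : Euc n × Euc n, overlap p.1 p.2 ^ 2 * radialDefect p.2 ^ l
      ∂(μ.prod (stdGaussian (Euc n))) =
      1 / n * (∫ g : Euc n, radialDefect g ^ l ∂stdGaussian (Euc n) -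
        ∫ g : Euc n, radialDefect g ^ (l + 1) ∂stdGaussian (Euc n)) := by
  have hn' : (n : ℝ) ≠ 0 := by positivity
  rw [integral_prod_symm _ (hμ.integrable_overlap_mul_radialDefect hn 2 l),
    ← integral_sub (integrable_radialDefect_pow hn _) (integrable_radialDefect_pow hn _),
    ← integral_const_mul]
  refine integral_congr_ae (.of_forall fun g => ?_)
  simp only [overlap, div_pow, integral_mul_const, integral_div, hμ.integral_inner_sq]
  rw [norm_sq_eq_radialDefect hn]
  field_simp
  ring

/-- Here `g` is integrated first: for `‖x‖ = √n` the variable `⟨x, g⟩` is centered Gaussian with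
variance `n`. -/
lemma integral_overlap_pow_gaussian (hμ : IsotropicSphereLaw μ) (hn : 0 < n) (k : ℕ) :
    ∫ p : Euc n × Euc n, overlap p.1 p.2 ^ k ∂(μ.prod (stdGaussian (Euc n))) =
      (√n / n) ^ k * ∫ x, x ^ k ∂gaussianReal 0 1 := by
  have h := hμ.integrable_overlap_mul_radialDefect hn k 0
  simp only [pow_zero, mul_one] at h
  rw [integral_prod _ h]
  have h2 : ∀ᵐ x ∂μ, ∫ g, overlap x g ^ k ∂stdGaussian (Euc n) =
      (√n / n) ^ k * ∫ x, x ^ k ∂gaussianReal 0 1 := by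
    filter_upwards [hμ.norm_sq] with x hx
    simp only [overlap, div_pow, integral_div]
    rw [integral_comp_inner_stdGaussian x (f := fun t => t ^ k) (by fun_prop), norm_eq_sqrt hx]
    simp only [mul_pow, integral_const_mul]
    ring
  rw [integral_congr_ae h2]
  simp

lemma integrable_gaussianOverlap_pow (hμ : IsotropicSphereLaw μ) (hn : 0 < n) (k : ℕ) :
    Integrable (fun p : Euc n × Euc n => gaussianOverlap p.1 p.2 ^ k)
      (μ.prod (stdGaussian (Euc n))) := by
  have h : ∀ p : Euc n × Euc n, gaussianOverlap p.1 p.2 ^ k = ∑ m ∈ Finset.range (k + 1),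
      ((1 / 2) ^ (k - m) * (k.choose m : ℝ)) *
        (overlap p.1 p.2 ^ m * radialDefect p.2 ^ (k - m)) := by
    intro p
    rw [gaussianOverlap, add_pow]
    refine Finset.sum_congr rfl fun m _ => ?_
    rw [div_pow, div_pow, one_pow]
    ring
  simp_rw [h]
  exact integrable_finsetSum _ fun m _ =>
    (hμ.integrable_overlap_mul_radialDefect hn m (k - m)).const_mul _

lemma integral_gaussianOverlap_pow (hμ : IsotropicSphereLaw μ) (hn : 0 < n) :
    ∫ p : Euc n × Euc n, gaussianOverlap p.1 p.2 ∂(μ.prod (stdGaussian (Euc n))) = 0 ∧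
    ∫ p : Euc n × Euc n, gaussianOverlap p.1 p.2 ^ 2 ∂(μ.prod (stdGaussian (Euc n))) =
      3 / (2 * n) ∧
    ∫ p : Euc n × Euc n, gaussianOverlap p.1 p.2 ^ 3 ∂(μ.prod (stdGaussian (Euc n))) =
      -4 / n ^ 2 ∧
    ∫ p : Euc n × Euc n, gaussianOverlap p.1 p.2 ^ 4 ∂(μ.prod (stdGaussian (Euc n))) ≤
      54 / n ^ 2 := by
  have hn' : (n : ℝ) ≠ 0 := by positivity
  obtain ⟨z1, z2, z3, z4⟩ := integral_radialDefect_pow hn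
  have hi := fun k l c => (hμ.integrable_overlap_mul_radialDefect hn k l).const_mul c
  have c1 := fun l => hμ.integral_overlap_mul_radialDefect hn l
  have c2 := fun l => hμ.integral_overlap_sq_mul_radialDefect hn l
  have hz := fun l : ℕ => integral_prod_gaussian_snd (μ := μ) fun g : Euc n => radialDefect g ^ l
  refine ⟨?_, ?_, ?_, ?_⟩
  · have h : ∀ p : Euc n × Euc n, gaussianOverlap p.1 p.2 =
        1 * (overlap p.1 p.2 ^ 1 * radialDefect p.2 ^ 0) +
        1 / 2 * (overlap p.1 p.2 ^ 0 * radialDefect p.2 ^ 1) := by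
      intro p; unfold gaussianOverlap; ring
    simp_rw [h]
    rw [integral_add (hi _ _ _) (hi _ _ _), integral_const_mul, integral_const_mul]
    have c10 := c1 0
    have hz1 := hz 1
    simp only [pow_one, pow_zero, one_mul, mul_one] at c10 hz1 ⊢
    rw [hz1, z1, c10]
    simp
  · have h : ∀ p : Euc n × Euc n, gaussianOverlap p.1 p.2 ^ 2 =
        1 * (overlap p.1 p.2 ^ 2 * radialDefect p.2 ^ 0) +
        1 * (overlap p.1 p.2 ^ 1 * radialDefect p.2 ^ 1) +
        1 / 4 * (overlap p.1 p.2 ^ 0 * radialDefect p.2 ^ 2) := by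
      intro p; unfold gaussianOverlap; ring
    simp_rw [h]
    rw [integral_add ((hi _ _ _).fun_add (hi _ _ _)) (hi _ _ _), integral_add (hi _ _ _) (hi _ _ _),
      integral_const_mul, integral_const_mul, integral_const_mul, c2]
    have c11 := c1 1
    simp only [pow_one, pow_zero, one_mul, zero_add] at c11 ⊢
    rw [hz 2, z1, z2, c11]
    simp only [integral_const, probReal_univ, smul_eq_mul]
    field_simp
    ring
  · have h : ∀ p : Euc n × Euc n, gaussianOverlap p.1 p.2 ^ 3 =
        1 * (overlap p.1 p.2 ^ 3 * radialDefect p.2 ^ 0) +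
        3 / 2 * (overlap p.1 p.2 ^ 2 * radialDefect p.2 ^ 1) +
        3 / 4 * (overlap p.1 p.2 ^ 1 * radialDefect p.2 ^ 2) +
        1 / 8 * (overlap p.1 p.2 ^ 0 * radialDefect p.2 ^ 3) := by
      intro p; unfold gaussianOverlap; ring
    simp_rw [h]
    rw [integral_add (((hi _ _ _).fun_add (hi _ _ _)).fun_add (hi _ _ _)) (hi _ _ _),
      integral_add ((hi _ _ _).fun_add (hi _ _ _)) (hi _ _ _), integral_add (hi _ _ _) (hi _ _ _),
      integral_const_mul, integral_const_mul, integral_const_mul, integral_const_mul, c2]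
    have c12 := c1 2
    have c3 := hμ.integral_overlap_pow_gaussian hn 3
    rw [integral_pow_three_gaussianReal] at c3
    simp only [pow_one, pow_zero, one_mul, mul_one] at c12 ⊢
    rw [hz 3, z3, c12, c3]
    simp only [one_add_one_eq_two, z1, z2]
    field_simp
    ring
  -- By `(a + b)⁴ ≤ 8(a⁴ + b⁴)` the constant is `54 = 8 * 3 + (8 / 16) * 60`.
  · have h : ∀ p : Euc n × Euc n, gaussianOverlap p.1 p.2 ^ 4 ≤
        8 * (overlap p.1 p.2 ^ 4 * radialDefect p.2 ^ 0) +
        1 / 2 * (overlap p.1 p.2 ^ 0 * radialDefect p.2 ^ 4) := by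
      intro p
      unfold gaussianOverlap
      have key : ∀ a b : ℝ, (a + b) ^ 4 ≤ 8 * (a ^ 4 + b ^ 4) := fun a b => by
        nlinarith [sq_nonneg (a - b), sq_nonneg (a + b), sq_nonneg (a ^ 2 - b ^ 2),
          sq_nonneg ((a - b) * (a + b)), sq_nonneg ((a - b) ^ 2), mul_nonneg (sq_nonneg (a - b))
          (sq_nonneg (a + b)), mul_nonneg (sq_nonneg (a - b)) (sq_nonneg a),
          mul_nonneg (sq_nonneg (a - b)) (sq_nonneg b)]
      refine (key _ _).trans (le_of_eq (by ring))
    refine (integral_mono (hμ.integrable_gaussianOverlap_pow hn 4) ((hi _ _ _).add (hi _ _ _))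
      h).trans ?_
    rw [integral_add' (hi _ _ _) (hi _ _ _), integral_const_mul, integral_const_mul]
    have c4 := hμ.integral_overlap_pow_gaussian hn 4
    rw [integral_pow_four_gaussianReal, div_pow, show √(n : ℝ) ^ 4 = (√(n : ℝ) ^ 2) ^ 2 by ring,
      Real.sq_sqrt (by positivity)] at c4
    simp only [pow_zero, one_mul, mul_one]
    rw [hz 4, c4]
    have h5 : (8 : ℝ) * ((n : ℝ) ^ 2 / n ^ 4 * 3) = 24 / n ^ 2 := by field_simp; ring
    have h6 : (54 : ℝ) / n ^ 2 = 24 / n ^ 2 + 1 / 2 * (60 / n ^ 2) := by ring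
    rw [h5, h6]
    linarith

end IsotropicSphereLaw

section Expansion

variable {w : ℝ → ℝ} {c₀ c₁ c₂ c₃ K : ℝ}

/-- The pointwise expansion is integrated; it also yields integrability of `w ∘ X`, whose distance
to a cubic in `X` is dominated by `K * X ^ 4`. -/
lemma integrable_and_abs_integral_sub_le {α : Type*} [MeasurableSpace α] {m : Measure α}
    [IsProbabilityMeasure m] {X : α → ℝ} (hw : Continuous w)
    (hexp : ∀ x ≤ 1, |w x - (c₀ + c₁ * x + c₂ * x ^ 2 + c₃ * x ^ 3)| ≤ K * x ^ 4)
    (hX : AEMeasurable X m) (hX1 : ∀ᵐ a ∂m, X a ≤ 1) (hi : ∀ k : ℕ, Integrable (fun a => X a ^ k) m) :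
    Integrable (fun a => w (X a)) m ∧
      |∫ a, w (X a) ∂m - (c₀ + c₁ * ∫ a, X a ∂m + c₂ * ∫ a, X a ^ 2 ∂m + c₃ * ∫ a, X a ^ 3 ∂m)| ≤
        K * ∫ a, X a ^ 4 ∂m := by
  have i1 : Integrable X m := by simpa using hi 1
  have j1 : Integrable (fun a => c₀ + c₁ * X a) m := (integrable_const _).add (i1.const_mul _)
  have j2 : Integrable (fun a => c₀ + c₁ * X a + c₂ * X a ^ 2) m := j1.add ((hi 2).const_mul _)
  have j3 : Integrable (fun a => c₀ + c₁ * X a + c₂ * X a ^ 2 + c₃ * X a ^ 3) m :=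
    j2.add ((hi 3).const_mul _)
  have hb : ∀ᵐ a ∂m, ‖w (X a) - (c₀ + c₁ * X a + c₂ * X a ^ 2 + c₃ * X a ^ 3)‖ ≤ K * X a ^ 4 := by
    filter_upwards [hX1] with a ha using hexp _ ha
  have hd : Integrable (fun a => w (X a) - (c₀ + c₁ * X a + c₂ * X a ^ 2 + c₃ * X a ^ 3)) m :=
    ((hi 4).const_mul K).mono'
      ((hw.measurable.comp_aemeasurable hX).sub j3.aemeasurable).aestronglyMeasurable hb
  have hwi : Integrable (fun a => w (X a)) m := by
    have h := hd.add j3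
    refine h.congr (.of_forall fun a => ?_)
    simp
  refine ⟨hwi, ?_⟩
  have h3 : ∫ a, (c₀ + c₁ * X a + c₂ * X a ^ 2 + c₃ * X a ^ 3) ∂m =
      c₀ + c₁ * ∫ a, X a ∂m + c₂ * ∫ a, X a ^ 2 ∂m + c₃ * ∫ a, X a ^ 3 ∂m := by
    rw [integral_add j2 ((hi 3).const_mul _), integral_add j1 ((hi 2).const_mul _),
      integral_add (integrable_const _) (i1.const_mul _), integral_const_mul, integral_const_mul,
      integral_const_mul]
    simp
  rw [← h3, ← integral_sub hwi j3, ← integral_const_mul]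
  exact norm_integral_le_of_norm_le ((hi 4).const_mul K) hb

/-- Comparison of the averages of a smooth function at the overlaps of `X` with an independent
copy, of `X` with a Gaussian vector, and at the radial defect of a Gaussian vector: the
contributions of the first three moments cancel except for the third moment of the overlap. -/
lemma IsotropicSphereLaw.integrable_and_abs_second_difference_le (hμ : IsotropicSphereLaw μ)
    (hn : 0 < n) (hK : 0 ≤ K) (hw : Continuous w)
    (hexp : ∀ x ≤ 1, |w x - (c₀ + c₁ * x + c₂ * x ^ 2 + c₃ * x ^ 3)| ≤ K * x ^ 4) :
    Integrable (fun p : Euc n × Euc n => w (overlap p.1 p.2)) (μ.prod μ) ∧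
    Integrable (fun p : Euc n × Euc n => w (gaussianOverlap p.1 p.2))
      (μ.prod (stdGaussian (Euc n))) ∧
    Integrable (fun g : Euc n => w (radialDefect g)) (stdGaussian (Euc n)) ∧
    |(∫ p : Euc n × Euc n, w (overlap p.1 p.2) ∂(μ.prod μ)) -
      2 * (∫ p : Euc n × Euc n, w (gaussianOverlap p.1 p.2) ∂(μ.prod (stdGaussian (Euc n)))) +
      (∫ g : Euc n, w (radialDefect g) ∂(stdGaussian (Euc n))) -
      c₃ * ∫ p : Euc n × Euc n, overlap p.1 p.2 ^ 3 ∂(μ.prod μ)| ≤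
      169 * K * ∫ p : Euc n × Euc n, overlap p.1 p.2 ^ 4 ∂(μ.prod μ) := by
  have hn' : (n : ℝ) ≠ 0 := by positivity
  obtain ⟨z1, z2, z3, z4⟩ := integral_radialDefect_pow hn
  obtain ⟨y1, y2, y3, y4⟩ := hμ.integral_gaussianOverlap_pow hn
  have x1 := hμ.integral_overlap hn
  have x2 := hμ.integral_overlap_sq hn
  have x4 := hμ.one_div_sq_le_integral_overlap_pow_four hn
  obtain ⟨ix, ex⟩ := integrable_and_abs_integral_sub_le (m := μ.prod μ)
    (X := fun p : Euc n × Euc n => overlap p.1 p.2) hw hexp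
    continuous_overlap.aemeasurable
    (by filter_upwards [hμ.ae_prod] with p hp using overlap_le_one hn hp.1 hp.2)
    (hμ.integrable_overlap_pow hn)
  obtain ⟨iy, ey⟩ := integrable_and_abs_integral_sub_le (m := μ.prod (stdGaussian (Euc n)))
    (X := fun p : Euc n × Euc n => gaussianOverlap p.1 p.2) hw hexp
    continuous_gaussianOverlap.aemeasurable
    (by filter_upwards [hμ.ae_prod_gaussian] with p hp using gaussianOverlap_le_one hn hp)
    (hμ.integrable_gaussianOverlap_pow hn)
  obtain ⟨iz, ez⟩ := integrable_and_abs_integral_sub_le (m := stdGaussian (Euc n))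
    (X := fun g : Euc n => radialDefect g) hw hexp
    continuous_radialDefect.aemeasurable (.of_forall radialDefect_le_one)
    (integrable_radialDefect_pow hn)
  refine ⟨ix, iy, iz, ?_⟩
  rw [x1, x2] at ex
  rw [y1, y2, y3] at ey
  rw [z1, z2, z3] at ez
  -- The constant is `169 = 1 + 2 * 54 + 60`, with `1/n²` bounded by the fourth moment. The
  -- identities `f3` and `f4` are the cancellations `1 - 3 + 2 = 0` at order two and `8 - 8 = 0` at
  -- order three.
  have e1 := mul_le_mul_of_nonneg_left y4 hK
  have e2 := mul_le_mul_of_nonneg_left z4 hK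
  have e3 := mul_le_mul_of_nonneg_left x4 hK
  have f1 : K * (54 / (n : ℝ) ^ 2) = 54 * (K * (1 / (n : ℝ) ^ 2)) := by ring
  have f2 : K * (60 / (n : ℝ) ^ 2) = 60 * (K * (1 / (n : ℝ) ^ 2)) := by ring
  have f3 : c₂ * (1 / (n : ℝ)) - 2 * (c₂ * (3 / (2 * n))) + c₂ * (2 / n) = 0 := by
    field_simp; ring
  have f4 : -2 * (c₃ * (-4 / (n : ℝ) ^ 2)) + c₃ * (-8 / n ^ 2) = 0 := by
    field_simp; ring
  rw [abs_le] at ex ey ez ⊢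
  constructor <;> linarith

end Expansion

end

/-! ### The `L²` distance of distribution functions as an energy distance. -/

section

section Energy

/-- The distribution function of the Dirac mass at `a`. -/
noncomputable def step (a x : ℝ) : ℝ := (Set.Iic x).indicator 1 a

lemma step_of_le {a x : ℝ} (h : a ≤ x) : step a x = 1 := by simp [step, h]

lemma step_of_lt {a x : ℝ} (h : x < a) : step a x = 0 := by simp [step, h]

lemma step_mul_step (a b x : ℝ) : step a x * step b x = step (max a b) x := by
  rcases le_or_gt a x with ha | ha
  · rcases le_or_gt b x with hb | hb
    · rw [step_of_le ha, step_of_le hb, step_of_le (max_le ha hb), one_mul]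
    · rw [step_of_lt hb, step_of_lt (lt_max_of_lt_right hb), mul_zero]
  · rw [step_of_lt ha, step_of_lt (lt_max_of_lt_left ha), zero_mul]

lemma measurable_step : Measurable fun p : ℝ × ℝ => step p.1 p.2 := by
  have h : (fun p : ℝ × ℝ => step p.1 p.2) = {p : ℝ × ℝ | p.1 ≤ p.2}.indicator 1 := by
    ext p
    by_cases hp : p.1 ≤ p.2
    · rw [step_of_le hp]; simp [hp]
    · rw [step_of_lt (not_le.1 hp)]; simp [hp]
  rw [h]
  exact measurable_one.indicator (measurableSet_le measurable_fst measurable_snd)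

lemma step_sub_step_of_le {a b : ℝ} (h : a ≤ b) :
    (fun x => step a x - step b x) = (Set.Ico a b).indicator 1 := by
  ext x
  rcases lt_or_ge x a with h1 | h1
  · rw [step_of_lt h1, step_of_lt (h1.trans_le h)]; simp [h1]
  · rcases lt_or_ge x b with h2 | h2
    · rw [step_of_le h1, step_of_lt h2]; simp [h1, h2]
    · rw [step_of_le h1, step_of_le h2]; simp [h2]

lemma integrable_step_sub_step (a b : ℝ) : Integrable fun x => step a x - step b x := by
  have key : ∀ a b : ℝ, a ≤ b → Integrable fun x => step a x - step b x := fun a b h => by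
    rw [step_sub_step_of_le h]
    exact (integrable_indicator_iff measurableSet_Ico).2
      (integrableOn_const (by simp) (by simp) : IntegrableOn (fun _ => (1 : ℝ)) _ _)
  rcases le_total a b with h | h
  · exact key a b h
  · refine (key b a h).neg.congr (.of_forall fun x => ?_)
    simp

lemma integral_step_sub_step (a b : ℝ) : ∫ x, (step a x - step b x) = b - a := by
  have key : ∀ a b : ℝ, a ≤ b → ∫ x, (step a x - step b x) = b - a := fun a b h => by
    rw [step_sub_step_of_le h, integral_indicator_one measurableSet_Ico]
    simp [h]
  rcases le_total a b with h | h
  · exact key a b h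
  · rw [← neg_sub a b, ← key b a h, ← integral_neg]
    simp

lemma integral_abs_step_sub_step (a b : ℝ) : ∫ x, |step a x - step b x| = |a - b| := by
  have key : ∀ a b : ℝ, a ≤ b → ∫ x, |step a x - step b x| = |a - b| := fun a b h => by
    rw [abs_sub_comm, abs_of_nonneg (sub_nonneg.2 h), ← integral_step_sub_step]
    refine integral_congr_ae (.of_forall fun x => ?_)
    have h1 := congrFun (step_sub_step_of_le h) x
    simp only at h1 ⊢
    rw [h1, abs_of_nonneg]
    exact Set.indicator_nonneg (by simp) x
  rcases le_total a b with h | h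
  · exact key a b h
  · simp_rw [abs_sub_comm (step a _)]
    rw [key b a h, abs_sub_comm]

lemma abs_step_sub_step_le (a b x : ℝ) : |step a x - step b x| ≤ 1 := by
  rcases le_or_gt a x with ha | ha <;> rcases le_or_gt b x with hb | hb <;>
    simp [step_of_le, step_of_lt, ha, hb]

lemma max_eq_half_add_abs (a b : ℝ) : max a b = (a + b + |a - b|) / 2 := by
  rcases le_total a b with h | h
  · rw [max_eq_right h, abs_of_nonpos (sub_nonpos.2 h)]; ring
  · rw [max_eq_left h, abs_of_nonneg (sub_nonneg.2 h)]; ring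

/-- A product of steps is the step at the maximum, and `max` is half the sum plus half the absolute
difference; the linear parts cancel. -/
lemma integral_step_sub_step_mul (a b c d : ℝ) :
    ∫ x, (step a x - step b x) * (step c x - step d x) =
      (|a - d| + |c - b| - |a - c| - |b - d|) / 2 := by
  have h : ∀ x, (step a x - step b x) * (step c x - step d x) =
      (step (max a c) x - step (max a d) x) - (step (max b c) x - step (max b d) x) := by
    intro x
    simp only [← step_mul_step]
    ring
  simp_rw [h]
  rw [integral_sub (integrable_step_sub_step _ _) (integrable_step_sub_step _ _),
    integral_step_sub_step, integral_step_sub_step]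
  simp only [max_eq_half_add_abs, abs_sub_comm c b]
  ring

lemma cdf_eq_integral_step (α : Measure ℝ) [IsProbabilityMeasure α] (x : ℝ) :
    cdf α x = ∫ a, step a x ∂α := by
  rw [cdf_eq_real]
  simp only [step]
  rw [integral_indicator_one measurableSet_Iic]

lemma integrable_step (α : Measure ℝ) [IsProbabilityMeasure α] (x : ℝ) :
    Integrable (fun a => step a x) α :=
  Integrable.of_bound (measurable_step.comp (measurable_id.prodMk
    measurable_const)).aestronglyMeasurable 1 (.of_forall fun a => by
      rcases le_or_gt a x with h | h <;> simp [step_of_le, step_of_lt, h])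

variable {α β : Measure ℝ} [IsProbabilityMeasure α] [IsProbabilityMeasure β]

lemma integrable_abs_sub_prod (hα : Integrable id α) (hβ : Integrable id β) :
    Integrable (fun z : ℝ × ℝ => |z.1 - z.2|) (α.prod β) :=
  ((hα.comp_fst β).sub (hβ.comp_snd α)).abs

/-- Steps are not integrable over the line but their differences are; averaging differences over the
product measure is what permits Fubini in `x`. -/
lemma cdf_sub_cdf_eq_integral (x : ℝ) :
    cdf α x - cdf β x = ∫ p : ℝ × ℝ, (step p.1 x - step p.2 x) ∂(α.prod β) := by
  rw [integral_sub ((integrable_step α x).comp_fst β) ((integrable_step β x).comp_snd α),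
    integral_fun_fst (fun a => step a x), integral_fun_snd (fun a => step a x),
    cdf_eq_integral_step, cdf_eq_integral_step]
  simp

/-- One factor is bounded by `1`; the other has `L¹` norm `|a - b|` in `x`, integrable by the first
moments. -/
lemma integrable_step_product (hα : Integrable id α) (hβ : Integrable id β) :
    Integrable (fun q : ℝ × ((ℝ × ℝ) × (ℝ × ℝ)) =>
      (step q.2.1.1 q.1 - step q.2.1.2 q.1) * (step q.2.2.1 q.1 - step q.2.2.2 q.1))
      ((volume : Measure ℝ).prod ((α.prod β).prod (α.prod β))) := by
  have hm : ∀ f : ℝ × ((ℝ × ℝ) × (ℝ × ℝ)) → ℝ, Measurable f →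
      Measurable fun q : ℝ × ((ℝ × ℝ) × (ℝ × ℝ)) => step (f q) q.1 := fun f hf =>
    measurable_step.comp (hf.prodMk measurable_fst)
  have hm1 : Measurable fun q : ℝ × ((ℝ × ℝ) × (ℝ × ℝ)) =>
      step q.2.1.1 q.1 - step q.2.1.2 q.1 :=
    (hm (fun q => q.2.1.1) (by fun_prop)).sub (hm (fun q => q.2.1.2) (by fun_prop))
  have hm2 : Measurable fun q : ℝ × ((ℝ × ℝ) × (ℝ × ℝ)) =>
      step q.2.2.1 q.1 - step q.2.2.2 q.1 :=
    (hm (fun q => q.2.2.1) (by fun_prop)).sub (hm (fun q => q.2.2.2) (by fun_prop))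
  have h1 : Integrable (fun q : ℝ × ((ℝ × ℝ) × (ℝ × ℝ)) =>
      step q.2.1.1 q.1 - step q.2.1.2 q.1)
      ((volume : Measure ℝ).prod ((α.prod β).prod (α.prod β))) := by
    rw [integrable_prod_iff' hm1.aestronglyMeasurable]
    refine ⟨.of_forall fun p => integrable_step_sub_step p.1.1 p.1.2, ?_⟩
    simp only [Real.norm_eq_abs, integral_abs_step_sub_step]
    exact (integrable_abs_sub_prod hα hβ).comp_fst _
  refine h1.norm.mono' (hm1.mul hm2).aestronglyMeasurable (.of_forall fun q => ?_)
  rw [norm_mul]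
  exact mul_le_of_le_one_right (norm_nonneg _) (abs_step_sub_step_le _ _ _)

lemma integrable_cdf_sub_cdf_sq (hα : Integrable id α) (hβ : Integrable id β) :
    Integrable fun x => (cdf α x - cdf β x) ^ 2 := by
  have h := (integrable_step_product hα hβ).integral_prod_left
  refine h.congr (.of_forall fun x => ?_)
  simp only
  rw [integral_prod_mul (fun p : ℝ × ℝ => step p.1 x - step p.2 x)
    (fun p : ℝ × ℝ => step p.1 x - step p.2 x), ← cdf_sub_cdf_eq_integral, sq]

/-- The squared `L²`-distance of two distribution functions is the energy distance. -/
lemma integral_cdf_sub_cdf_sq (hα : Integrable id α) (hβ : Integrable id β) :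
    ∫ x, (cdf α x - cdf β x) ^ 2 = ∫ z : ℝ × ℝ, |z.1 - z.2| ∂(α.prod β) -
      (∫ z : ℝ × ℝ, |z.1 - z.2| ∂(α.prod α)) / 2 - (∫ z : ℝ × ℝ, |z.1 - z.2| ∂(β.prod β)) / 2 := by
  have h1 : ∀ x, (cdf α x - cdf β x) ^ 2 = ∫ p : (ℝ × ℝ) × (ℝ × ℝ),
      (step p.1.1 x - step p.1.2 x) * (step p.2.1 x - step p.2.2 x)
        ∂((α.prod β).prod (α.prod β)) := by
    intro x
    rw [integral_prod_mul (fun p : ℝ × ℝ => step p.1 x - step p.2 x)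
      (fun p : ℝ × ℝ => step p.1 x - step p.2 x), ← cdf_sub_cdf_eq_integral, sq]
  simp_rw [h1]
  rw [integral_integral_swap (integrable_step_product hα hβ)]
  simp_rw [integral_step_sub_step_mul]
  -- Each pair takes one coordinate from each of the two independent copies of `α.prod β`, so its
  -- law is again a product measure.
  have m1 : MeasurePreserving (fun p : (ℝ × ℝ) × (ℝ × ℝ) => (p.1.1, p.2.2))
      ((α.prod β).prod (α.prod β)) (α.prod β) :=
    (measurePreserving_fst (μ := α) (ν := β)).prod (measurePreserving_snd (μ := α) (ν := β))
  have m2 : MeasurePreserving (fun p : (ℝ × ℝ) × (ℝ × ℝ) => (p.2.1, p.1.2))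
      ((α.prod β).prod (α.prod β)) (α.prod β) :=
    m1.comp (Measure.measurePreserving_swap (μ := α.prod β) (ν := α.prod β))
  have m3 : MeasurePreserving (fun p : (ℝ × ℝ) × (ℝ × ℝ) => (p.1.1, p.2.1))
      ((α.prod β).prod (α.prod β)) (α.prod α) :=
    (measurePreserving_fst (μ := α) (ν := β)).prod (measurePreserving_fst (μ := α) (ν := β))
  have m4 : MeasurePreserving (fun p : (ℝ × ℝ) × (ℝ × ℝ) => (p.1.2, p.2.2))
      ((α.prod β).prod (α.prod β)) (β.prod β) :=
    (measurePreserving_snd (μ := α) (ν := β)).prod (measurePreserving_snd (μ := α) (ν := β))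
  have hc : Measurable fun z : ℝ × ℝ => |z.1 - z.2| := by fun_prop
  have i1 := m1.integrable_comp_of_integrable (integrable_abs_sub_prod hα hβ)
  have i2 := m2.integrable_comp_of_integrable (integrable_abs_sub_prod hα hβ)
  have i3 := m3.integrable_comp_of_integrable (integrable_abs_sub_prod hα hα)
  have i4 := m4.integrable_comp_of_integrable (integrable_abs_sub_prod hβ hβ)
  have e := fun {γ : Measure (ℝ × ℝ)} {φ : (ℝ × ℝ) × (ℝ × ℝ) → ℝ × ℝ}
      (m : MeasurePreserving φ ((α.prod β).prod (α.prod β)) γ) => by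
    have h := integral_map (μ := (α.prod β).prod (α.prod β)) m.measurable.aemeasurable
      (f := fun z : ℝ × ℝ => |z.1 - z.2|) hc.aestronglyMeasurable
    rw [m.map_eq] at h
    exact h
  rw [e m1, e m3, e m4, integral_div]
  have e1 := e m1
  have e2 := e m2
  rw [e1] at e2
  simp only [Function.comp_def] at i1 i2 i3 i4
  have i5 : Integrable (fun x : (ℝ × ℝ) × (ℝ × ℝ) => |x.1.1 - x.2.2| + |x.2.1 - x.1.2| -
    |x.1.1 - x.2.1|) ((α.prod β).prod (α.prod β)) := (i1.add i2).sub i3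
  rw [integral_sub i5 i4, integral_sub (i1.fun_add i2) i3,
    integral_add i1 i2, ← e2]
  ring

end Energy

end

/-! ### One-dimensional projections and the spherical mean of `|⟨θ, a⟩|`. -/

section

/-- The law of `⟨θ, X⟩` when `X` has law `μ`. -/
noncomputable def projLaw {n : ℕ} (μ : Measure (Euc n)) (θ : Euc n) : Measure ℝ :=
  μ.map fun x => inner ℝ θ x

variable {n : ℕ} {μ : Measure (Euc n)} [IsProbabilityMeasure μ]

instance isProbabilityMeasure_projLaw (θ : Euc n) : IsProbabilityMeasure (projLaw μ θ) :=
  Measure.isProbabilityMeasure_map (by fun_prop)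

lemma projLaw_stdGaussian {θ : Euc n} (hθ : ‖θ‖ = 1) :
    projLaw (stdGaussian (Euc n)) θ = gaussianReal 0 1 := by
  rw [projLaw, map_inner_stdGaussian, hθ]
  simp

lemma integrable_norm_of_integrable {ν : Measure (Euc n)} (h : Integrable (fun x => ‖x‖) ν)
    (θ : Euc n) : Integrable id (projLaw ν θ) := by
  rw [projLaw, integrable_map_measure (by fun_prop) (by fun_prop)]
  refine (h.const_mul ‖θ‖).mono' (by fun_prop) (.of_forall fun x => ?_)
  exact abs_real_inner_le_norm θ x

lemma integrable_norm_stdGaussian : Integrable (fun x : Euc n => ‖x‖) (stdGaussian (Euc n)) := by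
  simpa using integrable_norm_pow_stdGaussian (E := Euc n) 1

lemma IsotropicSphereLaw.integrable_norm (hμ : IsotropicSphereLaw μ) :
    Integrable (fun x => ‖x‖) μ :=
  hμ.integrable_of_bound continuous_norm (√n) fun x hx => by rw [abs_norm, norm_eq_sqrt hx]

lemma integral_abs_sub_projLaw_prod {ν₁ ν₂ : Measure (Euc n)} [IsProbabilityMeasure ν₁]
    [IsProbabilityMeasure ν₂] (θ : Euc n) :
    ∫ z : ℝ × ℝ, |z.1 - z.2| ∂((projLaw ν₁ θ).prod (projLaw ν₂ θ)) =
      ∫ p : Euc n × Euc n, |inner ℝ θ (p.1 - p.2)| ∂(ν₁.prod ν₂) := by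
  rw [projLaw, projLaw, Measure.map_prod_map _ _ (by fun_prop) (by fun_prop),
    integral_map (by fun_prop) (by fun_prop)]
  simp [inner_sub_right]

lemma integral_abs_sub_gaussianReal_prod :
    ∫ z : ℝ × ℝ, |z.1 - z.2| ∂((gaussianReal 0 1).prod (gaussianReal 0 1)) =
      √2 * √(2 / Real.pi) := by
  have h1 : ((gaussianReal 0 1).prod (gaussianReal 0 1)).map (fun z : ℝ × ℝ => z.1 - z.2) =
      (gaussianReal 0 1).map (fun x => √2 * x) := by
    have h2 : (gaussianReal 0 1).map (fun x => -x) = gaussianReal 0 1 := by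
      rw [gaussianReal_map_neg, neg_zero]
    have h3 : (gaussianReal 0 1).prod (gaussianReal 0 1) =
        ((gaussianReal 0 1).prod (gaussianReal 0 1)).map
          (Prod.map (fun x : ℝ => x) (fun x : ℝ => -x)) := by
      rw [← Measure.map_prod_map _ _ (by fun_prop) (by fun_prop), h2]
      simp
    rw [h3, Measure.map_map (by fun_prop) (by fun_prop), gaussianReal_map_const_mul]
    have h4 := gaussianReal_conv_gaussianReal (m₁ := 0) (m₂ := 0) (v₁ := 1) (v₂ := 1)
    rw [Measure.conv] at h4
    have h5 : ((fun z : ℝ × ℝ => z.1 - z.2) ∘ Prod.map (fun x : ℝ => x) (fun x : ℝ => -x)) =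
        fun z : ℝ × ℝ => z.1 + z.2 := by
      ext z; simp
    rw [h5, h4]
    congr 1
    · simp
    · ext; simp; norm_num
  have h6 := integral_map (μ := (gaussianReal 0 1).prod (gaussianReal 0 1))
    (φ := fun z : ℝ × ℝ => z.1 - z.2) (by fun_prop) (f := fun x : ℝ => |x|) (by fun_prop)
  rw [h1, integral_map (by fun_prop) (by fun_prop)] at h6
  rw [← h6]
  simp_rw [abs_mul, abs_of_nonneg (Real.sqrt_nonneg 2)]
  rw [integral_const_mul, integral_abs_gaussianReal]

/-- The mean of `|⟨θ, e⟩|` over the sphere, for a unit vector `e`. -/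
noncomputable def sphereAbsMean (n : ℕ) : ℝ :=
  √(2 / Real.pi) / ∫ v, ‖v‖ ∂stdGaussian (Euc n)

lemma integral_norm_stdGaussian_eq (hn : 0 < n) :
    ∫ v, ‖v‖ ∂stdGaussian (Euc n) = √n * ∫ g, √(1 - radialDefect g) ∂stdGaussian (Euc n) := by
  rw [← integral_const_mul]
  refine integral_congr_ae (.of_forall fun g => ?_)
  simp only
  rw [← Real.sqrt_mul (by positivity), ← norm_sq_eq_radialDefect hn, Real.sqrt_sq (norm_nonneg _)]

lemma integrable_sqrt_radialDefect (hn : 0 < n) :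
    Integrable (fun g : Euc n => √(1 - radialDefect g)) (stdGaussian (Euc n)) :=
  (integrable_and_abs_integral_sub_le (m := stdGaussian (Euc n)) (w := fun x => √(1 - x))
    (by fun_prop) (fun _ hx => abs_sqrt_one_sub_sub_taylor_le hx)
    continuous_radialDefect.aemeasurable (.of_forall radialDefect_le_one)
    (integrable_radialDefect_pow hn)).1

/-- From `1 - ζ/2 - ζ²/2 ≤ √(1 - ζ) ≤ 1 - ζ/2` together with `E ζ = 0` and `E ζ² = 2/n`. -/
lemma integral_sqrt_radialDefect_bounds (hn : 0 < n) :
    1 - 1 / (n : ℝ) ≤ ∫ g : Euc n, √(1 - radialDefect g) ∂stdGaussian (Euc n) ∧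
      ∫ g : Euc n, √(1 - radialDefect g) ∂stdGaussian (Euc n) ≤ 1 := by
  obtain ⟨z1, z2, -, -⟩ := integral_radialDefect_pow hn
  have i1 : Integrable (fun g : Euc n => radialDefect g) (stdGaussian (Euc n)) := by
    simpa using integrable_radialDefect_pow (n := n) hn 1
  have i2 := integrable_radialDefect_pow (n := n) hn 2
  have j1 : Integrable (fun g : Euc n => 1 - radialDefect g / 2) (stdGaussian (Euc n)) :=
    (integrable_const _).sub (i1.div_const _)
  have e1 : ∫ g : Euc n, (1 - radialDefect g / 2) ∂stdGaussian (Euc n) = 1 := by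
    rw [integral_sub (integrable_const _) (i1.div_const _), integral_div, z1]
    simp
  constructor
  · have e2 : ∫ g : Euc n, (1 - radialDefect g / 2 - radialDefect g ^ 2 / 2)
        ∂stdGaussian (Euc n) = 1 - 1 / (n : ℝ) := by
      rw [integral_sub j1 (i2.div_const _), e1, integral_div, z2]
      ring
    rw [← e2]
    refine integral_mono (j1.sub (i2.div_const _)) (integrable_sqrt_radialDefect hn) fun g => ?_
    have h1 := Real.sqrt_nonneg (1 - radialDefect g)
    have h2 := Real.sq_sqrt (sub_nonneg.2 (radialDefect_le_one g))
    simp only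
    generalize √(1 - radialDefect g) = u at h1 h2 ⊢
    rw [show radialDefect g = 1 - u ^ 2 by linarith]
    nlinarith [mul_nonneg (mul_nonneg h1 (sq_nonneg (u - 1))) (by linarith : 0 ≤ u + 2)]
  · refine (integral_mono (integrable_sqrt_radialDefect hn) j1 fun g => ?_).trans_eq e1
    have h2 := Real.sq_sqrt (sub_nonneg.2 (radialDefect_le_one g))
    simp only
    nlinarith [sq_nonneg (√(1 - radialDefect g) - 1)]

lemma integral_norm_stdGaussian_pos (hn : 2 ≤ n) : 0 < ∫ v, ‖v‖ ∂stdGaussian (Euc n) := by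
  rw [integral_norm_stdGaussian_eq (by omega)]
  have h := (integral_sqrt_radialDefect_bounds (n := n) (by omega)).1
  have hn' : (2 : ℝ) ≤ n := by exact_mod_cast hn
  have h2 : 1 / (n : ℝ) ≤ 1 / 2 := one_div_le_one_div_of_le (by norm_num) hn'
  have : 0 < √(n : ℝ) := Real.sqrt_pos.2 (by linarith)
  apply mul_pos this
  linarith

/-- For Gaussian `v`, independence of length and direction factors `E |⟨v, a⟩| = √(2/π) ‖a‖` into `E
‖v‖` times the spherical mean. -/
lemma integral_sphere_abs_inner (hn : 2 ≤ n) (a : Euc n) :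
    ∫ θ : Metric.sphere (0 : Euc n) 1, |inner ℝ (θ : Euc n) a| ∂sphereMeasure n =
      sphereAbsMean n * ‖a‖ := by
  have hp := isProbabilityMeasure_sphereMeasure (n := n) (by omega)
  have hpos := integral_norm_stdGaussian_pos hn
  have h := lintegral_stdGaussian_polar (n := n) (by omega)
    (F := fun v => ENNReal.ofReal |inner ℝ v a|) (by fun_prop)
  have hi : Integrable (fun v : Euc n => |inner ℝ v a|) (stdGaussian (Euc n)) := by
    refine (integrable_norm_stdGaussian.mul_const ‖a‖).mono' (by fun_prop) (.of_forall fun v => ?_)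
    rw [Real.norm_eq_abs, abs_abs]
    exact abs_real_inner_le_norm v a
  have hs : Integrable (fun θ : Metric.sphere (0 : Euc n) 1 => |inner ℝ (θ : Euc n) a|)
      (sphereMeasure n) := by
    refine Integrable.of_bound (by fun_prop) ‖a‖ (.of_forall fun θ => ?_)
    rw [Real.norm_eq_abs, abs_abs]
    simpa using abs_real_inner_le_norm (θ : Euc n) a
  have h1 : ∀ v : Euc n, ∫⁻ θ : Metric.sphere (0 : Euc n) 1,
      ENNReal.ofReal |inner ℝ (‖v‖ • (θ : Euc n)) a| ∂sphereMeasure n =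
      ENNReal.ofReal ‖v‖ * ENNReal.ofReal
        (∫ θ : Metric.sphere (0 : Euc n) 1, |inner ℝ (θ : Euc n) a| ∂sphereMeasure n) := by
    intro v
    rw [ofReal_integral_eq_lintegral_ofReal hs (.of_forall fun _ => abs_nonneg _),
      ← lintegral_const_mul _ (by fun_prop)]
    refine lintegral_congr fun θ => ?_
    rw [real_inner_smul_left, abs_mul, abs_norm, ENNReal.ofReal_mul (norm_nonneg _)]
  simp_rw [h1] at h
  rw [lintegral_mul_const _ (by fun_prop), ← ofReal_integral_eq_lintegral_ofReal hi
    (.of_forall fun _ => abs_nonneg _), ← ofReal_integral_eq_lintegral_ofReal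
    integrable_norm_stdGaussian (.of_forall fun _ => norm_nonneg _),
    ← ENNReal.ofReal_mul hpos.le, ENNReal.ofReal_eq_ofReal_iff
    (integral_nonneg fun _ => abs_nonneg _)
    (mul_nonneg hpos.le (integral_nonneg fun _ => abs_nonneg _))] at h
  have h2 := integral_comp_inner_stdGaussian a (f := fun t => |t|) (by fun_prop)
  simp_rw [abs_mul, abs_norm] at h2
  rw [integral_const_mul, integral_abs_gaussianReal] at h2
  simp_rw [real_inner_comm] at h2 h
  rw [h2] at h
  rw [sphereAbsMean]
  simp_rw [real_inner_comm] at h ⊢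
  field_simp
  linarith

end

/-! ### Expansion of the averaged squared `L²` distance. -/

section

variable {n : ℕ} {μ : Measure (Euc n)} [IsProbabilityMeasure μ]

section

variable {ν₁ ν₂ : Measure (Euc n)} [IsProbabilityMeasure ν₁] [IsProbabilityMeasure ν₂]

lemma integrable_norm_sub_prod (h₁ : Integrable (fun x => ‖x‖) ν₁)
    (h₂ : Integrable (fun x => ‖x‖) ν₂) :
    Integrable (fun p : Euc n × Euc n => ‖p.1 - p.2‖) (ν₁.prod ν₂) := by
  refine ((h₁.comp_fst ν₂).add (h₂.comp_snd ν₁)).mono' (by fun_prop) (.of_forall fun p => ?_)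
  rw [norm_norm]
  exact norm_sub_le _ _

lemma integrable_sphere_prod_abs_inner_sub (hn : 0 < n) (h₁ : Integrable (fun x => ‖x‖) ν₁)
    (h₂ : Integrable (fun x => ‖x‖) ν₂) :
    Integrable (fun q : Metric.sphere (0 : Euc n) 1 × (Euc n × Euc n) =>
      |inner ℝ (q.1 : Euc n) (q.2.1 - q.2.2)|) ((sphereMeasure n).prod (ν₁.prod ν₂)) := by
  have := isProbabilityMeasure_sphereMeasure hn
  refine ((integrable_norm_sub_prod h₁ h₂).comp_snd (sphereMeasure n)).mono'
    (by fun_prop) (.of_forall fun q => ?_)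
  rw [Real.norm_eq_abs, abs_abs]
  simpa using abs_real_inner_le_norm (q.1 : Euc n) (q.2.1 - q.2.2)

lemma integral_sphere_integral_abs_inner_sub (hn : 2 ≤ n) (h₁ : Integrable (fun x => ‖x‖) ν₁)
    (h₂ : Integrable (fun x => ‖x‖) ν₂) :
    ∫ θ : Metric.sphere (0 : Euc n) 1, ∫ p : Euc n × Euc n, |inner ℝ (θ : Euc n) (p.1 - p.2)|
      ∂(ν₁.prod ν₂) ∂sphereMeasure n =
      sphereAbsMean n * ∫ p : Euc n × Euc n, ‖p.1 - p.2‖ ∂(ν₁.prod ν₂) := by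
  have := isProbabilityMeasure_sphereMeasure (n := n) (by omega)
  rw [integral_integral_swap (integrable_sphere_prod_abs_inner_sub (by omega) h₁ h₂)]
  simp_rw [integral_sphere_abs_inner hn]
  rw [integral_const_mul]

end

namespace IsotropicSphereLaw

/-- The energy formula applied to two projections along the same `θ`, the normal law being that of
the Gaussian vector. The purely Gaussian term does not depend on `θ`. -/
lemma integral_cdf_projLaw_sub_sq (hμ : IsotropicSphereLaw μ) {θ : Euc n} (hθ : ‖θ‖ = 1) :
    Integrable (fun x => (cdf (projLaw μ θ) x - normalCDF x) ^ 2) ∧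
    ∫ x, (cdf (projLaw μ θ) x - normalCDF x) ^ 2 =
      ∫ p : Euc n × Euc n, |inner ℝ θ (p.1 - p.2)| ∂(μ.prod (stdGaussian (Euc n))) -
      (∫ p : Euc n × Euc n, |inner ℝ θ (p.1 - p.2)| ∂(μ.prod μ)) / 2 -
      √2 * √(2 / Real.pi) / 2 := by
  have h1 := integrable_norm_of_integrable hμ.integrable_norm θ
  have h2 := integrable_norm_of_integrable (integrable_norm_stdGaussian (n := n)) θ
  rw [← integral_abs_sub_gaussianReal_prod, ← integral_abs_sub_projLaw_prod,
    ← integral_abs_sub_projLaw_prod]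
  rw [projLaw_stdGaussian hθ] at h2 ⊢
  exact ⟨integrable_cdf_sub_cdf_sq h1 h2, integral_cdf_sub_cdf_sq h1 h2⟩

lemma integrable_sphere_integral_cdf_sub_sq (hμ : IsotropicSphereLaw μ) (hn : 0 < n) :
    Integrable (fun θ : Metric.sphere (0 : Euc n) 1 =>
      ∫ x, (cdf (projLaw μ θ) x - normalCDF x) ^ 2) (sphereMeasure n) := by
  have := isProbabilityMeasure_sphereMeasure hn
  have h : ∀ θ : Metric.sphere (0 : Euc n) 1, ‖(θ : Euc n)‖ = 1 := by simp
  simp_rw [(hμ.integral_cdf_projLaw_sub_sq (h _)).2]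
  have i1 := (integrable_sphere_prod_abs_inner_sub hn hμ.integrable_norm
    integrable_norm_stdGaussian).integral_prod_left
  have i2 := (integrable_sphere_prod_abs_inner_sub hn hμ.integrable_norm
    hμ.integrable_norm).integral_prod_left
  exact (i1.sub (i2.div_const 2)).sub (integrable_const _)

/-- The average squared `L²`-distance in terms of the overlaps. -/
lemma integral_sphere_integral_cdf_sub_sq (hμ : IsotropicSphereLaw μ) (hn : 2 ≤ n) :
    ∫ θ : Metric.sphere (0 : Euc n) 1, (∫ x, (cdf (projLaw μ θ) x - normalCDF x) ^ 2)
      ∂sphereMeasure n =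
    -(1 / √Real.pi / ∫ g, √(1 - radialDefect g) ∂stdGaussian (Euc n)) *
      ((∫ p : Euc n × Euc n, √(1 - overlap p.1 p.2) ∂(μ.prod μ)) -
      2 * (∫ p : Euc n × Euc n, √(1 - gaussianOverlap p.1 p.2) ∂(μ.prod (stdGaussian (Euc n)))) +
      ∫ g, √(1 - radialDefect g) ∂stdGaussian (Euc n)) := by
  have hn0 : 0 < n := by omega
  have := isProbabilityMeasure_sphereMeasure hn0
  have h : ∀ θ : Metric.sphere (0 : Euc n) 1, ‖(θ : Euc n)‖ = 1 := by simp
  simp_rw [(hμ.integral_cdf_projLaw_sub_sq (h _)).2]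
  have i1 := (integrable_sphere_prod_abs_inner_sub hn0 hμ.integrable_norm
    integrable_norm_stdGaussian).integral_prod_left
  have i2 := (integrable_sphere_prod_abs_inner_sub hn0 hμ.integrable_norm
    hμ.integrable_norm).integral_prod_left
  have i3 : Integrable (fun θ : Metric.sphere (0 : Euc n) 1 =>
      ∫ p : Euc n × Euc n, |inner ℝ (θ : Euc n) (p.1 - p.2)| ∂(μ.prod (stdGaussian (Euc n))) -
      (∫ p : Euc n × Euc n, |inner ℝ (θ : Euc n) (p.1 - p.2)| ∂(μ.prod μ)) / 2)
      (sphereMeasure n) := i1.sub (i2.div_const 2)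
  rw [integral_sub i3 (integrable_const _), integral_sub i1 (i2.div_const 2), integral_div,
    integral_sphere_integral_abs_inner_sub hn hμ.integrable_norm integrable_norm_stdGaussian,
    integral_sphere_integral_abs_inner_sub hn hμ.integrable_norm hμ.integrable_norm]
  have e1 : ∫ p : Euc n × Euc n, ‖p.1 - p.2‖ ∂(μ.prod (stdGaussian (Euc n))) =
      √(2 * n) * ∫ p : Euc n × Euc n, √(1 - gaussianOverlap p.1 p.2)
        ∂(μ.prod (stdGaussian (Euc n))) := by
    rw [← integral_const_mul]
    refine integral_congr_ae ?_
    filter_upwards [hμ.ae_prod_gaussian] with p hp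
    rw [← Real.sqrt_mul (by positivity), ← norm_sub_sq_eq_gaussianOverlap hn0 hp,
      Real.sqrt_sq (norm_nonneg _)]
  have e2 : ∫ p : Euc n × Euc n, ‖p.1 - p.2‖ ∂(μ.prod μ) =
      √(2 * n) * ∫ p : Euc n × Euc n, √(1 - overlap p.1 p.2) ∂(μ.prod μ) := by
    rw [← integral_const_mul]
    refine integral_congr_ae ?_
    filter_upwards [hμ.ae_prod] with p hp
    rw [← Real.sqrt_mul (by positivity), ← norm_sub_sq_eq_overlap hn0 hp.1 hp.2,
      Real.sqrt_sq (norm_nonneg _)]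
  have hpos := integral_norm_stdGaussian_pos hn
  rw [e1, e2, sphereAbsMean]
  rw [integral_norm_stdGaussian_eq hn0] at hpos ⊢
  have hn' : (0 : ℝ) < √n := Real.sqrt_pos.2 (by exact_mod_cast hn0)
  have hz := pos_of_mul_pos_right hpos hn'.le
  have hpi : 0 < √Real.pi := Real.sqrt_pos.2 Real.pi_pos
  have h2 : √(2 : ℝ) * √2 = 2 := Real.mul_self_sqrt (by norm_num)
  rw [Real.sqrt_mul (by norm_num) (n : ℝ), Real.sqrt_div (by norm_num)]
  simp only [integral_const, probReal_univ, smul_eq_mul, one_mul]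
  generalize ∫ g, √(1 - radialDefect g) ∂stdGaussian (Euc n) = Z at hz ⊢
  generalize ∫ p : Euc n × Euc n, √(1 - gaussianOverlap p.1 p.2)
    ∂(μ.prod (stdGaussian (Euc n))) = B
  generalize ∫ p : Euc n × Euc n, √(1 - overlap p.1 p.2) ∂(μ.prod μ) = A
  field_simp
  rw [Real.sq_sqrt (by norm_num)]
  ring

/-- The asymptotic expansion of the average squared `L²`-distance. -/
theorem abs_integral_sphere_l2_sub_le (hμ : IsotropicSphereLaw μ) (hn : 2 ≤ n) :
    |(∫ θ : Metric.sphere (0 : Euc n) 1, (∫ x, (cdf (projLaw μ θ) x - normalCDF x) ^ 2)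
      ∂sphereMeasure n) - 1 / (16 * √Real.pi) *
        ∫ p : Euc n × Euc n, overlap p.1 p.2 ^ 3 ∂(μ.prod μ)| ≤
      400 * ∫ p : Euc n × Euc n, overlap p.1 p.2 ^ 4 ∂(μ.prod μ) := by
  have hn0 : 0 < n := by omega
  have hn2 : (2 : ℝ) ≤ n := by exact_mod_cast hn
  obtain ⟨-, -, -, hexp⟩ := hμ.integrable_and_abs_second_difference_le hn0
    (w := fun x => √(1 - x)) zero_le_one (by fun_prop)
    (fun _ hx => abs_sqrt_one_sub_sub_taylor_le hx)
  have hM3 := hμ.abs_integral_overlap_pow_three_div_le hn0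
  have hM4 := (hμ.one_div_sq_le_integral_overlap_pow_four hn0)
  have hM40 : 0 ≤ ∫ p : Euc n × Euc n, overlap p.1 p.2 ^ 4 ∂(μ.prod μ) :=
    le_trans (by positivity) hM4
  obtain ⟨hz1, hz2⟩ := integral_sqrt_radialDefect_bounds (n := n) hn0
  have hn3 : 1 / (n : ℝ) ≤ 1 / 2 := one_div_le_one_div_of_le (by norm_num) hn2
  have hpi : 1 ≤ √Real.pi := Real.one_le_sqrt.2 (by linarith [Real.pi_gt_three])
  rw [hμ.integral_sphere_integral_cdf_sub_sq hn]
  generalize (∫ p : Euc n × Euc n, √(1 - overlap p.1 p.2) ∂(μ.prod μ)) -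
      2 * (∫ p : Euc n × Euc n, √(1 - gaussianOverlap p.1 p.2) ∂(μ.prod (stdGaussian (Euc n)))) +
      ∫ g, √(1 - radialDefect g) ∂stdGaussian (Euc n) = D at hexp ⊢
  generalize ∫ g, √(1 - radialDefect g) ∂stdGaussian (Euc n) = Z at hz1 hz2 ⊢
  generalize ∫ p : Euc n × Euc n, overlap p.1 p.2 ^ 4 ∂(μ.prod μ) = M4 at *
  generalize ∫ p : Euc n × Euc n, overlap p.1 p.2 ^ 3 ∂(μ.prod μ) = M3 at *
  have hZ : 1 / 2 ≤ Z := by linarith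
  have hZ0 : 0 < Z := by linarith
  -- The first term is the error of the second difference, the second the cost of replacing `Z = 1 +
  -- O(1/n)` by `1`. With `1 / Z ≤ 2` the total is `2 * 169 + 1 ≤ 400`.
  have e : -(1 / √Real.pi / Z) * D - 1 / (16 * √Real.pi) * M3 =
      -(1 / √Real.pi / Z) * (D - -(1 / 16) * M3) + 1 / √Real.pi * ((1 - Z) / Z * M3 / 16) := by
    field_simp
    ring
  have hs : 1 / √Real.pi ≤ 1 := by rw [div_le_one (by linarith)]; exact hpi
  have hs0 : 0 ≤ 1 / √Real.pi := by positivity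
  have hs2 : 1 / √Real.pi / Z ≤ 2 := by
    rw [div_le_iff₀ hZ0]; linarith
  have b1 : |-(1 / √Real.pi / Z) * (D - -(1 / 16) * M3)| ≤ 2 * (169 * 1 * M4) := by
    rw [abs_mul, abs_neg, abs_of_nonneg (by positivity)]
    exact mul_le_mul hs2 hexp (abs_nonneg _) (by norm_num)
  have b2 : |1 / √Real.pi * ((1 - Z) / Z * M3 / 16)| ≤ M4 := by
    rw [abs_mul, abs_of_nonneg hs0, abs_div, abs_mul, abs_of_nonneg
      (div_nonneg (by linarith) hZ0.le), abs_of_pos (by norm_num : (0 : ℝ) < 16)]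
    have h1 : (1 - Z) / Z ≤ 2 * (1 / n) := by
      rw [div_le_iff₀ hZ0]
      nlinarith [show 0 < 1 / (n : ℝ) by positivity]
    have h2 : (1 - Z) / Z * |M3| ≤ 2 * M4 := by
      calc _ ≤ 2 * (1 / n) * |M3| := by gcongr
        _ = 2 * (|M3| / n) := by ring
        _ ≤ _ := by gcongr
    have h3 : 0 ≤ (1 - Z) / Z * |M3| / 16 := by
      have := div_nonneg (sub_nonneg.2 hz2) hZ0.le
      positivity
    calc _ ≤ 1 * ((1 - Z) / Z * |M3| / 16) := mul_le_mul_of_nonneg_right hs h3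
      _ ≤ M4 := by linarith
  rw [e]
  refine (abs_add_le _ _).trans ?_
  linarith

end IsotropicSphereLaw

end

/-! ### Gaussian averages of the squared distance of characteristic functions. -/

section

variable {n : ℕ} {μ : Measure (Euc n)} [IsProbabilityMeasure μ]

lemma re_charFun_stdGaussian (a : Euc n) :
    ∫ v, Real.cos (inner ℝ v a) ∂stdGaussian (Euc n) = Real.exp (-‖a‖ ^ 2 / 2) := by
  have h := charFun_stdGaussian a
  rw [charFun_apply] at h
  have h2 := congrArg Complex.re h
  have hi : Integrable (fun v : Euc n => Complex.exp ((inner ℝ v a : ℝ) * Complex.I))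
      (stdGaussian (Euc n)) :=
    Integrable.of_bound (by fun_prop) 1 (.of_forall fun v => by
      rw [Complex.norm_exp_ofReal_mul_I])
  rw [← RCLike.re_eq_complex_re, ← integral_re hi] at h2
  simp only [RCLike.re_eq_complex_re, Complex.exp_ofReal_mul_I_re] at h2
  rw [h2]
  norm_cast

/-- The product is the characteristic function of the difference of independent vectors. -/
lemma re_charFun_mul_conj {ν₁ ν₂ : Measure (Euc n)} [IsProbabilityMeasure ν₁]
    [IsProbabilityMeasure ν₂] (v : Euc n) :
    (charFun ν₁ v * (starRingEnd ℂ) (charFun ν₂ v)).re =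
      ∫ p : Euc n × Euc n, Real.cos (inner ℝ v (p.1 - p.2)) ∂(ν₁.prod ν₂) := by
  rw [charFun_apply, charFun_apply, ← integral_conj, ← integral_prod_mul
    (fun x : Euc n => Complex.exp ((inner ℝ x v : ℝ) * Complex.I))
    (fun x : Euc n => (starRingEnd ℂ) (Complex.exp ((inner ℝ x v : ℝ) * Complex.I)))]
  have h : ∀ p : Euc n × Euc n, Complex.exp ((inner ℝ p.1 v : ℝ) * Complex.I) *
      (starRingEnd ℂ) (Complex.exp ((inner ℝ p.2 v : ℝ) * Complex.I)) =
      Complex.exp ((inner ℝ v (p.1 - p.2) : ℝ) * Complex.I) := by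
    intro p
    rw [← Complex.exp_conj, ← Complex.exp_add, inner_sub_right, real_inner_comm v p.1,
      real_inner_comm v p.2]
    congr 1
    simp only [map_mul, Complex.conj_ofReal, Complex.conj_I, Complex.ofReal_sub]
    ring
  simp_rw [h]
  have hi : Integrable (fun p : Euc n × Euc n =>
      Complex.exp ((inner ℝ v (p.1 - p.2) : ℝ) * Complex.I)) (ν₁.prod ν₂) :=
    Integrable.of_bound (by fun_prop) 1 (.of_forall fun v => by
      rw [Complex.norm_exp_ofReal_mul_I])
  rw [← RCLike.re_eq_complex_re, ← integral_re hi]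
  simp only [RCLike.re_eq_complex_re, Complex.exp_ofReal_mul_I_re]

/-- Averaging the cosine over a Gaussian frequency gives a Gaussian kernel, which sees only the
length of `p.1 - p.2`. -/
lemma integral_re_charFun_mul_conj {ν₁ ν₂ : Measure (Euc n)} [IsProbabilityMeasure ν₁]
    [IsProbabilityMeasure ν₂] (σ : ℝ) :
    Integrable (fun v => (charFun ν₁ (σ • v) * (starRingEnd ℂ) (charFun ν₂ (σ • v))).re)
      (stdGaussian (Euc n)) ∧
    ∫ v, (charFun ν₁ (σ • v) * (starRingEnd ℂ) (charFun ν₂ (σ • v))).re ∂stdGaussian (Euc n) =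
      ∫ p : Euc n × Euc n, Real.exp (-(σ ^ 2 * ‖p.1 - p.2‖ ^ 2 / 2)) ∂(ν₁.prod ν₂) := by
  simp_rw [re_charFun_mul_conj]
  have hi : Integrable (fun q : Euc n × (Euc n × Euc n) =>
      Real.cos (inner ℝ (σ • q.1) (q.2.1 - q.2.2))) ((stdGaussian (Euc n)).prod (ν₁.prod ν₂)) :=
    Integrable.of_bound (by fun_prop) 1 (.of_forall fun v => by
      simpa using Real.abs_cos_le_one _)
  refine ⟨hi.integral_prod_left, ?_⟩
  rw [integral_integral_swap hi]
  refine integral_congr_ae (.of_forall fun p => ?_)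
  simp only
  simp_rw [real_inner_smul_left, ← real_inner_smul_right]
  rw [re_charFun_stdGaussian, norm_smul, mul_pow, Real.norm_eq_abs, sq_abs]
  congr 1
  ring

lemma norm_charFun_stdGaussian_sq (v : Euc n) :
    ‖charFun (stdGaussian (Euc n)) v‖ ^ 2 = Real.exp (-‖v‖ ^ 2) := by
  rw [charFun_stdGaussian, show (-(‖v‖ : ℂ) ^ 2 / 2) = ((-‖v‖ ^ 2 / 2 : ℝ) : ℂ) by push_cast; ring,
    Complex.norm_exp_ofReal, ← Real.exp_nat_mul]
  congr 1
  push_cast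
  ring

/-- The squared distance of the characteristic functions of `μ` and of the standard Gaussian. -/
noncomputable def charFunDistSq (μ : Measure (Euc n)) (v : Euc n) : ℝ :=
  ‖charFun μ v - charFun (stdGaussian (Euc n)) v‖ ^ 2

lemma charFunDistSq_nonneg (μ : Measure (Euc n)) (v : Euc n) : 0 ≤ charFunDistSq μ v := by
  unfold charFunDistSq; positivity

lemma measurable_charFunDistSq : Measurable (charFunDistSq μ) := by
  unfold charFunDistSq
  exact ((measurable_charFun.sub measurable_charFun).norm).pow_const 2

lemma charFunDistSq_eq {μ : Measure (Euc n)} (v : Euc n) : charFunDistSq μ v =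
    (charFun μ v * (starRingEnd ℂ) (charFun μ v)).re -
      2 * (charFun μ v * (starRingEnd ℂ) (charFun (stdGaussian (Euc n)) v)).re +
      Real.exp (-‖v‖ ^ 2) := by
  rw [charFunDistSq, ← norm_charFun_stdGaussian_sq, ← Complex.normSq_eq_norm_sq,
    ← Complex.normSq_eq_norm_sq, Complex.normSq_sub, Complex.mul_conj (charFun μ v)]
  simp only [Complex.ofReal_re]
  ring

namespace IsotropicSphereLaw

/-- Expanding the square gives the second difference for `w(x) = exp(-s(1 - x))`, `s = σ²n`. -/
lemma integral_charFunDistSq_smul (hμ : IsotropicSphereLaw μ) (hn : 0 < n) (σ : ℝ) :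
    Integrable (fun v => charFunDistSq μ (σ • v)) (stdGaussian (Euc n)) ∧
    ∫ v, charFunDistSq μ (σ • v) ∂stdGaussian (Euc n) =
      (∫ p : Euc n × Euc n, Real.exp (-(σ ^ 2 * n) * (1 - overlap p.1 p.2)) ∂(μ.prod μ)) -
      2 * (∫ p : Euc n × Euc n, Real.exp (-(σ ^ 2 * n) * (1 - gaussianOverlap p.1 p.2))
        ∂(μ.prod (stdGaussian (Euc n)))) +
      ∫ g, Real.exp (-(σ ^ 2 * n) * (1 - radialDefect g)) ∂stdGaussian (Euc n) := by
  obtain ⟨i1, e1⟩ := integral_re_charFun_mul_conj (ν₁ := μ) (ν₂ := μ) σ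
  obtain ⟨i2, e2⟩ := integral_re_charFun_mul_conj (ν₁ := μ) (ν₂ := stdGaussian (Euc n)) σ
  have e3 : ∀ g : Euc n, Real.exp (-‖σ • g‖ ^ 2) =
      Real.exp (-(σ ^ 2 * n) * (1 - radialDefect g)) := by
    intro g
    rw [norm_smul, mul_pow, Real.norm_eq_abs, sq_abs, norm_sq_eq_radialDefect hn]
    congr 1
    ring
  have i3 : Integrable (fun g : Euc n => Real.exp (-(σ ^ 2 * n) * (1 - radialDefect g)))
      (stdGaussian (Euc n)) := by
    simp_rw [← e3]
    refine Integrable.of_bound (by fun_prop) 1 (.of_forall fun g => ?_)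
    rw [Real.norm_eq_abs, Real.abs_exp, Real.exp_le_one_iff]
    linarith [sq_nonneg ‖σ • g‖]
  simp_rw [charFunDistSq_eq, e3]
  refine ⟨(i1.sub (i2.const_mul 2)).add i3, ?_⟩
  have i4 : Integrable (fun v => (charFun μ (σ • v) * (starRingEnd ℂ) (charFun μ (σ • v))).re -
      2 * (charFun μ (σ • v) * (starRingEnd ℂ) (charFun (stdGaussian (Euc n)) (σ • v))).re)
      (stdGaussian (Euc n)) := i1.sub (i2.const_mul 2)
  rw [integral_add i4 i3, integral_sub i1 (i2.const_mul 2),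
    integral_const_mul, e1, e2]
  congr 2
  · refine integral_congr_ae ?_
    filter_upwards [hμ.ae_prod] with p hp
    rw [norm_sub_sq_eq_overlap hn hp.1 hp.2]
    congr 1
    ring
  · congr 1
    refine integral_congr_ae ?_
    filter_upwards [hμ.ae_prod_gaussian] with p hp
    rw [norm_sub_sq_eq_gaussianOverlap hn hp]
    congr 1
    ring

lemma integral_charFunDistSq_smul_le (hμ : IsotropicSphereLaw μ) (hn : 0 < n) (σ : ℝ) :
    ∫ v, charFunDistSq μ (σ • v) ∂stdGaussian (Euc n) ≤
      Real.exp (-(σ ^ 2 * n)) * (σ ^ 2 * n) ^ 3 / 6 *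
        ∫ p : Euc n × Euc n, overlap p.1 p.2 ^ 3 ∂(μ.prod μ) +
      169 * (384 * min 1 (σ ^ 2 * n)) *
        ∫ p : Euc n × Euc n, overlap p.1 p.2 ^ 4 ∂(μ.prod μ) := by
  have hs : 0 ≤ σ ^ 2 * n := by positivity
  obtain ⟨-, -, -, h⟩ := hμ.integrable_and_abs_second_difference_le hn
    (w := fun x => Real.exp (-(σ ^ 2 * n) * (1 - x))) (K := 384 * min 1 (σ ^ 2 * n))
    (by positivity) (by fun_prop)
    (fun x hx => abs_exp_neg_mul_one_sub_sub_taylor_le hs hx)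
  rw [(hμ.integral_charFunDistSq_smul hn σ).2]
  linarith [(abs_le.1 h).2]

end IsotropicSphereLaw

end

/-! ### Comparison of spherical averages with Gaussian averages over scales. -/

section

/-- Under `t = r σ` the measure `dt/t` is invariant, and `(0, T]` becomes `(0, T/r]`, contained in
`(0, 4T]`. -/
lemma setLIntegral_mul_inv_le {G : ℝ → ENNReal} (hG : Measurable G) {r T : ℝ} (hr : 1 / 4 ≤ r) :
    ∫⁻ t in Set.Ioc 0 T, G t * ENNReal.ofReal t⁻¹ ≤
      ∫⁻ σ in Set.Ioc 0 (4 * T), G (r * σ) * ENNReal.ofReal σ⁻¹ := by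
  have hr0 : 0 < r := by linarith
  set H : ℝ → ENNReal := (Set.Ioc 0 T).indicator fun t => G t * ENNReal.ofReal t⁻¹ with hH
  have hHm : Measurable H := (hG.mul (by fun_prop)).indicator measurableSet_Ioc
  have hHr : Measurable fun σ => H (r * σ) := hHm.comp (by fun_prop)
  rw [← lintegral_indicator measurableSet_Ioc, ← lintegral_indicator measurableSet_Ioc, ← hH,
    ← Real.smul_map_volume_mul_left hr0.ne', lintegral_smul_measure,
    lintegral_map hHm (by fun_prop), smul_eq_mul, ← lintegral_const_mul _ hHr]
  refine (lintegral_mono fun σ => ?_).trans_eq (by rw [Real.smul_map_volume_mul_left hr0.ne'])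
  by_cases h : r * σ ∈ Set.Ioc 0 T
  · have hσ : 0 < σ := pos_of_mul_pos_right h.1 hr0.le
    have hσ2 : σ ∈ Set.Ioc 0 (4 * T) := ⟨hσ, by nlinarith [h.2]⟩
    rw [hH, Set.indicator_of_mem h, Set.indicator_of_mem hσ2, mul_left_comm, abs_of_pos hr0,
      ← ENNReal.ofReal_mul hr0.le]
    gcongr
    rw [mul_inv, mul_inv_cancel_left₀ hr0.ne']
  · rw [hH, Set.indicator_of_notMem h, mul_zero]
    exact zero_le

variable {n : ℕ}

lemma quarter_le_stdGaussian_norm (hn : 2 ≤ n) :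
    1 / 4 ≤ stdGaussian (Euc n) {v | 1 / 4 ≤ ‖v‖} := by
  have hn0 : 0 < n := by omega
  have hn2 : (2 : ℝ) ≤ n := by exact_mod_cast hn
  obtain ⟨z1, z2, -, -⟩ := integral_radialDefect_pow hn0
  have i1 : Integrable (fun g : Euc n => radialDefect g) (stdGaussian (Euc n)) := by
    simpa using integrable_radialDefect_pow (n := n) hn0 1
  have i2 := integrable_radialDefect_pow (n := n) hn0 2
  have hm : MeasurableSet {v : Euc n | 1 / 4 ≤ ‖v‖} :=
    measurableSet_le measurable_const measurable_norm
  have j1 : Integrable (fun g : Euc n => 11 / 16 - radialDefect g / 2) (stdGaussian (Euc n)) :=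
    (integrable_const _).sub (i1.div_const _)
  -- The integrand is `15/16 - (ζ + 1)²/4`, a quadratic minorant of the indicator: it is below `1`,
  -- and negative once `ζ ≥ 15/16`, as happens for `‖g‖ < 1/4`.
  have e : ∫ g : Euc n, (11 / 16 - radialDefect g / 2 - radialDefect g ^ 2 / 4)
      ∂stdGaussian (Euc n) = 11 / 16 - 1 / (2 * (n : ℝ)) := by
    rw [integral_sub j1 (i2.div_const _), integral_sub (integrable_const _) (i1.div_const _),
      integral_div (4 : ℝ), integral_div (2 : ℝ), z1, z2]
    simp only [integral_const, probReal_univ, smul_eq_mul]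
    field_simp
    ring
  have h : ∫ g : Euc n, (11 / 16 - radialDefect g / 2 - radialDefect g ^ 2 / 4)
      ∂stdGaussian (Euc n) ≤ (stdGaussian (Euc n)).real {v | 1 / 4 ≤ ‖v‖} := by
    rw [← integral_indicator_one hm]
    refine integral_mono (j1.sub (i2.div_const _))
      ((integrable_indicator_iff hm).2 (integrable_const _).integrableOn) fun g => ?_
    simp only
    have h1 := radialDefect_le_one g
    by_cases hg : 1 / 4 ≤ ‖g‖
    · rw [Set.indicator_of_mem (show g ∈ {v : Euc n | 1 / 4 ≤ ‖v‖} from hg), Pi.one_apply]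
      nlinarith [sq_nonneg (radialDefect g + 1)]
    · rw [Set.indicator_of_notMem (show g ∉ {v : Euc n | 1 / 4 ≤ ‖v‖} from hg)]
      push Not at hg
      have h2 := norm_sq_eq_radialDefect hn0 g
      have h3 : ‖g‖ ^ 2 ≤ 1 / 16 := by nlinarith [norm_nonneg g]
      have h4 : 1 - radialDefect g ≤ 1 / 16 := by nlinarith
      nlinarith
  rw [e] at h
  have h5 : 1 / (2 * (n : ℝ)) ≤ 1 / 4 := one_div_le_one_div_of_le (by norm_num) (by linarith)
  have h6 : (1 / 4 : ℝ) ≤ (stdGaussian (Euc n)).real {v | 1 / 4 ≤ ‖v‖} := by linarith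
  rw [measureReal_def, ← ENNReal.ofReal_le_iff_le_toReal (measure_ne_top _ _)] at h6
  refine le_trans (le_of_eq ?_) h6
  rw [ENNReal.ofReal_div_of_pos (by norm_num)]
  simp

/-- Averages over the sphere and over radii, with the scale invariant weight `dt / t`, are bounded
by averages over centered Gaussian measures of all scales. -/
lemma lintegral_sphere_radial_le (hn : 2 ≤ n) {F : Euc n → ENNReal} (hF : Measurable F) (T : ℝ) :
    ∫⁻ θ : Metric.sphere (0 : Euc n) 1, (∫⁻ t in Set.Ioc 0 T,
      F (t • (θ : Euc n)) * ENNReal.ofReal t⁻¹) ∂sphereMeasure n ≤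
    4 * ∫⁻ σ in Set.Ioc 0 (4 * T), (∫⁻ v, F (σ • v) ∂stdGaussian (Euc n)) *
      ENNReal.ofReal σ⁻¹ := by
  have hn0 : 0 < n := by omega
  have := isProbabilityMeasure_sphereMeasure hn0
  set Q := ∫⁻ θ : Metric.sphere (0 : Euc n) 1, (∫⁻ t in Set.Ioc 0 T,
      F (t • (θ : Euc n)) * ENNReal.ofReal t⁻¹) ∂sphereMeasure n with hQ
  have hpolar : ∀ σ : ℝ, ∫⁻ v, F (σ • v) ∂stdGaussian (Euc n) =
      ∫⁻ v, ∫⁻ θ, F ((‖v‖ * σ) • (θ : Euc n)) ∂sphereMeasure n ∂stdGaussian (Euc n) := by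
    intro σ
    rw [lintegral_stdGaussian_polar hn0 (F := fun v => F (σ • v)) (hF.comp (by fun_prop))]
    simp_rw [smul_smul, mul_comm]
  have hm4 : Measurable fun p : ℝ × (Euc n × Metric.sphere (0 : Euc n) 1) =>
      F ((‖p.2.1‖ * p.1) • (p.2.2 : Euc n)) * ENNReal.ofReal p.1⁻¹ :=
    (hF.comp (by fun_prop)).mul (by fun_prop)
  have hR : ∫⁻ σ in Set.Ioc 0 (4 * T), (∫⁻ v, F (σ • v) ∂stdGaussian (Euc n)) *
      ENNReal.ofReal σ⁻¹ = ∫⁻ v, ∫⁻ θ : Metric.sphere (0 : Euc n) 1,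
        (∫⁻ σ in Set.Ioc 0 (4 * T), F ((‖v‖ * σ) • (θ : Euc n)) * ENNReal.ofReal σ⁻¹)
        ∂sphereMeasure n ∂stdGaussian (Euc n) := by
    have h1 : ∀ σ : ℝ, (∫⁻ v, F (σ • v) ∂stdGaussian (Euc n)) * ENNReal.ofReal σ⁻¹ =
        ∫⁻ p : Euc n × Metric.sphere (0 : Euc n) 1, F ((‖p.1‖ * σ) • (p.2 : Euc n)) *
          ENNReal.ofReal σ⁻¹ ∂((stdGaussian (Euc n)).prod (sphereMeasure n)) := by
      intro σ
      have hm2 : Measurable fun p : Euc n × Metric.sphere (0 : Euc n) 1 =>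
        F ((‖p.1‖ * σ) • (p.2 : Euc n)) := hF.comp (by fun_prop)
      rw [hpolar, lintegral_mul_const _ hm2, lintegral_prod _ hm2.aemeasurable]
    simp_rw [h1]
    rw [lintegral_lintegral_swap hm4.aemeasurable, lintegral_prod]
    exact (Measurable.lintegral_prod_left' hm4).aemeasurable
  rw [hR]
  -- Every `v` of norm at least `1/4` contributes at least `Q`, and such `v` have mass at least
  -- `1/4`; hence the factor `4`.
  have h2 : ∀ v ∈ {v : Euc n | 1 / 4 ≤ ‖v‖}, Q ≤ ∫⁻ θ : Metric.sphere (0 : Euc n) 1,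
        (∫⁻ σ in Set.Ioc 0 (4 * T), F ((‖v‖ * σ) • (θ : Euc n)) * ENNReal.ofReal σ⁻¹)
        ∂sphereMeasure n := by
    intro v hv
    refine lintegral_mono fun θ => ?_
    exact setLIntegral_mul_inv_le (G := fun t => F (t • (θ : Euc n))) (hF.comp (by fun_prop)) hv
  have hm : MeasurableSet {v : Euc n | 1 / 4 ≤ ‖v‖} :=
    measurableSet_le measurable_const measurable_norm
  calc Q = 4 * (Q * (1 / 4)) := by
        rw [mul_left_comm, one_div, ENNReal.mul_inv_cancel (by simp) (by simp), mul_one]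
    _ ≤ 4 * (Q * stdGaussian (Euc n) {v | 1 / 4 ≤ ‖v‖}) := by
        gcongr
        exact quarter_le_stdGaussian_norm hn
    _ = 4 * ∫⁻ v in {v : Euc n | 1 / 4 ≤ ‖v‖}, Q ∂stdGaussian (Euc n) := by
        rw [lintegral_const, Measure.restrict_apply_univ]
    _ ≤ 4 * ∫⁻ v in {v : Euc n | 1 / 4 ≤ ‖v‖}, ∫⁻ θ : Metric.sphere (0 : Euc n) 1,
        (∫⁻ σ in Set.Ioc 0 (4 * T), F ((‖v‖ * σ) • (θ : Euc n)) * ENNReal.ofReal σ⁻¹)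
        ∂sphereMeasure n ∂stdGaussian (Euc n) := by
        exact mul_le_mul' le_rfl (setLIntegral_mono' hm h2)
    _ ≤ _ := mul_le_mul' le_rfl (setLIntegral_le_lintegral _ _)

end

/-! ### Integration over scales. -/

section

/-- This bound for small `s` and the next for large `s` make the cubic coefficient integrable in
`dσ/σ` at both ends, so that the third moment picks up no logarithm here. -/
lemma exp_neg_mul_pow_three_le_self {s : ℝ} (hs : 0 ≤ s) : Real.exp (-s) * s ^ 3 / 6 ≤ s := by
  have h := Real.quadratic_le_exp_of_nonneg hs
  have h1 : s ^ 2 ≤ 6 * Real.exp s := by nlinarith [sq_nonneg s]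
  rw [Real.exp_neg, inv_mul_eq_div, div_div, div_le_iff₀ (by positivity)]
  nlinarith

lemma exp_neg_mul_pow_three_le_div {s : ℝ} (hs : 0 < s) :
    Real.exp (-s) * s ^ 3 / 6 ≤ 4 / s := by
  have h := pow_four_mul_exp_neg_le hs.le
  rw [le_div_iff₀ hs]
  linarith [show Real.exp (-s) * s ^ 3 / 6 * s = s ^ 4 * Real.exp (-s) / 6 by ring]

lemma setLIntegral_Ioc_ofReal_le {f : ℝ → ℝ} {a b c : ℝ} (hab : a ≤ b)
    (hf : ContinuousOn f (Set.Icc a b)) (h0 : ∀ x ∈ Set.Ioc a b, 0 ≤ f x)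
    (hc : ∫ x in a..b, f x ≤ c) :
    ∫⁻ x in Set.Ioc a b, ENNReal.ofReal (f x) ≤ ENNReal.ofReal c := by
  have hi : IntegrableOn f (Set.Ioc a b) := (hf.integrableOn_Icc).mono_set Set.Ioc_subset_Icc_self
  rw [← ofReal_integral_eq_lintegral_ofReal hi
    ((ae_restrict_iff' measurableSet_Ioc).2 (.of_forall h0)), ← intervalIntegral.integral_of_le hab]
  exact ENNReal.ofReal_le_ofReal hc

/-- Integration over scales of the bound for the Gaussian averages. -/
lemma lintegral_scale_le {J : ℝ → ℝ} {M₃ M₄ K N A : ℝ} (hN : 0 < N) (hM₃ : 0 ≤ M₃) (hM₄ : 0 ≤ M₄)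
    (hK : 0 ≤ K) (hA : 1 ≤ A * √N)
    (hJ : ∀ σ, J σ ≤ Real.exp (-(σ ^ 2 * N)) * (σ ^ 2 * N) ^ 3 / 6 * M₃ +
      K * min 1 (σ ^ 2 * N) * M₄) :
    ∫⁻ σ in Set.Ioc 0 A, ENNReal.ofReal (J σ) * ENNReal.ofReal σ⁻¹ ≤
      ENNReal.ofReal (5 / 2 * M₃ + K * (1 / 2 + Real.log (A * √N)) * M₄) := by
  have hsN : 0 < √N := Real.sqrt_pos.2 hN
  -- The scale at which `σ²N = 1`. Below it all terms are `O(σ)` and contribute `(M₃ + K M₄)/2`;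
  -- above it they contribute `2 M₃` and the logarithm.
  set a : ℝ := (√N)⁻¹ with ha
  have ha0 : 0 < a := by positivity
  have ha2 : a ^ 2 = N⁻¹ := by rw [ha, inv_pow, Real.sq_sqrt hN.le]
  have haA : a ≤ A := by rw [ha, inv_le_iff_one_le_mul₀ hsN]; linarith
  have hA0 : 0 < A := ha0.trans_le haA
  have hlog : 0 ≤ Real.log (A * √N) := Real.log_nonneg hA
  have b1 : ∫⁻ σ in Set.Ioc 0 a, ENNReal.ofReal (J σ) * ENNReal.ofReal σ⁻¹ ≤
      ENNReal.ofReal ((M₃ + K * M₄) / 2) := by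
    calc _ ≤ ∫⁻ σ in Set.Ioc 0 a, ENNReal.ofReal (N * (M₃ + K * M₄) * σ) := by
          refine setLIntegral_mono' measurableSet_Ioc fun σ hσ => ?_
          have hσ0 : 0 < σ := hσ.1
          rw [← ENNReal.ofReal_mul' (by positivity)]
          refine ENNReal.ofReal_le_ofReal ?_
          have h1 := exp_neg_mul_pow_three_le_self (s := σ ^ 2 * N) (by positivity)
          have h2 : min 1 (σ ^ 2 * N) ≤ σ ^ 2 * N := min_le_right _ _
          rw [← div_eq_mul_inv, div_le_iff₀ hσ0]
          calc _ ≤ _ := hJ σ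
            _ ≤ (σ ^ 2 * N) * M₃ + K * (σ ^ 2 * N) * M₄ := by gcongr
            _ = _ := by ring
      _ ≤ _ := by
          refine setLIntegral_Ioc_ofReal_le ha0.le (by fun_prop) (fun x hx => ?_) ?_
          · have := hx.1; positivity
          · rw [intervalIntegral.integral_const_mul, integral_id, ha2]
            apply le_of_eq
            field_simp
            ring
  have b2 : ∫⁻ σ in Set.Ioc a A, ENNReal.ofReal (J σ) * ENNReal.ofReal σ⁻¹ ≤
      ENNReal.ofReal (2 * M₃ + K * Real.log (A * √N) * M₄) := by
    have hne : ∀ x ∈ Set.Icc a A, x ≠ 0 := fun x hx => (ha0.trans_le hx.1).ne'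
    have h0 : (0 : ℝ) ∉ Set.uIcc a A := by
      rw [Set.uIcc_of_le haA]; exact fun h => hne 0 h rfl
    calc _ ≤ ∫⁻ σ in Set.Ioc a A, ENNReal.ofReal (4 / N * M₃ * σ ^ (-3 : ℤ) + K * M₄ * σ⁻¹) := by
          refine setLIntegral_mono' measurableSet_Ioc fun σ hσ => ?_
          have hσ0 : 0 < σ := ha0.trans hσ.1
          rw [← ENNReal.ofReal_mul' (by positivity)]
          refine ENNReal.ofReal_le_ofReal ?_
          have h1 := exp_neg_mul_pow_three_le_div (s := σ ^ 2 * N) (by positivity)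
          have h2 : min 1 (σ ^ 2 * N) ≤ 1 := min_le_left _ _
          rw [← div_eq_mul_inv, div_le_iff₀ hσ0]
          calc _ ≤ _ := hJ σ
            _ ≤ (4 / (σ ^ 2 * N)) * M₃ + K * 1 * M₄ := by gcongr
            _ = _ := by
              rw [zpow_neg, show (3 : ℤ) = ((3 : ℕ) : ℤ) from rfl, zpow_natCast]
              field_simp
      _ ≤ _ := by
          have hc1 : ContinuousOn (fun x : ℝ => x ^ (-3 : ℤ)) (Set.Icc a A) :=
            continuousOn_id.zpow₀ _ fun x hx => Or.inl (hne x hx)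
          have hc2 : ContinuousOn (fun x : ℝ => x⁻¹) (Set.Icc a A) := continuousOn_id.inv₀ hne
          refine setLIntegral_Ioc_ofReal_le haA ((hc1.const_mul _).add (hc2.const_mul _))
            (fun x hx => ?_) ?_
          · have := ha0.trans hx.1; positivity
          · rw [intervalIntegral.integral_add, intervalIntegral.integral_const_mul,
              intervalIntegral.integral_const_mul, integral_zpow (Or.inr ⟨by norm_num, h0⟩),
              integral_inv_of_pos ha0 hA0]
            · have e1 : A / a = A * √N := by rw [ha, div_inv_eq_mul]
              have e2 : (A ^ ((-3 : ℤ) + 1) - a ^ ((-3 : ℤ) + 1)) / (((-3 : ℤ) : ℝ) + 1) ≤ N / 2 := by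
                have e3 : a ^ ((-3 : ℤ) + 1) = N := by
                  norm_num [zpow_neg]
                  rw [ha2, inv_inv]
                have e4 : 0 ≤ A ^ ((-3 : ℤ) + 1) := by positivity
                rw [e3, show (((-3 : ℤ) : ℝ) + 1) = -2 by norm_num]
                generalize A ^ ((-3 : ℤ) + 1) = z at e4 ⊢
                linarith
              rw [e1]
              have e5 : 4 / N * M₃ * (N / 2) = 2 * M₃ := by field_simp; ring
              have e6 := mul_le_mul_of_nonneg_left e2 (show 0 ≤ 4 / N * M₃ by positivity)
              rw [e5] at e6
              linarith [show K * M₄ * Real.log (A * √N) = K * Real.log (A * √N) * M₄ by ring]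
            · apply ContinuousOn.intervalIntegrable
              rw [Set.uIcc_of_le haA]
              exact hc1.const_mul _
            · apply ContinuousOn.intervalIntegrable
              rw [Set.uIcc_of_le haA]
              exact hc2.const_mul _
  rw [← Set.Ioc_union_Ioc_eq_Ioc ha0.le haA]
  refine (lintegral_union_le _ _ _).trans ((add_le_add b1 b2).trans ?_)
  rw [← ENNReal.ofReal_add (by positivity) (by positivity)]
  apply ENNReal.ofReal_le_ofReal
  apply le_of_eq
  ring

variable {n : ℕ} {μ : Measure (Euc n)} [IsProbabilityMeasure μ]

lemma IsotropicSphereLaw.lintegral_sphere_charFunDistSq_le (hμ : IsotropicSphereLaw μ)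
    (hn : 2 ≤ n) {T : ℝ} (hT : 1 ≤ T) :
    ∫⁻ θ : Metric.sphere (0 : Euc n) 1, (∫⁻ t in Set.Ioc 0 T,
      ENNReal.ofReal (charFunDistSq μ (t • (θ : Euc n))) * ENNReal.ofReal t⁻¹)
      ∂sphereMeasure n ≤
    ENNReal.ofReal (4 * (5 / 2 * ∫ p : Euc n × Euc n, overlap p.1 p.2 ^ 3 ∂(μ.prod μ) +
      169 * 384 * (1 / 2 + Real.log (4 * T * √n)) *
        ∫ p : Euc n × Euc n, overlap p.1 p.2 ^ 4 ∂(μ.prod μ))) := by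
  have hn0 : 0 < n := by omega
  refine (lintegral_sphere_radial_le hn (F := fun v => ENNReal.ofReal (charFunDistSq μ v))
    measurable_charFunDistSq.ennreal_ofReal T).trans ?_
  rw [ENNReal.ofReal_mul (by norm_num), ENNReal.ofReal_ofNat]
  refine mul_le_mul' le_rfl ?_
  have h1 : ∀ σ : ℝ, ∫⁻ v, ENNReal.ofReal (charFunDistSq μ (σ • v)) ∂stdGaussian (Euc n) =
      ENNReal.ofReal (∫ v, charFunDistSq μ (σ • v) ∂stdGaussian (Euc n)) := fun σ =>
    (ofReal_integral_eq_lintegral_ofReal (hμ.integral_charFunDistSq_smul hn0 σ).1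
      (.of_forall fun v => charFunDistSq_nonneg _ _)).symm
  simp_rw [h1]
  have hs1 : 1 ≤ √(n : ℝ) := Real.one_le_sqrt.2 (by exact_mod_cast hn0)
  refine lintegral_scale_le (by exact_mod_cast hn0) hμ.integral_overlap_pow_three_nonneg
    (integral_nonneg fun p => by positivity) (by norm_num) (by nlinarith) fun σ => ?_
  have h2 := hμ.integral_charFunDistSq_smul_le hn0 σ
  rwa [← mul_assoc (169 : ℝ)] at h2

end

/-! ### Kolmogorov distance and Gaussian smoothing. -/

section

lemma normalCDF_eq_integral (y : ℝ) :
    normalCDF y = ∫ x in Set.Iic y, gaussianPDFReal 0 1 x := by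
  rw [normalCDF, cdf_eq_real, measureReal_def, gaussianReal_apply_eq_integral 0 one_ne_zero,
    ENNReal.toReal_ofReal]
  exact setIntegral_nonneg measurableSet_Iic fun x _ => gaussianPDFReal_nonneg _ _ _

lemma normalCDF_sub (a b : ℝ) :
    normalCDF b - normalCDF a = ∫ x in a..b, gaussianPDFReal 0 1 x := by
  rw [normalCDF_eq_integral, normalCDF_eq_integral]
  exact intervalIntegral.integral_Iic_sub_Iic (integrable_gaussianPDFReal 0 1).integrableOn
    (integrable_gaussianPDFReal 0 1).integrableOn

lemma continuous_gaussianPDFReal : Continuous (gaussianPDFReal 0 1) := by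
  unfold gaussianPDFReal; fun_prop

lemma gaussianPDFReal_standard (x : ℝ) :
    gaussianPDFReal 0 1 x = (√(2 * Real.pi))⁻¹ * Real.exp (-x ^ 2 / 2) := by
  simp [gaussianPDFReal]

lemma hasDerivAt_normalCDF (y : ℝ) : HasDerivAt normalCDF (gaussianPDFReal 0 1 y) y := by
  have h := intervalIntegral.integral_hasDerivAt_right
    (continuous_gaussianPDFReal.intervalIntegrable 0 y)
    (continuous_gaussianPDFReal.stronglyMeasurableAtFilter _ _) continuous_gaussianPDFReal.continuousAt
  have h2 : normalCDF = fun b => normalCDF 0 + ∫ x in (0 : ℝ)..b, gaussianPDFReal 0 1 x := by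
    ext b
    rw [← normalCDF_sub]
    ring
  rw [h2]
  exact h.const_add _

lemma normalCDF_sub_le {a b : ℝ} (hab : a ≤ b) : normalCDF b - normalCDF a ≤ (b - a) / 2 := by
  rw [normalCDF_sub]
  have h : ∀ x, gaussianPDFReal 0 1 x ≤ 1 / 2 := by
    intro x
    rw [gaussianPDFReal_standard]
    have h1 : Real.exp (-x ^ 2 / 2) ≤ 1 := Real.exp_le_one_iff.2 (by nlinarith [sq_nonneg x])
    have h2 : (2 : ℝ) ≤ √(2 * Real.pi) := by
      apply Real.le_sqrt_of_sq_le
      linarith [Real.pi_gt_three]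
    have h3 : (√(2 * Real.pi))⁻¹ ≤ 1 / 2 := by
      rw [one_div]
      exact inv_anti₀ (by norm_num) h2
    calc _ ≤ (1 / 2 : ℝ) * 1 := mul_le_mul h3 h1 (Real.exp_pos _).le (by norm_num)
      _ = _ := by norm_num
  have h2 := intervalIntegral.integral_mono_on hab
    (continuous_gaussianPDFReal.intervalIntegrable a b)
    (continuous_const.intervalIntegrable (μ := volume) a b) fun x _ => h x
  rw [intervalIntegral.integral_const, smul_eq_mul] at h2
  linarith

lemma integral_sq_gaussianReal : ∫ x, x ^ 2 ∂gaussianReal 0 1 = 1 := by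
  rw [← stdGaussian_real]
  have h2 := integral_norm_pow_stdGaussian_add_two ℝ 0
  simp only [pow_zero, integral_const, probReal_univ, Module.finrank_self, smul_eq_mul] at h2
  simpa using h2

lemma integrable_sq_gaussianReal : Integrable (fun x : ℝ => x ^ 2) (gaussianReal 0 1) := by
  have h := integrable_norm_pow_stdGaussian (E := ℝ) 2
  rw [stdGaussian_real] at h
  simpa using h

/-- A monotone function is close to a Lipschitz function if their Gaussian smoothings are. -/
lemma kolmogorovDist_le_of_smoothing {F G : ℝ → ℝ} {s B : ℝ} (hF : Monotone F)
    (hG : Monotone G) (hFG : ∀ x, |F x - G x| ≤ 1)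
    (hL : ∀ a b, a ≤ b → G b - G a ≤ (b - a) / 2) (hs : 0 ≤ s)
    (hB : ∀ x, |∫ z, (F (x - s * z) - G (x - s * z)) ∂gaussianReal 0 1| ≤ B) :
    kolmogorovDist F G ≤ 2 * B + 3 * s := by
  set M := kolmogorovDist F G with hM
  have hbdd : BddAbove (Set.range fun x => |F x - G x|) := ⟨1, by rintro _ ⟨x, rfl⟩; exact hFG x⟩
  have hle : ∀ x, |F x - G x| ≤ M := fun x => le_ciSup hbdd x
  have hM0 : 0 ≤ M := (abs_nonneg _).trans (hle 0)
  have hB0 : 0 ≤ B := (abs_nonneg _).trans (hB 0)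
  have hi : ∀ x, Integrable (fun z => F (x - s * z) - G (x - s * z)) (gaussianReal 0 1) := fun x =>
    Integrable.of_bound (((hF.measurable.comp (by fun_prop)).sub
      (hG.measurable.comp (by fun_prop))).aestronglyMeasurable) 1 (.of_forall fun z => hFG _)
  have hq : ∀ a b : ℝ, Integrable (fun z : ℝ => a - b * (z ^ 2 / 4)) (gaussianReal 0 1) :=
    fun a b => (integrable_const _).sub ((integrable_sq_gaussianReal.div_const _).const_mul _)
  have hqi : ∀ a b : ℝ, ∫ z : ℝ, (a - b * (z ^ 2 / 4)) ∂gaussianReal 0 1 = a - b / 4 := by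
    intro a b
    rw [integral_sub (integrable_const _) ((integrable_sq_gaussianReal.div_const _).const_mul _),
      integral_const_mul, integral_div, integral_sq_gaussianReal]
    simp only [integral_const, probReal_univ, smul_eq_mul]
    ring
  have hz : ∀ z : ℝ, ¬ |z| ≤ 2 → 1 ≤ z ^ 2 / 4 := by
    intro z h
    push Not at h
    nlinarith [sq_abs z]
  have hup : ∀ x, F x - G x ≤ 4 / 3 * (B + M / 4) + 2 * s := by
    intro x
    by_cases hc : F x - G x - 2 * s ≤ 0
    · linarith
    push Not at hc
    set c := F x - G x - 2 * s
    -- For `|z| ≤ 2` the shifted argument lies in `[x, x + 4s]`, where monotonicity of `F` and the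
    -- Lipschitz bound on `G` keep the difference above `c`. Elsewhere it is at least `-M`, and `1 ≤
    -- z²/4` there.
    have h1 : c - (c + M) / 4 ≤ ∫ z, (F (x + 2 * s - s * z) - G (x + 2 * s - s * z))
        ∂gaussianReal 0 1 := by
      rw [← hqi]
      refine integral_mono (hq _ _) (hi _) fun z => ?_
      simp only
      by_cases h : |z| ≤ 2
      · have h2 := abs_le.1 h
        have h3 : F x ≤ F (x + 2 * s - s * z) := hF (by nlinarith [h2.2])
        have h4 : G (x + 2 * s - s * z) ≤ G (x + 4 * s) := hG (by nlinarith [h2.1])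
        have h5 := hL x (x + 4 * s) (by linarith)
        have h6 : 0 ≤ (c + M) * (z ^ 2 / 4) := by positivity
        have h7 : c = F x - G x - 2 * s := rfl
        linarith
      · have h2 := hz z h
        have h3 := (abs_le.1 (hle (x + 2 * s - s * z))).1
        nlinarith [mul_le_mul_of_nonneg_left h2 (show 0 ≤ c + M by positivity)]
    have h2 := (abs_le.1 (hB (x + 2 * s))).2
    have h7 : c = F x - G x - 2 * s := rfl
    linarith
  have hdn : ∀ x, G x - F x ≤ 4 / 3 * (B + M / 4) + 2 * s := by
    intro x
    by_cases hc : G x - F x - 2 * s ≤ 0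
    · linarith
    push Not at hc
    set c := G x - F x - 2 * s
    have h1 : ∫ z, (F (x - 2 * s - s * z) - G (x - 2 * s - s * z)) ∂gaussianReal 0 1 ≤
        -c - (-(c + M)) / 4 := by
      rw [← hqi]
      refine integral_mono (hi _) (hq _ _) fun z => ?_
      simp only
      by_cases h : |z| ≤ 2
      · have h2 := abs_le.1 h
        have h3 : F (x - 2 * s - s * z) ≤ F x := hF (by nlinarith [h2.1])
        have h4 : G (x - 4 * s) ≤ G (x - 2 * s - s * z) := hG (by nlinarith [h2.2])
        have h5 := hL (x - 4 * s) x (by linarith)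
        have h6 : 0 ≤ (c + M) * (z ^ 2 / 4) := by positivity
        have h7 : c = G x - F x - 2 * s := rfl
        linarith
      · have h2 := hz z h
        have h3 := (abs_le.1 (hle (x - 2 * s - s * z))).2
        nlinarith [mul_le_mul_of_nonneg_left h2 (show 0 ≤ c + M by positivity)]
    have h2 := (abs_le.1 (hB (x - 2 * s))).1
    have h7 : c = G x - F x - 2 * s := rfl
    linarith
  -- The term `M/3` on the right is absorbed by the left side, which gives `M ≤ 2B + 3s`.
  have hfin : M ≤ 4 / 3 * (B + M / 4) + 2 * s :=
    ciSup_le fun x => abs_le.2 ⟨by linarith [hdn x], hup x⟩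
  linarith

lemma abs_cdf_sub_cdf_le_one (α β : Measure ℝ) (x : ℝ) : |cdf α x - cdf β x| ≤ 1 := by
  rw [abs_le]
  constructor <;> linarith [cdf_nonneg α x, cdf_nonneg β x, cdf_le_one α x, cdf_le_one β x]

end

/-! ### Fourier bound for the smoothed difference. -/

section

lemma integral_cos_gaussianReal (y : ℝ) :
    ∫ t, Real.cos (t * y) ∂gaussianReal 0 1 = Real.exp (-y ^ 2 / 2) := by
  have h := charFun_gaussianReal (μ := 0) (v := 1) y
  rw [charFun_apply_real] at h
  have h2 := congrArg Complex.re h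
  have hi : Integrable (fun t : ℝ => Complex.exp (y * t * Complex.I)) (gaussianReal 0 1) :=
    Integrable.of_bound (by fun_prop) 1 (.of_forall fun v => by
      rw [← Complex.ofReal_mul, Complex.norm_exp_ofReal_mul_I])
  rw [← RCLike.re_eq_complex_re, ← integral_re hi] at h2
  simp only [RCLike.re_eq_complex_re, ← Complex.ofReal_mul, Complex.exp_ofReal_mul_I_re] at h2
  simp_rw [mul_comm _ y]
  rw [h2]
  have e : (((y * 0 : ℝ) : ℂ) * Complex.I - ((1 : NNReal) : ℂ) * (y : ℂ) ^ 2 / 2) =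
      ((-y ^ 2 / 2 : ℝ) : ℂ) := by push_cast; ring
  rw [e, Complex.exp_ofReal_re]

lemma ae_ne_zero_gaussianReal : ∀ᵐ t ∂gaussianReal 0 1, t ≠ 0 := by
  have := nullSingletonClass_gaussianReal (μ := 0) (v := 1) one_ne_zero
  rw [ae_iff]
  simp

lemma abs_sin_mul_div_le (t y : ℝ) : |Real.sin (t * y) / t| ≤ |y| := by
  rcases eq_or_ne t 0 with rfl | ht
  · simp
  · rw [abs_div, div_le_iff₀ (abs_pos.2 ht), ← abs_mul, mul_comm y]
    exact Real.abs_sin_le_abs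

lemma integrable_sin_mul_div (y : ℝ) :
    Integrable (fun t => Real.sin (t * y) / t) (gaussianReal 0 1) :=
  Integrable.of_bound ((by fun_prop : Measurable fun t => Real.sin (t * y)).div
    measurable_id).aestronglyMeasurable |y| (.of_forall fun t => abs_sin_mul_div_le t y)

/-- The Fourier representation of the normal distribution function. -/
lemma normalCDF_eq_integral_sin (y : ℝ) : normalCDF y = normalCDF 0 +
    (√(2 * Real.pi))⁻¹ * ∫ t, Real.sin (t * y) / t ∂gaussianReal 0 1 := by
  -- The Gaussian is its own Fourier transform up to a constant, so both sides have the same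
  -- derivative in `y`; they agree at `0`.
  have hd : ∀ y : ℝ, HasDerivAt (fun y => ∫ t, Real.sin (t * y) / t ∂gaussianReal 0 1)
      (Real.exp (-y ^ 2 / 2)) y := by
    intro y
    rw [← integral_cos_gaussianReal]
    refine (hasDerivAt_integral_of_dominated_loc_of_deriv_le (bound := fun _ => 1)
      (F' := fun y t => Real.cos (t * y)) Filter.univ_mem
      (.of_forall fun y => (integrable_sin_mul_div y).aestronglyMeasurable)
      (integrable_sin_mul_div y) (by fun_prop)
      (.of_forall fun t y _ => by simpa using Real.abs_cos_le_one _) (integrable_const _) ?_).2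
    filter_upwards [ae_ne_zero_gaussianReal] with t ht y _
    have h := ((Real.hasDerivAt_sin (t * y)).comp y
      ((hasDerivAt_id y).const_mul t)).div_const t
    simp only [mul_one] at h
    rw [mul_div_cancel_right₀ _ ht] at h
    exact h
  set G : ℝ → ℝ := fun y => normalCDF y -
    (√(2 * Real.pi))⁻¹ * ∫ t, Real.sin (t * y) / t ∂gaussianReal 0 1 with hG
  have hGd : ∀ y, HasDerivAt G 0 y := by
    intro y
    have h := (hasDerivAt_normalCDF y).sub ((hd y).const_mul (√(2 * Real.pi))⁻¹)
    rw [gaussianPDFReal_standard, sub_self] at h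
    exact h
  have h := is_const_of_deriv_eq_zero (fun y => (hGd y).differentiableAt)
    (fun y => (hGd y).deriv) y 0
  simp only [hG, mul_zero, Real.sin_zero, zero_div, integral_zero, sub_zero] at h
  linarith

variable {α β : Measure ℝ} [IsProbabilityMeasure α] [IsProbabilityMeasure β]

/-- Both sides are the probability that `U + sZ ≤ x`, conditioned on `Z` and on `U` respectively. -/
lemma integral_cdf_smoothing (x : ℝ) {s : ℝ} (hs : 0 < s) :
    ∫ z, cdf α (x - s * z) ∂gaussianReal 0 1 = ∫ u, normalCDF ((x - u) / s) ∂α := by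
  simp_rw [cdf_eq_integral_step α]
  have hm : Measurable fun p : ℝ × ℝ => step p.2 (x - s * p.1) :=
    measurable_step.comp (measurable_snd.prodMk (by fun_prop))
  have hi : Integrable (fun p : ℝ × ℝ => step p.2 (x - s * p.1)) ((gaussianReal 0 1).prod α) :=
    Integrable.of_bound hm.aestronglyMeasurable 1 (.of_forall fun p => by
      rcases le_or_gt p.2 (x - s * p.1) with h | h <;> simp [step_of_le, step_of_lt, h])
  rw [integral_integral_swap hi]
  refine integral_congr_ae (.of_forall fun u => ?_)
  simp only
  rw [normalCDF, cdf_eq_integral_step]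
  refine integral_congr_ae (.of_forall fun z => ?_)
  simp only
  rcases le_or_gt u (x - s * z) with h | h
  · rw [step_of_le h, step_of_le]
    rw [le_div_iff₀ hs]; linarith
  · rw [step_of_lt h, step_of_lt]
    rw [div_lt_iff₀ hs]; linarith

lemma integrable_sin_prod (hα : Integrable id α) (x : ℝ) {s : ℝ} :
    Integrable (fun p : ℝ × ℝ => Real.sin (p.2 * ((x - p.1) / s)) / p.2)
      (α.prod (gaussianReal 0 1)) := by
  have h1 : Integrable (fun u : ℝ => |(x - u) / s|) α :=
    (((integrable_const x).sub hα).div_const s).abs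
  refine (h1.comp_fst (gaussianReal 0 1)).mono' ((by fun_prop : Measurable fun p : ℝ × ℝ =>
    Real.sin (p.2 * ((x - p.1) / s))).div measurable_snd).aestronglyMeasurable
    (.of_forall fun p => ?_)
  exact abs_sin_mul_div_le _ _

lemma integral_cdf_smoothing_eq (hα : Integrable id α) (x : ℝ) {s : ℝ} (hs : 0 < s) :
    Integrable (fun t => (∫ u, Real.sin (t * ((x - u) / s)) ∂α) / t) (gaussianReal 0 1) ∧
    ∫ z, cdf α (x - s * z) ∂gaussianReal 0 1 = normalCDF 0 + (√(2 * Real.pi))⁻¹ *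
      ∫ t, (∫ u, Real.sin (t * ((x - u) / s)) ∂α) / t ∂gaussianReal 0 1 := by
  have hi := integrable_sin_prod hα x (s := s)
  have h1 := hi.integral_prod_right
  simp only [integral_div] at h1
  refine ⟨h1, ?_⟩
  rw [integral_cdf_smoothing x hs]
  simp_rw [normalCDF_eq_integral_sin ((x - _) / s)]
  rw [integral_add (integrable_const _) (hi.integral_prod_left.const_mul _), integral_const_mul,
    integral_integral_swap hi]
  simp only [integral_const, probReal_univ, one_smul, integral_div]

lemma integral_sin_eq_im (x w : ℝ) : ∫ u, Real.sin (w * (x - u)) ∂α =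
    (Complex.exp ((w * x : ℝ) * Complex.I) * (starRingEnd ℂ) (charFun α w)).im := by
  rw [charFun_apply_real, ← integral_conj, ← integral_const_mul]
  have h : ∀ u : ℝ, Complex.exp ((w * x : ℝ) * Complex.I) *
      (starRingEnd ℂ) (Complex.exp (w * u * Complex.I)) =
      Complex.exp ((w * (x - u) : ℝ) * Complex.I) := by
    intro u
    rw [← Complex.exp_conj, ← Complex.exp_add]
    congr 1
    simp only [map_mul, Complex.conj_ofReal, Complex.conj_I]
    push_cast
    ring
  simp_rw [h]
  have hi : Integrable (fun u : ℝ => Complex.exp ((w * (x - u) : ℝ) * Complex.I)) α :=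
    Integrable.of_bound (by fun_prop) 1 (.of_forall fun v => by
      rw [Complex.norm_exp_ofReal_mul_I])
  rw [← RCLike.im_eq_complex_im, ← integral_im hi]
  simp only [RCLike.im_eq_complex_im, Complex.exp_ofReal_mul_I_im]

lemma abs_integral_sin_sub_le (x t s : ℝ) :
    |∫ u, Real.sin (t * ((x - u) / s)) ∂α - ∫ u, Real.sin (t * ((x - u) / s)) ∂β| ≤
      ‖charFun α (t / s) - charFun β (t / s)‖ := by
  have h : ∀ u : ℝ, t * ((x - u) / s) = t / s * (x - u) := fun u => by ring
  simp_rw [h]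
  rw [integral_sin_eq_im, integral_sin_eq_im, ← Complex.sub_im, ← mul_sub, ← map_sub]
  refine (Complex.abs_im_le_norm _).trans ?_
  rw [norm_mul, Complex.norm_exp_ofReal_mul_I, one_mul, RCLike.norm_conj]

lemma norm_charFun_sub_one_le (hα : Integrable id α) (w : ℝ) :
    ‖charFun α w - 1‖ ≤ |w| * ∫ u, |u| ∂α := by
  have hi : Integrable (fun u : ℝ => Complex.exp (w * u * Complex.I)) α :=
    Integrable.of_bound (by fun_prop) 1 (.of_forall fun v => by
      rw [← Complex.ofReal_mul, Complex.norm_exp_ofReal_mul_I])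
  have h1 : charFun α w - 1 = ∫ u : ℝ, (Complex.exp (w * u * Complex.I) - 1) ∂α := by
    rw [charFun_apply_real, integral_sub hi (integrable_const _)]
    simp
  rw [h1, ← integral_const_mul]
  refine norm_integral_le_of_norm_le (hα.abs.const_mul |w|) (.of_forall fun u => ?_)
  have h2 := Real.norm_exp_I_mul_ofReal_sub_one_le (x := w * u)
  rw [Complex.ofReal_mul, mul_comm Complex.I] at h2
  simpa [abs_mul] using h2

lemma norm_charFun_sub_charFun_le (hα : Integrable id α) (hβ : Integrable id β) (w : ℝ) :
    ‖charFun α w - charFun β w‖ ≤ |w| * (∫ u, |u| ∂α + ∫ u, |u| ∂β) := by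
  have h1 := norm_charFun_sub_one_le hα w
  have h2 := norm_charFun_sub_one_le hβ w
  have h3 := norm_sub_le (charFun α w - 1) (charFun β w - 1)
  rw [sub_sub_sub_cancel_right] at h3
  linarith

lemma integrable_norm_charFun_sub_div (hα : Integrable id α) (hβ : Integrable id β) (s : ℝ) :
    Integrable (fun t => ‖charFun α (t / s) - charFun β (t / s)‖ / |t|) (gaussianReal 0 1) := by
  refine Integrable.of_bound ?_ (|s|⁻¹ * (∫ u, |u| ∂α + ∫ u, |u| ∂β)) (.of_forall fun t => ?_)
  · have h1 : Measurable fun t : ℝ => charFun α (t / s) - charFun β (t / s) :=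
      (measurable_charFun.comp (by fun_prop)).sub (measurable_charFun.comp (by fun_prop))
    exact (h1.norm.div (by fun_prop)).aestronglyMeasurable
  · have h := norm_charFun_sub_charFun_le hα hβ (t / s)
    have h0 : 0 ≤ ∫ u, |u| ∂α + ∫ u, |u| ∂β :=
      add_nonneg (integral_nonneg fun _ => abs_nonneg _) (integral_nonneg fun _ => abs_nonneg _)
    rw [Real.norm_of_nonneg (by positivity)]
    rcases eq_or_ne t 0 with rfl | ht
    · simp only [abs_zero, div_zero]; positivity
    · rw [div_le_iff₀ (abs_pos.2 ht)]
      rw [abs_div] at h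
      exact h.trans_eq (by ring)

/-- The Fourier bound for the Gaussian smoothing of a difference of distribution functions. -/
lemma abs_integral_cdf_sub_smoothing_le (hα : Integrable id α) (hβ : Integrable id β) (x : ℝ)
    {s : ℝ} (hs : 0 < s) :
    |∫ z, (cdf α (x - s * z) - cdf β (x - s * z)) ∂gaussianReal 0 1| ≤ (√(2 * Real.pi))⁻¹ *
      ∫ t, ‖charFun α (t / s) - charFun β (t / s)‖ / |t| ∂gaussianReal 0 1 := by
  have hm : ∀ γ : Measure ℝ, Integrable (fun z => cdf γ (x - s * z)) (gaussianReal 0 1) := fun γ =>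
    Integrable.of_bound (((monotone_cdf γ).measurable.comp (by fun_prop)).aestronglyMeasurable) 1
      (.of_forall fun z => by
        rw [Real.norm_of_nonneg (cdf_nonneg _ _)]; exact cdf_le_one _ _)
  obtain ⟨i1, e1⟩ := integral_cdf_smoothing_eq hα x hs
  obtain ⟨i2, e2⟩ := integral_cdf_smoothing_eq hβ x hs
  rw [integral_sub (hm α) (hm β), e1, e2, add_sub_add_left_eq_sub, ← mul_sub, ← integral_sub i1 i2,
    abs_mul, abs_of_nonneg (by positivity)]
  refine mul_le_mul_of_nonneg_left ?_ (by positivity)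
  rw [← Real.norm_eq_abs]
  refine norm_integral_le_of_norm_le (integrable_norm_charFun_sub_div hα hβ s)
    (.of_forall fun t => ?_)
  rw [← sub_div, norm_div, Real.norm_eq_abs, Real.norm_eq_abs]
  gcongr
  exact abs_integral_sin_sub_le x t s

end

/-! ### Esseen's inequality in squared form. -/

section

lemma integral_abs_le_one {α : Measure ℝ} [IsProbabilityMeasure α] (hα : Integrable id α)
    (hsq : Integrable (fun u : ℝ => u ^ 2) α) (h2 : ∫ u, u ^ 2 ∂α ≤ 1) : ∫ u, |u| ∂α ≤ 1 := by
  have h1 : ∫ u, |u| ∂α ≤ ∫ u, (1 + u ^ 2) / 2 ∂α := by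
    refine integral_mono hα.abs (((integrable_const _).add hsq).div_const 2) fun u => ?_
    simp only
    nlinarith [sq_nonneg (|u| - 1), sq_abs u]
  rw [integral_div, integral_add (integrable_const _) hsq, integral_const, probReal_univ,
    one_smul] at h1
  linarith

lemma measurable_norm_charFun_sub {α β : Measure ℝ} [IsProbabilityMeasure α]
    [IsProbabilityMeasure β] : Measurable fun t : ℝ => ‖charFun α t - charFun β t‖ :=
  (measurable_charFun.sub measurable_charFun).norm

lemma norm_charFun_sub_le_two {α β : Measure ℝ} [IsProbabilityMeasure α]
    [IsProbabilityMeasure β] (t : ℝ) : ‖charFun α t - charFun β t‖ ≤ 2 := by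
  have h1 := norm_charFun_le_one (μ := α) t
  have h2 := norm_charFun_le_one (μ := β) t
  linarith [norm_sub_le (charFun α t) (charFun β t)]

lemma norm_charFun_sub_abs {α β : Measure ℝ} (t : ℝ) :
    ‖charFun α |t| - charFun β |t|‖ = ‖charFun α t - charFun β t‖ := by
  rcases abs_choice t with h | h <;> rw [h]
  rw [charFun_neg, charFun_neg, ← map_sub, RCLike.norm_conj]

/-- The integrand is even, and rescaling moves `s` from the characteristic functions into a Gaussian
cutoff. -/
lemma integral_norm_charFun_sub_div_gaussianReal {α β : Measure ℝ} {s : ℝ} (hs : 0 < s) :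
    ∫ t, ‖charFun α (t / s) - charFun β (t / s)‖ / |t| ∂gaussianReal 0 1 =
      2 * (√(2 * Real.pi))⁻¹ * ∫ t in Set.Ioi (0 : ℝ),
        ‖charFun α t - charFun β t‖ / t * Real.exp (-(s * t) ^ 2 / 2) := by
  set f : ℝ → ℝ := fun r => (√(2 * Real.pi))⁻¹ * (‖charFun α (r / s) - charFun β (r / s)‖ / r *
    Real.exp (-r ^ 2 / 2)) with hf
  rw [integral_gaussianReal_eq_integral_smul one_ne_zero]
  have h1 : ∀ t : ℝ, gaussianPDFReal 0 1 t • (‖charFun α (t / s) - charFun β (t / s)‖ / |t|) =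
      f |t| := by
    intro t
    simp only [hf]
    rw [← norm_charFun_sub_abs (t / s), abs_div, abs_of_pos hs, gaussianPDFReal_standard,
      sq_abs, smul_eq_mul]
    ring
  simp_rw [h1]
  rw [integral_comp_abs]
  have h2 := integral_comp_mul_left_Ioi f 0 hs
  rw [mul_zero, smul_eq_mul, eq_inv_mul_iff_mul_eq₀ hs.ne'] at h2
  rw [← h2, mul_assoc 2]
  congr 1
  rw [← integral_const_mul, ← integral_const_mul]
  refine setIntegral_congr_fun measurableSet_Ioi fun t ht => ?_
  have ht' : t ≠ 0 := (Set.mem_Ioi.1 ht).ne'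
  simp only [hf]
  rw [mul_div_cancel_left₀ _ hs.ne']
  field_simp

lemma integrableOn_of_measurable_of_le {f : ℝ → ℝ} {a b C : ℝ} (hf : Measurable f)
    (hC : ∀ x ∈ Set.Ioc a b, |f x| ≤ C) : IntegrableOn f (Set.Ioc a b) :=
  Measure.integrableOn_of_bounded (by simp) hf.aestronglyMeasurable (M := C)
    ((ae_restrict_mem measurableSet_Ioc).mono hC)

/-- The Cauchy-Schwarz inequality with respect to the measure `dt / t`. -/
lemma sq_setIntegral_div_le {h : ℝ → ℝ} (hm : Measurable h) {C : ℝ} (h0 : ∀ t, 0 ≤ h t)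
    (hC : ∀ t, h t ≤ C) {δ T : ℝ} (hδ : 0 < δ) (hT : δ < T) :
    (∫ t in Set.Ioc δ T, h t / t) ^ 2 ≤
      Real.log (T / δ) * ∫ t in Set.Ioc δ T, h t ^ 2 * t⁻¹ := by
  set I := ∫ t in Set.Ioc δ T, h t / t with hI
  have hL : ∫ t in Set.Ioc δ T, t⁻¹ = Real.log (T / δ) := by
    rw [← intervalIntegral.integral_of_le hT.le, integral_inv_of_pos hδ (hδ.trans hT)]
  have hLpos : 0 < Real.log (T / δ) := Real.log_pos ((one_lt_div hδ).2 hT)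
  set L := Real.log (T / δ)
  have hC0 : 0 ≤ C := (h0 0).trans (hC 0)
  have hinv : ∀ t ∈ Set.Ioc δ T, 0 ≤ t⁻¹ ∧ t⁻¹ ≤ δ⁻¹ := fun t ht =>
    ⟨(inv_pos.2 (hδ.trans ht.1)).le, inv_anti₀ hδ ht.1.le⟩
  have i1 : IntegrableOn (fun t => h t / t) (Set.Ioc δ T) :=
    integrableOn_of_measurable_of_le (C := C * δ⁻¹) (hm.div measurable_id) fun t ht => by
      rw [div_eq_mul_inv, abs_of_nonneg (mul_nonneg (h0 t) (hinv t ht).1)]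
      exact mul_le_mul (hC t) (hinv t ht).2 (hinv t ht).1 hC0
  have i2 : IntegrableOn (fun t => h t ^ 2 * t⁻¹) (Set.Ioc δ T) :=
    integrableOn_of_measurable_of_le (C := C ^ 2 * δ⁻¹) ((hm.pow_const 2).mul measurable_inv)
      fun t ht => by
      rw [abs_of_nonneg (mul_nonneg (sq_nonneg _) (hinv t ht).1)]
      exact mul_le_mul (pow_le_pow_left₀ (h0 t) (hC t) 2) (hinv t ht).2 (hinv t ht).1
        (sq_nonneg _)
  have i3 : IntegrableOn (fun t : ℝ => t⁻¹) (Set.Ioc δ T) :=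
    integrableOn_of_measurable_of_le (C := δ⁻¹) measurable_inv fun t ht => by
      rw [abs_of_nonneg (hinv t ht).1]; exact (hinv t ht).2
  -- `I / L` is the mean of `h` for `dt/t`; Cauchy-Schwarz is nonnegativity of the variance.
  have hnn : 0 ≤ ∫ t in Set.Ioc δ T, (h t - I / L) ^ 2 * t⁻¹ :=
    setIntegral_nonneg measurableSet_Ioc fun t ht => mul_nonneg (sq_nonneg _) (hinv t ht).1
  have he : ∫ t in Set.Ioc δ T, (h t - I / L) ^ 2 * t⁻¹ =
      (∫ t in Set.Ioc δ T, h t ^ 2 * t⁻¹) - 2 * (I / L) * I + (I / L) ^ 2 * L := by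
    have e : ∀ t, (h t - I / L) ^ 2 * t⁻¹ =
        h t ^ 2 * t⁻¹ - 2 * (I / L) * (h t / t) + (I / L) ^ 2 * t⁻¹ := fun t => by ring
    simp_rw [e]
    have i4 : IntegrableOn (fun t => h t ^ 2 * t⁻¹ - 2 * (I / L) * (h t / t)) (Set.Ioc δ T) :=
      i2.sub (i1.const_mul _)
    rw [integral_add i4 (i3.const_mul _), integral_sub i2 (i1.const_mul _), integral_const_mul,
      integral_const_mul, hL]
  rw [he] at hnn
  have e2 : (I / L) ^ 2 * L = (I / L) * I := by field_simp
  have e3 : I ^ 2 = L * ((I / L) * I) := by field_simp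
  rw [e3]
  exact mul_le_mul_of_nonneg_left (by linarith) hLpos.le

lemma exp_neg_sq_div_two_le {y : ℝ} (hy : 0 < y) : Real.exp (-y ^ 2 / 2) ≤ 2 / y ^ 2 := by
  have h1 : 0 < y ^ 2 / 2 := by positivity
  have h2 := Real.add_one_le_exp (y ^ 2 / 2)
  rw [show -y ^ 2 / 2 = -(y ^ 2 / 2) by ring, Real.exp_neg, show 2 / y ^ 2 = (y ^ 2 / 2)⁻¹ by
    field_simp]
  exact inv_anti₀ h1 (by linarith)

/-- Linearity of the bound at `0` handles `(0, δ]`, the cutoff is dropped on `(δ, T]`, and beyond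
`T` it is bounded by `2/(s t)²`. -/
lemma setIntegral_Ioi_div_mul_exp_le {h : ℝ → ℝ} (hm : Measurable h) (h0 : ∀ t, 0 ≤ h t)
    (h2 : ∀ t, h t ≤ 2) (hlin : ∀ t, 0 ≤ t → h t ≤ 2 * t) {δ T s : ℝ} (hδ : 0 < δ)
    (hT : δ < T) (hs : 0 < s) :
    ∫ t in Set.Ioi (0 : ℝ), h t / t * Real.exp (-(s * t) ^ 2 / 2) ≤
      2 * δ + (∫ t in Set.Ioc δ T, h t / t) + 2 / (s * T) ^ 2 := by
  set g : ℝ → ℝ := fun t => h t / t * Real.exp (-(s * t) ^ 2 / 2) with hg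
  have hT0 : 0 < T := hδ.trans hT
  have hgm : Measurable g := (hm.div measurable_id).mul (by fun_prop)
  have hdiv : ∀ t, 0 < t → h t / t ≤ 2 := fun t ht => (div_le_iff₀ ht).2 (hlin t ht.le)
  have hdiv0 : ∀ t, 0 < t → 0 ≤ h t / t := fun t ht => div_nonneg (h0 t) ht.le
  have hexp : ∀ t, Real.exp (-(s * t) ^ 2 / 2) ≤ 1 := fun t =>
    Real.exp_le_one_iff.2 (by nlinarith [sq_nonneg (s * t)])
  have hgle : ∀ t, 0 < t → g t ≤ h t / t := fun t ht =>
    mul_le_of_le_one_right (hdiv0 t ht) (hexp t)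
  have hg0 : ∀ t, 0 < t → 0 ≤ g t := fun t ht => mul_nonneg (hdiv0 t ht) (Real.exp_nonneg _)
  have iA : IntegrableOn g (Set.Ioc 0 δ) :=
    integrableOn_of_measurable_of_le (C := 2) hgm fun t ht => by
      rw [abs_of_nonneg (hg0 t ht.1)]; exact (hgle t ht.1).trans (hdiv t ht.1)
  have iB : IntegrableOn g (Set.Ioc δ T) :=
    integrableOn_of_measurable_of_le (C := 2) hgm fun t ht => by
      have := hδ.trans ht.1
      rw [abs_of_nonneg (hg0 t this)]; exact (hgle t this).trans (hdiv t this)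
  have iB' : IntegrableOn (fun t => h t / t) (Set.Ioc δ T) :=
    integrableOn_of_measurable_of_le (C := 2) (hm.div measurable_id) fun t ht => by
      have := hδ.trans ht.1
      rw [abs_of_nonneg (hdiv0 t this)]; exact hdiv t this
  have hgC : ∀ t ∈ Set.Ioi T, g t ≤ 4 / s ^ 2 * t ^ (-3 : ℝ) := by
    intro t ht
    have ht0 : 0 < t := hT0.trans ht
    have h3 : t ^ (-3 : ℝ) = (t ^ 3)⁻¹ := by
      rw [Real.rpow_neg ht0.le]; norm_cast
    rw [h3]
    calc g t ≤ 2 / t * (2 / (s * t) ^ 2) :=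
          mul_le_mul (div_le_div_of_nonneg_right (h2 t) ht0.le)
            (exp_neg_sq_div_two_le (mul_pos hs ht0)) (Real.exp_nonneg _) (by positivity)
      _ = 4 / s ^ 2 * (t ^ 3)⁻¹ := by field_simp; norm_num
  have ipow : IntegrableOn (fun t : ℝ => 4 / s ^ 2 * t ^ (-3 : ℝ)) (Set.Ioi T) :=
    (integrableOn_Ioi_rpow_of_lt (by norm_num) hT0).const_mul _
  have iC : IntegrableOn g (Set.Ioi T) := by
    refine ipow.mono' hgm.aestronglyMeasurable
      ((ae_restrict_mem measurableSet_Ioi).mono fun t ht => ?_)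
    rw [Real.norm_of_nonneg (hg0 t (hT0.trans ht))]
    exact hgC t ht
  have bA : ∫ t in Set.Ioc 0 δ, g t ≤ 2 * δ := by
    have h3 := setIntegral_mono_on iA (integrableOn_const (C := (2 : ℝ)) (by simp))
      measurableSet_Ioc fun t ht => (hgle t ht.1).trans (hdiv t ht.1)
    rw [setIntegral_const, measureReal_def, Real.volume_Ioc, sub_zero,
      ENNReal.toReal_ofReal hδ.le, smul_eq_mul] at h3
    linarith
  have bB : ∫ t in Set.Ioc δ T, g t ≤ ∫ t in Set.Ioc δ T, h t / t :=
    setIntegral_mono_on iB iB' measurableSet_Ioc fun t ht => hgle t (hδ.trans ht.1)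
  have bC : ∫ t in Set.Ioi T, g t ≤ 2 / (s * T) ^ 2 := by
    refine (setIntegral_mono_on iC ipow measurableSet_Ioi hgC).trans_eq ?_
    rw [integral_const_mul, integral_Ioi_rpow_of_lt (by norm_num) hT0]
    have h3 : T ^ (-3 + 1 : ℝ) = (T ^ 2)⁻¹ := by
      rw [show (-3 + 1 : ℝ) = -2 by norm_num, Real.rpow_neg hT0.le]; norm_cast
    rw [h3]
    field_simp
    norm_num
  have iBC : IntegrableOn g (Set.Ioi δ) := by
    rw [← Set.Ioc_union_Ioi_eq_Ioi hT.le]; exact iB.union iC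
  rw [← Set.Ioc_union_Ioi_eq_Ioi hδ.le, setIntegral_union Set.Ioc_disjoint_Ioi_same
    measurableSet_Ioi iA iBC, ← Set.Ioc_union_Ioi_eq_Ioi hT.le,
    setIntegral_union Set.Ioc_disjoint_Ioi_same measurableSet_Ioi iB iC]
  linarith

/-- Esseen's smoothing inequality for laws with unit second moment, in squared form. -/
lemma sq_kolmogorovDist_le {α : Measure ℝ} [IsProbabilityMeasure α] (hα : Integrable id α)
    (hsq : Integrable (fun u : ℝ => u ^ 2) α) (h2 : ∫ u, u ^ 2 ∂α ≤ 1) {n : ℕ} (hn : 2 ≤ n) :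
    kolmogorovDist (cdf α) normalCDF ^ 2 ≤ 162 / (n : ℝ) ^ 2 + 24 * Real.log n *
      ∫ t in Set.Ioc (n : ℝ)⁻¹ ((n : ℝ) ^ 2),
        ‖charFun α t - charFun (gaussianReal 0 1) t‖ ^ 2 * t⁻¹ := by
  set β := gaussianReal 0 1 with hβ
  have hn2 : (2 : ℝ) ≤ n := by exact_mod_cast hn
  have hn0 : (0 : ℝ) < n := by linarith
  have iβ : Integrable id β := by
    simpa [Function.id_def] using (memLp_id_gaussianReal (μ := 0) (v := 1) 1).integrable le_rfl
  have iβ2 : Integrable (fun u : ℝ => u ^ 2) β := by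
    simpa using (memLp_id_gaussianReal (μ := 0) (v := 1) 2).integrable_sq
  have mα := integral_abs_le_one hα hsq h2
  have mβ := integral_abs_le_one iβ iβ2 integral_sq_gaussianReal.le
  set h : ℝ → ℝ := fun t => ‖charFun α t - charFun β t‖ with hh
  have hlin : ∀ t, 0 ≤ t → h t ≤ 2 * t := fun t ht => by
    have := norm_charFun_sub_charFun_le hα iβ t
    rw [abs_of_nonneg ht] at this
    exact this.trans (by nlinarith)
  -- With `δ = s = 1/n` and `T = n²` all error terms are `O(1/n)`, while `log (T/δ) = 3 log n`.
  have hδ : (0 : ℝ) < (n : ℝ)⁻¹ := inv_pos.2 hn0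
  have hT : (n : ℝ)⁻¹ < (n : ℝ) ^ 2 :=
    (inv_le_one_of_one_le₀ (by linarith)).trans_lt (by nlinarith)
  have h0 : ∀ t, 0 ≤ h t := fun t => norm_nonneg _
  have hle2 : ∀ t, h t ≤ 2 := norm_charFun_sub_le_two
  have hm : Measurable h := measurable_norm_charFun_sub
  have hK := setIntegral_Ioi_div_mul_exp_le hm h0 hle2 hlin hδ hT hδ
  have hCS := sq_setIntegral_div_le hm h0 hle2 hδ hT
  set I := ∫ t in Set.Ioc (n : ℝ)⁻¹ ((n : ℝ) ^ 2), h t / t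
  set V := ∫ t in Set.Ioc (n : ℝ)⁻¹ ((n : ℝ) ^ 2), h t ^ 2 * t⁻¹
  set K := ∫ t in Set.Ioi (0 : ℝ), h t / t * Real.exp (-((n : ℝ)⁻¹ * t) ^ 2 / 2) with hKdef
  have hK0 : 0 ≤ K := setIntegral_nonneg measurableSet_Ioi fun t ht =>
    mul_nonneg (div_nonneg (h0 t) (le_of_lt ht)) (Real.exp_nonneg _)
  have hB : ∀ x, |∫ z, (cdf α (x - (n : ℝ)⁻¹ * z) - normalCDF (x - (n : ℝ)⁻¹ * z))
      ∂gaussianReal 0 1| ≤ K := by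
    intro x
    refine (abs_integral_cdf_sub_smoothing_le hα iβ x hδ).trans ?_
    rw [integral_norm_charFun_sub_div_gaussianReal hδ, ← hKdef]
    have hpi : (√(2 * Real.pi))⁻¹ * (√(2 * Real.pi))⁻¹ = (2 * Real.pi)⁻¹ := by
      rw [← mul_inv, Real.mul_self_sqrt (by positivity)]
    have : (√(2 * Real.pi))⁻¹ * (2 * (√(2 * Real.pi))⁻¹ * K) = Real.pi⁻¹ * K := by
      rw [show (√(2 * Real.pi))⁻¹ * (2 * (√(2 * Real.pi))⁻¹ * K) =
        2 * ((√(2 * Real.pi))⁻¹ * (√(2 * Real.pi))⁻¹) * K by ring, hpi, mul_inv]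
      ring
    rw [this]
    exact mul_le_of_le_one_left hK0 (inv_le_one_of_one_le₀ (by linarith [Real.pi_gt_three]))
  have hρ := kolmogorovDist_le_of_smoothing (monotone_cdf α) (monotone_cdf β)
    (abs_cdf_sub_cdf_le_one α β) (fun a b hab => normalCDF_sub_le hab) hδ.le hB
  have hρ0 : 0 ≤ kolmogorovDist (cdf α) normalCDF := Real.iSup_nonneg fun x => abs_nonneg _
  have hlog : Real.log ((n : ℝ) ^ 2 / (n : ℝ)⁻¹) = 3 * Real.log n := by
    rw [div_inv_eq_mul, ← pow_succ, Real.log_pow]; norm_num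
  rw [hlog] at hCS
  have hsT : 2 / ((n : ℝ)⁻¹ * (n : ℝ) ^ 2) ^ 2 ≤ (n : ℝ)⁻¹ := by
    rw [show (n : ℝ)⁻¹ * (n : ℝ) ^ 2 = n by field_simp, div_le_iff₀ (by positivity)]
    rw [show (n : ℝ)⁻¹ * (n : ℝ) ^ 2 = n by field_simp]
    exact hn2
  -- `9 = 2 * (2 + 1) + 3`: both ends of the frequency range, doubled, and the smoothing error.
  have hfin : kolmogorovDist (cdf α) normalCDF ≤ 2 * I + 9 * (n : ℝ)⁻¹ := by
    have : kolmogorovDist (cdf α) normalCDF ≤ 2 * K + 3 * (n : ℝ)⁻¹ := hρ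
    linarith
  calc kolmogorovDist (cdf α) normalCDF ^ 2 ≤ (2 * I + 9 * (n : ℝ)⁻¹) ^ 2 :=
        pow_le_pow_left₀ hρ0 hfin 2
    _ ≤ 8 * I ^ 2 + 162 * ((n : ℝ)⁻¹) ^ 2 := by nlinarith [sq_nonneg (2 * I - 9 * (n : ℝ)⁻¹)]
    _ ≤ 162 / (n : ℝ) ^ 2 + 24 * Real.log n * V := by
        rw [inv_pow, div_eq_mul_inv]; linarith

end

/-! ### Averaging the squared Kolmogorov distance over the sphere. -/

section

/-- Right continuity reduces the supremum to a countable one, which gives measurability in `θ`. -/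
lemma kolmogorovDist_cdf_eq_iSup_rat (α β : Measure ℝ) :
    kolmogorovDist (cdf α) (cdf β) = ⨆ q : ℚ, |cdf α q - cdf β q| := by
  have hb : BddAbove (Set.range fun q : ℚ => |cdf α q - cdf β q|) :=
    ⟨1, by rintro _ ⟨q, rfl⟩; exact abs_cdf_sub_cdf_le_one α β q⟩
  have hb' : BddAbove (Set.range fun x : ℝ => |cdf α x - cdf β x|) :=
    ⟨1, by rintro _ ⟨q, rfl⟩; exact abs_cdf_sub_cdf_le_one α β q⟩
  refine le_antisymm (ciSup_le fun x => ?_) (ciSup_le fun q => le_ciSup hb' (q : ℝ))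
  by_contra hlt
  push Not at hlt
  have hc : ContinuousWithinAt (fun x => |cdf α x - cdf β x|) (Set.Ici x) x :=
    (((cdf α).right_continuous x).sub ((cdf β).right_continuous x)).abs
  have he := hc.eventually (lt_mem_nhds hlt)
  obtain ⟨u, hu, hsub⟩ := mem_nhdsGE_iff_exists_Ico_subset.1 he
  obtain ⟨q, hq1, hq2⟩ := exists_rat_btwn (Set.mem_Ioi.1 hu)
  exact absurd (le_ciSup hb q) (not_le.2 (hsub ⟨hq1.le, hq2⟩))

variable {n : ℕ} {μ : Measure (Euc n)} [IsProbabilityMeasure μ]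

lemma measurable_cdf_projLaw (x : ℝ) : Measurable fun θ : Euc n => cdf (projLaw μ θ) x := by
  have h : ∀ θ : Euc n, cdf (projLaw μ θ) x = ∫ y, step (inner ℝ θ y) x ∂μ := by
    intro θ
    have hst : Measurable fun a => step a x :=
      measurable_step.comp (measurable_id.prodMk measurable_const)
    rw [cdf_eq_integral_step, projLaw, integral_map (by fun_prop) hst.aestronglyMeasurable]
  simp_rw [h]
  have hm : Measurable fun p : Euc n × Euc n => step (inner ℝ p.1 p.2) x :=
    measurable_step.comp ((by fun_prop : Measurable fun p : Euc n × Euc n =>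
      inner ℝ p.1 p.2).prodMk measurable_const)
  exact hm.stronglyMeasurable.integral_prod_right'.measurable

lemma measurable_kolmogorovDist_projLaw :
    Measurable fun θ : Euc n => kolmogorovDist (cdf (projLaw μ θ)) normalCDF := by
  have h : ∀ θ : Euc n, kolmogorovDist (cdf (projLaw μ θ)) normalCDF =
      ⨆ q : ℚ, |cdf (projLaw μ θ) q - normalCDF q| := fun θ =>
    kolmogorovDist_cdf_eq_iSup_rat (projLaw μ θ) (gaussianReal 0 1)
  simp_rw [h]
  exact Measurable.iSup fun q => ((measurable_cdf_projLaw (q : ℝ)).sub_const _).abs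

lemma kolmogorovDist_cdf_nonneg (F G : ℝ → ℝ) : 0 ≤ kolmogorovDist F G :=
  Real.iSup_nonneg fun _ => abs_nonneg _

lemma kolmogorovDist_cdf_le_one (α : Measure ℝ) : kolmogorovDist (cdf α) normalCDF ≤ 1 :=
  ciSup_le fun x => abs_cdf_sub_cdf_le_one α (gaussianReal 0 1) x

lemma integrable_sq_kolmogorovDist_projLaw (hn : 0 < n) :
    Integrable (fun θ : Metric.sphere (0 : Euc n) 1 =>
      kolmogorovDist (cdf (projLaw μ θ)) normalCDF ^ 2) (sphereMeasure n) := by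
  have := isProbabilityMeasure_sphereMeasure hn
  refine Integrable.of_bound ((measurable_kolmogorovDist_projLaw.comp
    measurable_subtype_coe).pow_const 2).aestronglyMeasurable 1 (.of_forall fun θ => ?_)
  rw [Real.norm_of_nonneg (sq_nonneg _)]
  exact pow_le_one₀ (kolmogorovDist_cdf_nonneg _ _) (kolmogorovDist_cdf_le_one _)

lemma one_half_le_log {x : ℝ} (hx : 2 ≤ x) : 1 / 2 ≤ Real.log x := by
  have := Real.log_two_gt_d9
  have := Real.log_le_log (by norm_num) hx
  linarith

namespace IsotropicSphereLaw

lemma ofReal_sq_kolmogorovDist_projLaw_le (hμ : IsotropicSphereLaw μ) (hn : 2 ≤ n)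
    {θ : Euc n} (hθ : ‖θ‖ = 1) :
    ENNReal.ofReal (kolmogorovDist (cdf (projLaw μ θ)) normalCDF ^ 2) ≤
      ENNReal.ofReal (162 / (n : ℝ) ^ 2) + ENNReal.ofReal (24 * Real.log n) *
        ∫⁻ t in Set.Ioc 0 ((n : ℝ) ^ 2),
          ENNReal.ofReal (charFunDistSq μ (t • θ)) * ENNReal.ofReal t⁻¹ := by
  have hn2 : (2 : ℝ) ≤ n := by exact_mod_cast hn
  have hlog : 0 ≤ Real.log n := Real.log_nonneg (by linarith)
  have hδ : (0 : ℝ) < (n : ℝ)⁻¹ := by positivity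
  have hα := integrable_norm_of_integrable hμ.integrable_norm θ
  have hsq : Integrable (fun u : ℝ => u ^ 2) (projLaw μ θ) := by
    rw [projLaw, integrable_map_measure (by fun_prop) (by fun_prop)]
    have := hμ.integrable_inner_pow θ 2
    simpa only [real_inner_comm, Function.comp_def] using this
  have h2 : ∫ u, u ^ 2 ∂projLaw μ θ ≤ 1 := by
    rw [projLaw, integral_map (by fun_prop) (by fun_prop)]
    have := hμ.integral_inner_sq θ
    simp only [real_inner_comm] at this ⊢
    rw [this, hθ]
    norm_num
  have h := sq_kolmogorovDist_le hα hsq h2 hn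
  have hc : ∀ t : ℝ, ‖charFun (projLaw μ θ) t - charFun (gaussianReal 0 1) t‖ ^ 2 =
      charFunDistSq μ (t • θ) := by
    have key : ∀ (ν : Measure (Euc n)) (t : ℝ), charFun (projLaw ν θ) t = charFun ν (t • θ) := by
      intro ν t
      rw [projLaw, charFun_apply_real, charFun_apply, integral_map (by fun_prop) (by fun_prop)]
      refine integral_congr_ae (.of_forall fun x => ?_)
      simp only [inner_smul_right, real_inner_comm, Complex.ofReal_mul]
    intro t
    rw [← projLaw_stdGaussian hθ, key, key, charFunDistSq]
  simp_rw [hc] at h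
  refine (ENNReal.ofReal_le_ofReal h).trans ?_
  have hnn : ∀ t ∈ Set.Ioc (n : ℝ)⁻¹ ((n : ℝ) ^ 2), 0 ≤ charFunDistSq μ (t • θ) * t⁻¹ :=
    fun t ht => mul_nonneg (charFunDistSq_nonneg _ _) (inv_nonneg.2 (hδ.trans ht.1).le)
  rw [ENNReal.ofReal_add (by positivity)
    (mul_nonneg (by positivity) (setIntegral_nonneg measurableSet_Ioc hnn)),
    ENNReal.ofReal_mul (p := 24 * Real.log n) (by positivity)]
  gcongr
  have hi : IntegrableOn (fun t : ℝ => charFunDistSq μ (t • θ) * t⁻¹)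
      (Set.Ioc (n : ℝ)⁻¹ ((n : ℝ) ^ 2)) := by
    refine integrableOn_of_measurable_of_le (C := 2 ^ 2 * n)
      ((measurable_charFunDistSq.comp (by fun_prop)).mul measurable_inv) fun t ht => ?_
    rw [abs_of_nonneg (hnn t ht), ← hc]
    have ht0 : 0 < t := hδ.trans ht.1
    have : t⁻¹ ≤ n := by rw [inv_le_comm₀ ht0 (by positivity)]; exact ht.1.le
    gcongr
    exact norm_charFun_sub_le_two t
  rw [ofReal_integral_eq_lintegral_ofReal hi
    ((ae_restrict_mem measurableSet_Ioc).mono hnn)]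
  refine (lintegral_mono_set (Set.Ioc_subset_Ioc_left hδ.le)).trans_eq ?_
  refine lintegral_congr fun t => ?_
  rw [ENNReal.ofReal_mul (charFunDistSq_nonneg _ _)]

theorem integral_sphere_sq_kolmogorovDist_le (hμ : IsotropicSphereLaw μ) (hn : 2 ≤ n) :
    ∫ θ : Metric.sphere (0 : Euc n) 1, kolmogorovDist (cdf (projLaw μ θ)) normalCDF ^ 2
      ∂sphereMeasure n ≤
    240 * Real.log n * (∫ p : Euc n × Euc n, overlap p.1 p.2 ^ 3 ∂(μ.prod μ)) +
      4 * 10 ^ 7 * Real.log n ^ 2 * ∫ p : Euc n × Euc n, overlap p.1 p.2 ^ 4 ∂(μ.prod μ) := by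
  have hn0 : 0 < n := by omega
  have hn2 : (2 : ℝ) ≤ n := by exact_mod_cast hn
  have hS := isProbabilityMeasure_sphereMeasure hn0
  have hlog := one_half_le_log hn2
  have hW := hμ.lintegral_sphere_charFunDistSq_le hn (T := (n : ℝ) ^ 2) (by nlinarith)
  have hM3 := hμ.integral_overlap_pow_three_nonneg
  have hM4 := hμ.one_div_sq_le_integral_overlap_pow_four hn0
  set M₃ := ∫ p : Euc n × Euc n, overlap p.1 p.2 ^ 3 ∂(μ.prod μ)
  set M₄ := ∫ p : Euc n × Euc n, overlap p.1 p.2 ^ 4 ∂(μ.prod μ)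
  have hM40 : 0 ≤ M₄ := le_trans (by positivity) hM4
  set L := Real.log n
  set A := 4 * (5 / 2 * M₃ + 169 * 384 * (1 / 2 + Real.log (4 * (n : ℝ) ^ 2 * √n)) * M₄) with hA
  have hsn : √(n : ℝ) ≤ n := Real.sqrt_le_iff.2 ⟨by linarith, by nlinarith⟩
  have hs1 : 1 ≤ √(n : ℝ) := Real.one_le_sqrt.2 (by linarith)
  -- Here `4 ≤ n ^ 2` and `√n ≤ n`; together with `1/2 ≤ L` this gives the factor `6 * L`.
  have hle : Real.log (4 * (n : ℝ) ^ 2 * √n) ≤ 5 * L := by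
    rw [show 5 * L = Real.log ((n : ℝ) ^ 5) by rw [Real.log_pow]; norm_num; rfl]
    refine Real.log_le_log (by positivity) ?_
    calc 4 * (n : ℝ) ^ 2 * √n ≤ (n : ℝ) ^ 2 * (n : ℝ) ^ 2 * n := by gcongr; nlinarith
      _ = (n : ℝ) ^ 5 := by ring
  have hlog0 : 0 ≤ Real.log (4 * (n : ℝ) ^ 2 * √n) := Real.log_nonneg (by nlinarith)
  have hA0 : 0 ≤ A := by positivity
  have hA1 : A ≤ 10 * M₃ + 4 * 169 * 384 * (6 * L) * M₄ := by
    have : (1 / 2 + Real.log (4 * (n : ℝ) ^ 2 * √n)) * M₄ ≤ (6 * L) * M₄ :=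
      mul_le_mul_of_nonneg_right (by linarith) hM40
    rw [hA]
    linarith
  have hmain : ∫ θ : Metric.sphere (0 : Euc n) 1,
      kolmogorovDist (cdf (projLaw μ θ)) normalCDF ^ 2 ∂sphereMeasure n ≤
      162 / (n : ℝ) ^ 2 + 24 * L * A := by
    rw [← ENNReal.ofReal_le_ofReal_iff (by positivity), ofReal_integral_eq_lintegral_ofReal
      (integrable_sq_kolmogorovDist_projLaw hn0) (.of_forall fun θ => sq_nonneg _)]
    refine (lintegral_mono fun θ : Metric.sphere (0 : Euc n) 1 =>
      hμ.ofReal_sq_kolmogorovDist_projLaw_le hn (θ := θ) (by simp)).trans ?_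
    rw [lintegral_add_left measurable_const, lintegral_const, measure_univ, mul_one,
      lintegral_const_mul' _ _ ENNReal.ofReal_ne_top, ENNReal.ofReal_add (by positivity)
      (by positivity), ENNReal.ofReal_mul (p := 24 * L) (by positivity)]
    gcongr
  refine hmain.trans ?_
  -- The smoothing error is absorbed through `M₄ ≥ 1/n²` and `4 L² ≥ 1`. The coefficient of `L² M₄`
  -- is then `648 + 24 * 4 * 169 * 384 * 6 < 4 * 10 ^ 7`.
  have e1 : 162 / (n : ℝ) ^ 2 ≤ 648 * L ^ 2 * M₄ := by
    have h1 : 162 / (n : ℝ) ^ 2 ≤ 162 * M₄ := by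
      rw [div_eq_mul_one_div]; linarith
    have h2 : 162 ≤ 648 * L ^ 2 := by nlinarith
    exact h1.trans (mul_le_mul_of_nonneg_right h2 hM40)
  have e2 : 24 * L * A ≤ 24 * L * (10 * M₃ + 4 * 169 * 384 * (6 * L) * M₄) := by gcongr
  have e3 : 0 ≤ L ^ 2 * M₄ := by positivity
  linarith

end IsotropicSphereLaw

end

/-! ### Passage from the law of `X` to the random vector. -/

section

variable {n : ℕ} {Ω : Type*} [MeasurableSpace Ω] {P : Measure Ω} {X : Ω → Euc n}

lemma isotropicSphereLaw_map (hX : Measurable X) (hiso : IsIsotropic P X)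
    (hmean : ∀ i, ∫ ω, X ω i ∂P = 0) (hnorm : ∀ᵐ ω ∂P, ‖X ω‖ ^ 2 = (n : ℝ)) :
    IsotropicSphereLaw (P.map X) where
  norm_sq := by
    rw [ae_map_iff hX.aemeasurable (measurableSet_eq_fun (by fun_prop) measurable_const)]
    exact hnorm
  cov i j := by
    rw [integral_map hX.aemeasurable (by fun_prop)]
    exact hiso i j
  mean i := by
    rw [integral_map hX.aemeasurable (by fun_prop)]
    exact hmean i

variable [IsProbabilityMeasure P]

lemma weightedCDF_eq_cdf_projLaw (hX : Measurable X) (θ : Euc n) :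
    weightedCDF P X θ = cdf (projLaw (P.map X) θ) := by
  have := Measure.isProbabilityMeasure_map (μ := P) hX.aemeasurable
  funext x
  rw [cdf_eq_real, projLaw, Measure.map_map (by fun_prop) hX, weightedCDF,
    map_measureReal_apply ((by fun_prop : Measurable fun x : Euc n => inner ℝ θ x).comp hX)
      measurableSet_Iic]
  rfl

lemma l2Dist_sq (F G : ℝ → ℝ) : l2Dist F G ^ 2 = ∫ x, (F x - G x) ^ 2 :=
  Real.sq_sqrt (integral_nonneg fun _ => sq_nonneg _)

/-- Nonnegativity of the moment is needed because the real power `1/p` is undone by the `p`-th power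
only on nonnegative numbers. -/
lemma momentFunctional_pow (hX : Measurable X) {p : ℕ} (hp : p ≠ 0)
    (h0 : 0 ≤ ∫ q : Euc n × Euc n, overlap q.1 q.2 ^ p ∂((P.map X).prod (P.map X))) :
    momentFunctional P X p ^ p = (√n) ^ p *
      ∫ q : Euc n × Euc n, overlap q.1 q.2 ^ p ∂((P.map X).prod (P.map X)) := by
  have := Measure.isProbabilityMeasure_map (μ := P) hX.aemeasurable
  have h1 : ∫ q : Euc n × Euc n, overlap q.1 q.2 ^ p ∂((P.map X).prod (P.map X)) =
      (∫ z : Ω × Ω, (inner ℝ (X z.1) (X z.2)) ^ p ∂(P.prod P)) / (n : ℝ) ^ p := by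
    rw [Measure.map_prod_map _ _ hX hX, integral_map (by fun_prop)
      (by unfold overlap; fun_prop), ← integral_div]
    simp [overlap, div_pow]
  rw [h1] at h0 ⊢
  rcases Nat.eq_zero_or_pos n with rfl | hn
  · simp [momentFunctional, hp]
  have hnp : (0 : ℝ) < (n : ℝ) ^ p := by positivity
  have h2 : 0 ≤ ∫ z : Ω × Ω, (inner ℝ (X z.1) (X z.2)) ^ p ∂(P.prod P) := by
    have := mul_nonneg h0 hnp.le
    rwa [div_mul_cancel₀ _ hnp.ne'] at this
  rw [momentFunctional, mul_pow, one_div (p : ℝ), Real.rpow_inv_natCast_pow h2 hp, div_pow, one_pow]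
  have h3 : (n : ℝ) ^ p = √n ^ p * √n ^ p := by
    rw [← mul_pow, Real.mul_self_sqrt (Nat.cast_nonneg n)]
  have h4 : 0 < √(n : ℝ) ^ p := by positivity
  rw [h3]
  field_simp

end

end RandomizedCLT

theorem theorem1p1 :
    ∃ C c₁ c₂ : ℝ, 0 < C ∧ 0 < c₁ ∧ 0 < c₂ ∧
      ∀ (n : ℕ), 2 ≤ n →
      ∀ (Ω : Type*) [MeasurableSpace Ω] (P : Measure Ω) [IsProbabilityMeasure P]
        (X : Ω → EuclideanSpace ℝ (Fin n)),
        Measurable X →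
        RandomizedCLT.IsIsotropic P X →
        (∀ i : Fin n, ∫ ω, X ω i ∂P = 0) →
        (∀ᵐ ω ∂P, ‖X ω‖ ^ 2 = (n : ℝ)) →
        -- the `L²`-distances, and the two averages over the sphere, are well defined and finite
        ((∀ θ : Metric.sphere (0 : EuclideanSpace ℝ (Fin n)) 1,
            Integrable (fun x : ℝ =>
              (RandomizedCLT.weightedCDF P X θ x - RandomizedCLT.normalCDF x) ^ 2)) ∧
          Integrable (fun θ : Metric.sphere (0 : EuclideanSpace ℝ (Fin n)) 1 =>
              RandomizedCLT.l2Dist (RandomizedCLT.weightedCDF P X θ)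
                RandomizedCLT.normalCDF ^ 2) (RandomizedCLT.sphereMeasure n) ∧
          Integrable (fun θ : Metric.sphere (0 : EuclideanSpace ℝ (Fin n)) 1 =>
              RandomizedCLT.kolmogorovDist (RandomizedCLT.weightedCDF P X θ)
                RandomizedCLT.normalCDF ^ 2) (RandomizedCLT.sphereMeasure n)) ∧
        -- the asymptotic expansion of the average squared `L²`-distance
        |(∫ θ : Metric.sphere (0 : EuclideanSpace ℝ (Fin n)) 1,
              RandomizedCLT.l2Dist (RandomizedCLT.weightedCDF P X θ)
                RandomizedCLT.normalCDF ^ 2 ∂(RandomizedCLT.sphereMeasure n))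
            - 1 / (16 * Real.sqrt Real.pi) / (n : ℝ) ^ (3 / 2 : ℝ)
                * RandomizedCLT.momentFunctional P X 3 ^ 3|
          ≤ C * (1 / (n : ℝ) ^ 2 * RandomizedCLT.momentFunctional P X 4 ^ 4) ∧
        -- the bound on the average squared Kolmogorov distance
        (∫ θ : Metric.sphere (0 : EuclideanSpace ℝ (Fin n)) 1,
              RandomizedCLT.kolmogorovDist (RandomizedCLT.weightedCDF P X θ)
                RandomizedCLT.normalCDF ^ 2 ∂(RandomizedCLT.sphereMeasure n))
          ≤ c₁ * Real.log n / (n : ℝ) ^ (3 / 2 : ℝ) * RandomizedCLT.momentFunctional P X 3 ^ 3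
            + c₂ * (Real.log n) ^ 2 / (n : ℝ) ^ 2 * RandomizedCLT.momentFunctional P X 4 ^ 4 := by
  refine ⟨400, 240, 4 * 10 ^ 7, by norm_num, by norm_num, by norm_num, ?_⟩
  intro n hn Ω _ P _ X hX hiso hmean hnorm
  have hn0 : 0 < n := by omega
  have hnR : (0 : ℝ) < n := by exact_mod_cast hn0
  have hμp := Measure.isProbabilityMeasure_map (μ := P) hX.aemeasurable
  have hμ := RandomizedCLT.isotropicSphereLaw_map hX hiso hmean hnorm
  -- The powers of `√n` produced here cancel the denominators `n^{3/2}` and `n²` of the statement,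
  -- leaving the overlap moments.
  have hM3 := RandomizedCLT.momentFunctional_pow hX three_ne_zero
    hμ.integral_overlap_pow_three_nonneg
  have hM4 := RandomizedCLT.momentFunctional_pow hX four_ne_zero
    (le_trans (by positivity) (hμ.one_div_sq_le_integral_overlap_pow_four hn0))
  have h3 : (n : ℝ) ^ (3 / 2 : ℝ) = √n ^ 3 := by
    rw [Real.sqrt_eq_rpow, ← Real.rpow_natCast, ← Real.rpow_mul hnR.le]
    norm_num
  have h4 : √(n : ℝ) ^ 4 = (n : ℝ) ^ 2 := by
    rw [show 4 = 2 * 2 by rfl, pow_mul, Real.sq_sqrt hnR.le]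
  have hs : 0 < √(n : ℝ) := Real.sqrt_pos.2 hnR
  rw [hM3, hM4, h3, h4]
  simp_rw [RandomizedCLT.l2Dist_sq, RandomizedCLT.weightedCDF_eq_cdf_projLaw hX]
  refine ⟨⟨fun θ => (hμ.integral_cdf_projLaw_sub_sq (by simp)).1,
    hμ.integrable_sphere_integral_cdf_sub_sq hn0,
    RandomizedCLT.integrable_sq_kolmogorovDist_projLaw hn0⟩, ?_, ?_⟩
  · have h := hμ.abs_integral_sphere_l2_sub_le hn
    rw [← mul_assoc (1 / (n : ℝ) ^ 2), one_div_mul_cancel (by positivity), one_mul,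
      ← mul_assoc (1 / (16 * √Real.pi) / √n ^ 3), div_mul_cancel₀ _ (by positivity)]
    exact h
  · have h := hμ.integral_sphere_sq_kolmogorovDist_le hn
    rw [← mul_assoc (240 * Real.log n / √n ^ 3), div_mul_cancel₀ _ (by positivity),
      ← mul_assoc (4 * 10 ^ 7 * Real.log n ^ 2 / (n : ℝ) ^ 2), div_mul_cancel₀ _ (by positivity)]
    exact h
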